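/- Let $k$ be a field; all tensor products are over $k$, and Sweedler notation is used: $\Delta(h)=h_1\otimes h_2$ for a comultiplication, $m\mapsto m_{(-1)}\otimes m_{(0)}$ for a left coaction, and $m_{(-1)1}\otimes m_{(-1)2}\otimes m_{(0)}$ for its iterate. **Dual quasi-Hopf algebras.** Let $H$ be a dual quasi-Hopf algebra with bijective antipode. That is, $H$ is a coassociative coalgebra with coalgebra morphisms $H\otimes H\to H$, $a\otimes b\mapsto ab$, and $k\to H$, $1\mapsto 1$, a convolution-invertible $\sigma\in(H\otimes H\otimes H)^*$, a bijective coalgebra anti-morphism $s:H\to H$ and $\alpha,\beta\in H^*$ such that for all $a,b,c,d,h\in H$ $$a_1(b_1c_1)\,\sigma(a_2,b_2,c_2)=\sigma(a_1,b_1,c_1)\,(a_2b_2)c_2,\qquad 1a=a1=a,\qquad \sigma(a,1,b)=\varepsilon(a)\varepsilon(b),$$ $$\sigma(a_1,b_1,c_1d_1)\,\sigma(a_2b_2,c_2,d_2)=\sigma(b_1,c_1,d_1)\,\sigma(a_1,b_2c_2,d_2)\,\sigma(a_2,b_3,c_3),$$ $$s(h_1)\alpha(h_2)h_3=\alpha(h)1,\qquad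 h_1\beta(h_2)s(h_3)=\beta(h)1,$$ $$\sigma(h_1\beta(h_2),s(h_3),\alpha(h_4)h_5)=\sigma^{-1}(s(h_1),\alpha(h_2)h_3,\beta(h_4)s(h_5))=\varepsilon(h).$$ Put $q^R(a,b)=\sigma(a,b_3,s^{-1}(b_1))\,\alpha(s^{-1}(b_2))$ and $p^L(a,b)=\sigma(s^{-1}(a_3),a_1,b)\,\beta(s^{-1}(a_2))$. **Yetter-Drinfeld modules.** A *left-left Yetter-Drinfeld module* is a left $H$-comodule $M$ with a linear map $H\otimes M\to M$, $h\otimes m\mapsto h\cdot m$, such that $1\cdot m=m$ and $$\sigma(h_1,g_1,m_{(-1)})\,\sigma((h_2g_2\cdot m_{(0)})_{(-1)},h_3,g_3)\,(h_2g_2\cdot m_{(0)})_{(0)}=\sigma(h_1,(g_1\cdot m)_{(-1)},g_2)\,h_2\cdot(g_1\cdot m)_{(0)},$$ $$h_1m_{(-1)}\otimes h_2\cdot m_{(0)}=(h_1\cdot m)_{(-1)}h_2\otimes(h_1\cdot m)_{(0)}.$$ A *right-left Yetter-Drinfeld module* is a left $H$-comodule $M$ with a linear map $M\otimes H\to M$,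 $m\otimes h\mapsto m\cdot h$, such that $m\cdot 1=m$ and $$\sigma^{-1}(m_{(-1)},h_1,g_1)\,\sigma^{-1}(h_3,g_3,(m_{(0)}\cdot h_2g_2)_{(-1)})\,(m_{(0)}\cdot h_2g_2)_{(0)}=\sigma^{-1}(h_2,(m\cdot h_1)_{(-1)},g_1)\,(m\cdot h_1)_{(0)}\cdot g_2,$$ $$h_2(m\cdot h_1)_{(-1)}\otimes(m\cdot h_1)_{(0)}=m_{(-1)}h_1\otimes m_{(0)}\cdot h_2.$$ Morphisms are the $H$-colinear maps commuting with the action of $H$. The categories are denoted ${}^H_H\mathcal{YD}$ and ${}^H\mathcal{YD}_H$. **Monoidal structure and braiding.** In both categories the tensor product is $M\otimes N$ with coaction $m\otimes n\mapsto m_{(-1)}n_{(-1)}\otimes(m_{(0)}\otimes n_{(0)})$, the tensor product of morphisms is the usual one, the unit is $k$ with coaction $1\mapsto 1\otimes 1$ and with $h$ acting as $\varepsilon(h)$, the unit constraints are the canonical ones, and the associativity constraint is $(m\otimes n)\otimes p\mapsto\sigma^{-1}(m_{(-1)},n_{(-1)},p_{(-1)})\,m_{(0)}\otimes(n_{(0)}\otimes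 p_{(0)})$. The action on $M\otimes N$ and the braiding are as follows. * In ${}^H_H\mathcal{YD}$: $h\cdot(m\otimes n)=\sigma(h_1,m_{(-1)},n_{(-1)1})\,\sigma^{-1}((h_2\cdot m_{(0)})_{(-1)1},h_3,n_{(-1)2})\,\sigma((h_2\cdot m_{(0)})_{(-1)2},(h_4\cdot n_{(0)})_{(-1)},h_5)\,(h_2\cdot m_{(0)})_{(0)}\otimes(h_4\cdot n_{(0)})_{(0)}$, and the braiding $M\otimes N\to N\otimes M$ is $m\otimes n\mapsto m_{(-1)}\cdot n\otimes m_{(0)}$. * In ${}^H\mathcal{YD}_H$: $(m\otimes n)\cdot h=\sigma^{-1}(m_{(-1)1},n_{(-1)},h_1)\,\sigma(m_{(-1)2},h_3,(n_{(0)}\cdot h_2)_{(-1)1})\,\sigma^{-1}(h_5,(m_{(0)}\cdot h_4)_{(-1)},(n_{(0)}\cdot h_2)_{(-1)2})\,(m_{(0)}\cdot h_4)_{(0)}\otimes(n_{(0)}\cdot h_2)_{(0)}$, and the braiding $d_{M,N}:M\otimes N\to N\otimes M$ is $m\otimes n\mapsto n_{(0)}\otimes m\cdot n_{(-1)}$.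 Let ${}^H\mathcal{YD}_H^{in}$ be ${}^H\mathcal{YD}_H$ with the mirror-reversed braiding $\tilde d_{M,N}=d_{N,M}^{-1}:M\otimes N\to N\otimes M$. **Proposition.** With these structures ${}^H_H\mathcal{YD}$ and ${}^H\mathcal{YD}_H$ are braided monoidal categories, and there is an isomorphism of braided monoidal categories $$T:{}^H\mathcal{YD}_H^{in}\;\cong\;{}^H_H\mathcal{YD}$$ defined as follows: $T(M)=M$ as a left $H$-comodule, with left action $$h\triangleright m=q^R(h_1m_{(-1)1},s(h_6))\,\sigma^{-1}(h_2,m_{(-1)2},s(h_5))\,p^L\big(s(h_3),(m_{(0)}\cdot s(h_4))_{(-1)}\big)\,(m_{(0)}\cdot s(h_4))_{(0)},$$ and $T$ sends each morphism to itself. Explicitly, $T$ is a well-defined functor, it is invertible as a functor (not only up to natural isomorphism), and it is a braided monoidal functor whose structure maps $T(M)\otimes T(N)\to T(M\otimes N)$ and $k\to T(k)$ are identity maps. -/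

import Mathlib

open CategoryTheory Coalgebra WithConv
open scoped TensorProduct

universe u

/-! Sweedler notation is used in the comments: `Δ h = h₁ ⊗ h₂` for the comultiplication of `H`,
and `ρ m = m₋₁ ⊗ m₀` for a left coaction.  Linear forms on `H ⊗ H ⊗ H` are linear forms on
`H ⊗ (H ⊗ H)`. -/

/-! ### Dual quasi-Hopf algebras -/

/-- A dual quasi-bialgebra: a coassociative coalgebra `H` with coalgebra morphisms
`mul : H ⊗ H → H` and `k → H`, `1 ↦ one`, and a convolution-invertible reassociator
`σ ∈ (H ⊗ H ⊗ H)^*`. -/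
class DualQuasiBialgebra (k H : Type u) [Field k] [AddCommGroup H] [Module k H]
    [Coalgebra k H] where
  mul : H ⊗[k] H →ₗ[k] H
  one : H
  σ : H ⊗[k] (H ⊗[k] H) →ₗ[k] k
  σinv : H ⊗[k] (H ⊗[k] H) →ₗ[k] k
  /-- the multiplication is a coalgebra morphism -/
  comul_mul : comul ∘ₗ mul = TensorProduct.map mul mul ∘ₗ comul
  counit_mul : counit ∘ₗ mul = counit (R := k) (A := H ⊗[k] H)
  /-- the unit is a coalgebra morphism -/
  comul_one : comul (R := k) one = one ⊗ₜ[k] one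
  counit_one : counit (R := k) one = 1
  one_mul : ∀ a : H, mul (one ⊗ₜ a) = a
  mul_one : ∀ a : H, mul (a ⊗ₜ one) = a
  /-- `σ * σ⁻¹ = 1 = σ⁻¹ * σ` in the convolution algebra `(H ⊗ H ⊗ H)^*` -/
  σ_mul_σinv : toConv σ * toConv σinv = 1
  σinv_mul_σ : toConv σinv * toConv σ = 1
  /-- `a₁(b₁c₁) σ(a₂,b₂,c₂) = σ(a₁,b₁,c₁) (a₂b₂)c₂` -/
  quasi_assoc :
    (TensorProduct.rid k H).toLinearMap ∘ₗ TensorProduct.map (mul ∘ₗ mul.lTensor H) σ ∘ₗ comul =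
    (TensorProduct.lid k H).toLinearMap ∘ₗ TensorProduct.map σ
      (mul ∘ₗ mul.rTensor H ∘ₗ (TensorProduct.assoc k H H H).symm.toLinearMap) ∘ₗ comul
  /-- `σ(a₁,b₁,c₁d₁) σ(a₂b₂,c₂,d₂) = σ(b₁,c₁,d₁) σ(a₁,b₂c₂,d₂) σ(a₂,b₃,c₃)`, as an identity
  of convolution products of linear forms on `H ⊗ (H ⊗ (H ⊗ H))` -/
  cocycle :
    toConv (σ ∘ₗ (mul.lTensor H).lTensor H) *
      toConv (σ ∘ₗ mul.rTensor (H ⊗[k] H) ∘ₗ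
        (TensorProduct.assoc k H H (H ⊗[k] H)).symm.toLinearMap) =
    toConv ((TensorProduct.lid k k).toLinearMap ∘ₗ TensorProduct.map counit σ) *
      toConv (σ ∘ₗ (mul.rTensor H ∘ₗ (TensorProduct.assoc k H H H).symm.toLinearMap).lTensor H) *
      toConv (σ ∘ₗ (((TensorProduct.rid k H).toLinearMap ∘ₗ counit.lTensor H).lTensor H).lTensor H)
  /-- `σ(a,1,b) = ε(a) ε(b)` -/
  σ_one : ∀ a b : H, σ (a ⊗ₜ (one ⊗ₜ b)) = counit (R := k) a * counit (R := k) b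

section

variable {k H : Type u} [Field k] [AddCommGroup H] [Module k H] [Coalgebra k H]

/-- `contractMid χ h = h₁ ⊗ χ(h₂) h₃`. -/
noncomputable def contractMid (χ : H →ₗ[k] k) : H →ₗ[k] H ⊗[k] H :=
  ((TensorProduct.lid k H).toLinearMap ∘ₗ χ.rTensor H ∘ₗ comul).lTensor H ∘ₗ comul

end

open DualQuasiBialgebra in
/-- A dual quasi-Hopf algebra: a dual quasi-bialgebra with an anti-morphism `s` of the coalgebra
`H` and linear forms `α, β` on `H`. -/
class DualQuasiHopfAlgebra (k H : Type u) [Field k] [AddCommGroup H] [Module k H]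
    [Coalgebra k H] extends DualQuasiBialgebra k H where
  s : H →ₗ[k] H
  α : H →ₗ[k] k
  β : H →ₗ[k] k
  /-- `Δ(s h) = s h₂ ⊗ s h₁` -/
  comul_s : comul ∘ₗ s = TensorProduct.map s s ∘ₗ (TensorProduct.comm k H H).toLinearMap ∘ₗ comul
  counit_s : counit ∘ₗ s = counit (R := k) (A := H)
  /-- `s(h₁) α(h₂) h₃ = α(h) 1` -/
  s_α : ∀ h : H, mul (s.rTensor H (contractMid α h)) = α h • one
  /-- `h₁ β(h₂) s(h₃) = β(h) 1` -/
  β_s : ∀ h : H, mul (s.lTensor H (contractMid β h)) = β h • one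
  /-- `σ(h₁ β(h₂), s(h₃), α(h₄) h₅) = ε(h)` -/
  σ_βα : ∀ h : H, σ ((s.rTensor H ∘ₗ contractMid α).lTensor H (contractMid β h)) =
    counit (R := k) h
  /-- `σ⁻¹(s(h₁), α(h₂) h₃, β(h₄) s(h₅)) = ε(h)` -/
  σinv_αβ : ∀ h : H, σinv (TensorProduct.map s (s.lTensor H ∘ₗ contractMid β) (contractMid α h)) =
    counit (R := k) h

/-- The antipode is bijective. -/
class BijectiveAntipode (k H : Type u) [Field k] [AddCommGroup H] [Module k H] [Coalgebra k H]
    [DualQuasiHopfAlgebra k H] : Prop where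
  bijective : Function.Bijective (DualQuasiHopfAlgebra.s (k := k) (H := H))

/-! ### Coactions

The operations below are given for arbitrary linear maps `ρ : X → C ⊗ X`, written
`x ↦ x₋₁ ⊗ x₀`. -/

section Coactions

variable {k : Type u} [Field k]
  {A C D X Y : Type u} [AddCommGroup A] [Module k A] [AddCommGroup C] [Module k C]
  [AddCommGroup D] [Module k D] [AddCommGroup X] [Module k X] [AddCommGroup Y] [Module k Y]

/-- `x ⊗ y ↦ (x₋₁ ⊗ y₋₁) ⊗ (x₀ ⊗ y₀)`. -/
noncomputable def coactProd (ρ : X →ₗ[k] C ⊗[k] X) (τ : Y →ₗ[k] D ⊗[k] Y) :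
    X ⊗[k] Y →ₗ[k] (C ⊗[k] D) ⊗[k] (X ⊗[k] Y) :=
  (TensorProduct.tensorTensorTensorComm k C X D Y).toLinearMap ∘ₗ TensorProduct.map ρ τ

/-- `x ↦ φ(x₋₁) x₀`. -/
noncomputable def hit (φ : C →ₗ[k] k) (ρ : X →ₗ[k] C ⊗[k] X) : X →ₗ[k] X :=
  (TensorProduct.lid k X).toLinearMap ∘ₗ φ.rTensor X ∘ₗ ρ

/-- `a ⊗ x ↦ (a ⊗ x₋₁) ⊗ x₀`. -/
noncomputable def coactAfter (A : Type u) [AddCommGroup A] [Module k A] (ρ : X →ₗ[k] C ⊗[k] X) :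
    A ⊗[k] X →ₗ[k] (A ⊗[k] C) ⊗[k] X :=
  (TensorProduct.assoc k A C X).symm.toLinearMap ∘ₗ ρ.lTensor A

/-- `x ⊗ a ↦ (x₋₁ ⊗ a) ⊗ x₀`. -/
noncomputable def coactBefore (A : Type u) [AddCommGroup A] [Module k A] (ρ : X →ₗ[k] C ⊗[k] X) :
    X ⊗[k] A →ₗ[k] (C ⊗[k] A) ⊗[k] X :=
  (TensorProduct.rightComm k C X A).toLinearMap ∘ₗ ρ.rTensor A

/-- `a ⊗ x ↦ φ(a, x₋₁) x₀`. -/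
noncomputable def contractAfter (φ : A ⊗[k] C →ₗ[k] k) (ρ : X →ₗ[k] C ⊗[k] X) :
    A ⊗[k] X →ₗ[k] X :=
  (TensorProduct.lid k X).toLinearMap ∘ₗ φ.rTensor X ∘ₗ coactAfter A ρ

/-- `x ⊗ a ↦ φ(x₋₁, a) x₀`. -/
noncomputable def contractBefore (φ : C ⊗[k] A →ₗ[k] k) (ρ : X →ₗ[k] C ⊗[k] X) :
    X ⊗[k] A →ₗ[k] X :=
  (TensorProduct.lid k X).toLinearMap ∘ₗ φ.rTensor X ∘ₗ coactBefore A ρ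

/-- For operators `act h : M → M`, thought of as `m ↦ h · m`, and a coaction of `H` on `X`:
`x ⊗ m ↦ x₋₁ · m ⊗ x₀`. -/
noncomputable def crossLeft {H M : Type u} [AddCommGroup H] [Module k H] [AddCommGroup M]
    [Module k M] (act : H →ₗ[k] M →ₗ[k] M) (τ : X →ₗ[k] H ⊗[k] X) :
    X ⊗[k] M →ₗ[k] M ⊗[k] X :=
  (TensorProduct.lift act).rTensor X ∘ₗ (TensorProduct.assoc k H M X).symm.toLinearMap ∘ₗ
    (TensorProduct.comm k X M).toLinearMap.lTensor H ∘ₗ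
    (TensorProduct.assoc k H X M).toLinearMap ∘ₗ τ.rTensor M

/-- For operators `act h : M → M`, thought of as `m ↦ m · h`, and a coaction of `H` on `X`:
`m ⊗ x ↦ x₀ ⊗ m · x₋₁`. -/
noncomputable def crossRight {H M : Type u} [AddCommGroup H] [Module k H] [AddCommGroup M]
    [Module k M] (act : H →ₗ[k] M →ₗ[k] M) (τ : X →ₗ[k] H ⊗[k] X) :
    M ⊗[k] X →ₗ[k] X ⊗[k] M :=
  (TensorProduct.comm k M X).toLinearMap ∘ₗ (TensorProduct.lift act.flip).rTensor X ∘ₗ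
    (TensorProduct.assoc k M H X).symm.toLinearMap ∘ₗ τ.lTensor M

end Coactions

/-! ### Spaces with a coaction and an action -/

/-- A `k`-space `M` with a linear map `M → H ⊗ M` and a linear operator `act h` on `M`
for each `h ∈ H` (linear in `h`), to be read as `m ↦ h · m` for left actions and as
`m ↦ m · h` for right actions. No axioms are imposed here: the Yetter-Drinfeld axioms
are the predicates `IsLeftLeftYD` and `IsRightLeftYD` below. -/
structure YDData (k H : Type u) [Field k] [AddCommGroup H] [Module k H] where
  carrier : Type u
  [addCommGroup : AddCommGroup carrier]
  [module : Module k carrier]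
  coact : carrier →ₗ[k] H ⊗[k] carrier
  act : H →ₗ[k] carrier →ₗ[k] carrier

namespace YDData

attribute [instance] YDData.addCommGroup YDData.module

section

variable {k H : Type u} [Field k] [AddCommGroup H] [Module k H]

/-- `f` is colinear and commutes with the operators of `H`. -/
structure IsHom (M N : YDData k H) (f : M.carrier →ₗ[k] N.carrier) : Prop where
  coact : N.coact ∘ₗ f = f.lTensor H ∘ₗ M.coact
  act : ∀ h m, f (M.act h m) = N.act h (f m)

/-- Morphisms: `H`-colinear and `H`-linear maps. -/
@[ext]
structure Hom (M N : YDData k H) where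
  lin : M.carrier →ₗ[k] N.carrier
  isHom : IsHom M N lin

noncomputable instance : Category (YDData k H) where
  Hom := Hom
  id M := ⟨LinearMap.id, ⟨by ext; simp, fun _ _ => rfl⟩⟩
  comp f g := ⟨g.lin ∘ₗ f.lin, ⟨by
    rw [← LinearMap.comp_assoc, g.isHom.coact, LinearMap.comp_assoc, f.isHom.coact,
      LinearMap.lTensor_comp, LinearMap.comp_assoc], fun h m => by
    simp [f.isHom.act, g.isHom.act]⟩⟩

/-- A bijective morphism is an isomorphism. -/
noncomputable def isoOfBijective {M N : YDData k H} (f : M ⟶ N)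
    (hf : Function.Bijective f.lin) : M ≅ N where
  hom := f
  inv := ⟨(LinearEquiv.ofBijective f.lin hf).symm.toLinearMap, by
    set e := LinearEquiv.ofBijective f.lin hf with he
    have hfe : f.lin = e.toLinearMap := rfl
    refine ⟨?_, fun h n => ?_⟩
    · have h := f.isHom.coact
      rw [hfe] at h
      have h2 : e.symm.toLinearMap.lTensor H ∘ₗ (N.coact ∘ₗ e.toLinearMap) ∘ₗ
          e.symm.toLinearMap = M.coact ∘ₗ e.symm.toLinearMap := by
        rw [h, ← LinearMap.comp_assoc, ← LinearMap.comp_assoc, ← LinearMap.lTensor_comp]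
        simp
      rw [← h2, LinearMap.comp_assoc]
      simp
    · apply e.injective
      have h1 := f.isHom.act h (e.symm n)
      rw [hfe] at h1
      simpa using h1.symm⟩
  hom_inv_id := Hom.ext (LinearMap.ext fun m =>
    (LinearEquiv.ofBijective f.lin hf).symm_apply_apply m)
  inv_hom_id := Hom.ext (LinearMap.ext fun m =>
    (LinearEquiv.ofBijective f.lin hf).apply_symm_apply m)

/-- `coact` is a coassociative and counital left coaction. -/
structure IsComodule [Coalgebra k H] (M : YDData k H) : Prop where
  coassoc : M.coact.lTensor H ∘ₗ M.coact =
    (TensorProduct.assoc k H H M.carrier).toLinearMap ∘ₗ comul.rTensor M.carrier ∘ₗ M.coact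
  counit : (TensorProduct.lid k M.carrier).toLinearMap ∘ₗ counit.rTensor M.carrier ∘ₗ M.coact =
    LinearMap.id

end

end YDData

/-! ### The comodule structures and associativity constraint on tensor products -/

section TensorData

open DualQuasiBialgebra

variable {k H : Type u} [Field k] [AddCommGroup H] [Module k H] [Coalgebra k H]
  [DualQuasiBialgebra k H]

/-- The coaction on a tensor product: `x ⊗ y ↦ x₋₁ y₋₁ ⊗ (x₀ ⊗ y₀)`. -/
noncomputable def tensorCoact {X Y : Type u} [AddCommGroup X] [Module k X] [AddCommGroup Y]
    [Module k Y] (ρ : X →ₗ[k] H ⊗[k] X) (τ : Y →ₗ[k] H ⊗[k] Y) :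
    X ⊗[k] Y →ₗ[k] H ⊗[k] (X ⊗[k] Y) :=
  mul.rTensor (X ⊗[k] Y) ∘ₗ coactProd ρ τ

/-- `x ⊗ (y ⊗ z) ↦ φ(x₋₁, y₋₁, z₋₁) x₀ ⊗ (y₀ ⊗ z₀)`. -/
noncomputable def twist (φ : H ⊗[k] (H ⊗[k] H) →ₗ[k] k) {X Y Z : Type u}
    [AddCommGroup X] [Module k X] [AddCommGroup Y] [Module k Y] [AddCommGroup Z] [Module k Z]
    (ρ : X →ₗ[k] H ⊗[k] X) (τ : Y →ₗ[k] H ⊗[k] Y) (υ : Z →ₗ[k] H ⊗[k] Z) :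
    X ⊗[k] (Y ⊗[k] Z) →ₗ[k] X ⊗[k] (Y ⊗[k] Z) :=
  hit φ (coactProd ρ (coactProd τ υ))

/-- The associativity constraint of left comodules:
`(x ⊗ y) ⊗ z ↦ σ⁻¹(x₋₁, y₋₁, z₋₁) x₀ ⊗ (y₀ ⊗ z₀)`. -/
noncomputable def assocMap {X Y Z : Type u}
    [AddCommGroup X] [Module k X] [AddCommGroup Y] [Module k Y] [AddCommGroup Z] [Module k Z]
    (ρ : X →ₗ[k] H ⊗[k] X) (τ : Y →ₗ[k] H ⊗[k] Y) (υ : Z →ₗ[k] H ⊗[k] Z) :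
    (X ⊗[k] Y) ⊗[k] Z →ₗ[k] X ⊗[k] (Y ⊗[k] Z) :=
  twist σinv ρ τ υ ∘ₗ (TensorProduct.assoc k X Y Z).toLinearMap

/-- The inverse associativity constraint:
`x ⊗ (y ⊗ z) ↦ σ(x₋₁, y₋₁, z₋₁) (x₀ ⊗ y₀) ⊗ z₀`. -/
noncomputable def assocInvMap {X Y Z : Type u}
    [AddCommGroup X] [Module k X] [AddCommGroup Y] [Module k Y] [AddCommGroup Z] [Module k Z]
    (ρ : X →ₗ[k] H ⊗[k] X) (τ : Y →ₗ[k] H ⊗[k] Y) (υ : Z →ₗ[k] H ⊗[k] Z) :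
    X ⊗[k] (Y ⊗[k] Z) →ₗ[k] (X ⊗[k] Y) ⊗[k] Z :=
  (TensorProduct.assoc k X Y Z).symm.toLinearMap ∘ₗ twist σ ρ τ υ

/-! ### Yetter-Drinfeld modules -/

/-- Left-left Yetter-Drinfeld modules; `act h m` is `h · m`. -/
structure IsLeftLeftYD (M : YDData k H) : Prop extends M.IsComodule where
  /-- `σ(h₁, g₁, m₋₁) σ((h₂g₂ · m₀)₋₁, h₃, g₃) (h₂g₂ · m₀)₀ = σ(h₁, (g₁ · m)₋₁, g₂) h₂ · (g₁ · m)₀` -/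
  act_act : ∀ (h g : H) (m : M.carrier),
    contractBefore σ M.coact (crossLeft M.act (tensorCoact comul comul)
      (assocInvMap comul comul M.coact (h ⊗ₜ (g ⊗ₜ m)))) =
    TensorProduct.lift M.act (contractBefore (σ ∘ₗ (TensorProduct.assoc k H H H).toLinearMap)
      (coactProd comul M.coact) ((TensorProduct.assoc k H M.carrier H).symm
        (h ⊗ₜ crossLeft M.act comul (g ⊗ₜ m))))
  /-- `1 · m = m` -/
  one_act : ∀ m : M.carrier, M.act (one k) m = m
  /-- `h₁ m₋₁ ⊗ h₂ · m₀ = (h₁ · m)₋₁ h₂ ⊗ (h₁ · m)₀` -/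
  compat : ∀ (h : H) (m : M.carrier),
    TensorProduct.map mul (TensorProduct.lift M.act) (coactProd comul M.coact (h ⊗ₜ m)) =
    mul.rTensor M.carrier (coactBefore H M.coact (crossLeft M.act comul (h ⊗ₜ m)))

/-- Right-left Yetter-Drinfeld modules (right action, left coaction); `act h m` is `m · h`. -/
structure IsRightLeftYD (M : YDData k H) : Prop extends M.IsComodule where
  /-- `σ⁻¹(m₋₁, h₁, g₁) σ⁻¹(h₃, g₃, (m₀ · h₂g₂)₋₁) (m₀ · h₂g₂)₀ =
  σ⁻¹(h₂, (m · h₁)₋₁, g₁) (m · h₁)₀ · g₂` -/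
  act_act : ∀ (h g : H) (m : M.carrier),
    contractAfter (σinv ∘ₗ (TensorProduct.assoc k H H H).toLinearMap) M.coact
      (crossRight M.act (tensorCoact comul comul)
        (assocMap M.coact comul comul ((m ⊗ₜ h) ⊗ₜ g))) =
    TensorProduct.lift M.act.flip (contractAfter σinv (coactProd M.coact comul)
      (TensorProduct.assoc k H M.carrier H (crossRight M.act comul (m ⊗ₜ h) ⊗ₜ g)))
  /-- `m · 1 = m` -/
  act_one : ∀ m : M.carrier, M.act (one k) m = m
  /-- `h₂ (m · h₁)₋₁ ⊗ (m · h₁)₀ = m₋₁ h₁ ⊗ m₀ · h₂` -/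
  compat : ∀ (h : H) (m : M.carrier),
    mul.rTensor M.carrier (coactAfter H M.coact (crossRight M.act comul (m ⊗ₜ h))) =
    TensorProduct.map mul (TensorProduct.lift M.act.flip) (coactProd M.coact comul (m ⊗ₜ h))

/-- The left action on `M ⊗ N`:
`h · (m ⊗ n) = σ(h₁, m₋₁, n₋₁₁) σ⁻¹((h₂ · m₀)₋₁₁, h₃, n₋₁₂)
  σ((h₂ · m₀)₋₁₂, (h₄ · n₀)₋₁, h₅) (h₂ · m₀)₀ ⊗ (h₄ · n₀)₀`. -/
noncomputable def leftTensorAct (M N : YDData k H) :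
    H →ₗ[k] M.carrier ⊗[k] N.carrier →ₗ[k] M.carrier ⊗[k] N.carrier :=
  TensorProduct.curry <|
    contractBefore (σ ∘ₗ (TensorProduct.assoc k H H H).toLinearMap)
      (coactProd M.coact N.coact) ∘ₗ
    (TensorProduct.assoc k M.carrier N.carrier H).symm.toLinearMap ∘ₗ
    (crossLeft N.act comul).lTensor M.carrier ∘ₗ
    assocMap M.coact comul N.coact ∘ₗ
    (crossLeft M.act comul).rTensor N.carrier ∘ₗ
    assocInvMap comul M.coact N.coact

/-- The right action on `M ⊗ N`:
`(m ⊗ n) · h = σ⁻¹(m₋₁₁, n₋₁, h₁) σ(m₋₁₂, h₃, (n₀ · h₂)₋₁₁)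
  σ⁻¹(h₅, (m₀ · h₄)₋₁, (n₀ · h₂)₋₁₂) (m₀ · h₄)₀ ⊗ (n₀ · h₂)₀`. -/
noncomputable def rightTensorAct (M N : YDData k H) :
    H →ₗ[k] M.carrier ⊗[k] N.carrier →ₗ[k] M.carrier ⊗[k] N.carrier :=
  (TensorProduct.curry <|
    contractAfter σinv (coactProd M.coact N.coact) ∘ₗ
    (TensorProduct.assoc k H M.carrier N.carrier).toLinearMap ∘ₗ
    (crossRight M.act comul).rTensor N.carrier ∘ₗ
    assocInvMap M.coact comul N.coact ∘ₗ
    (crossRight N.act comul).lTensor M.carrier ∘ₗ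
    assocMap M.coact N.coact comul).flip

end TensorData

/-! ### The two braided monoidal categories -/

/-- One of the kinds of Yetter-Drinfeld modules with a left coaction: its axioms, its action
on tensor products and its braiding `M ⊗ N → N ⊗ M`. -/
structure YDKind (k H : Type u) [Field k] [AddCommGroup H] [Module k H] where
  prop : ObjectProperty (YDData k H)
  tensorAct : ∀ M N : YDData k H,
    H →ₗ[k] M.carrier ⊗[k] N.carrier →ₗ[k] M.carrier ⊗[k] N.carrier
  braid : ∀ M N : YDData k H, M.carrier ⊗[k] N.carrier →ₗ[k] N.carrier ⊗[k] M.carrier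

section

variable (k H : Type u) [Field k] [AddCommGroup H] [Module k H] [Coalgebra k H]
  [DualQuasiBialgebra k H]

/-- Left-left Yetter-Drinfeld modules, with the braiding `m ⊗ n ↦ m₋₁ · n ⊗ m₀`. -/
noncomputable abbrev leftLeft : YDKind k H where
  prop := IsLeftLeftYD
  tensorAct := leftTensorAct
  braid M N := crossLeft N.act M.coact

/-- Right-left Yetter-Drinfeld modules, with the braiding `m ⊗ n ↦ n₀ ⊗ m · n₋₁`. -/
noncomputable abbrev rightLeft : YDKind k H where
  prop := IsRightLeftYD
  tensorAct := rightTensorAct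
  braid M N := crossRight M.act N.coact

/-- The unit object `k`, with `1 ↦ 1_H ⊗ 1` and with `H` acting through `ε`. -/
noncomputable abbrev unitData : YDData k H where
  carrier := k
  coact := LinearMap.toSpanSingleton k (H ⊗[k] k) (DualQuasiBialgebra.one k ⊗ₜ 1)
  act := LinearMap.mul k k ∘ₗ counit

end

namespace YDKind

variable {k H : Type u} [Field k] [AddCommGroup H] [Module k H] [Coalgebra k H]
  [DualQuasiBialgebra k H]

/-- The category of Yetter-Drinfeld modules of the given kind: all objects satisfying the axioms,
with the linear and colinear maps as morphisms. -/
abbrev Mod (K : YDKind k H) := K.prop.FullSubcategory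

/-- The tensor product of two objects. -/
noncomputable abbrev tensor (K : YDKind k H) (M N : YDData k H) : YDData k H where
  carrier := M.carrier ⊗[k] N.carrier
  coact := tensorCoact M.coact N.coact
  act := K.tensorAct M N

/-- The tensor product, the unit object, and the constraints stay within the category. -/
structure IsClosed (K : YDKind k H) : Prop where
  tensor : ∀ M N : K.Mod, K.prop (K.tensor M.obj N.obj)
  unit : K.prop (unitData k H)
  map : ∀ (M M' N N' : K.Mod) (f : M ⟶ M') (g : N ⟶ N'),
    YDData.IsHom (K.tensor M.obj N.obj) (K.tensor M'.obj N'.obj)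
      (TensorProduct.map f.hom.lin g.hom.lin)
  assoc : ∀ M N P : K.Mod,
    YDData.IsHom (K.tensor (K.tensor M.obj N.obj) P.obj) (K.tensor M.obj (K.tensor N.obj P.obj))
      (assocMap M.obj.coact N.obj.coact P.obj.coact)
  assoc_bijective : ∀ M N P : K.Mod,
    Function.Bijective (assocMap M.obj.coact N.obj.coact P.obj.coact)
  leftUnit : ∀ M : K.Mod, YDData.IsHom (K.tensor (unitData k H) M.obj) M.obj
    (TensorProduct.lid k M.obj.carrier).toLinearMap
  rightUnit : ∀ M : K.Mod, YDData.IsHom (K.tensor M.obj (unitData k H)) M.obj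
    (TensorProduct.rid k M.obj.carrier).toLinearMap

/-- Tensor products of objects and morphisms, the unit object `k`, the associativity constraint
given by `σ⁻¹`, and the canonical unit constraints. -/
noncomputable abbrev IsClosed.monoidalStruct {K : YDKind k H} (h : K.IsClosed) :
    MonoidalCategoryStruct K.Mod where
  tensorObj M N := ⟨K.tensor M.obj N.obj, h.tensor M N⟩
  tensorUnit := ⟨unitData k H, h.unit⟩
  tensorHom f g := ObjectProperty.homMk
    ⟨TensorProduct.map f.hom.lin g.hom.lin, h.map _ _ _ _ f g⟩
  whiskerLeft M _ _ g := ObjectProperty.homMk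
    ⟨TensorProduct.map LinearMap.id g.hom.lin, h.map _ _ _ _ (𝟙 M) g⟩
  whiskerRight f N := ObjectProperty.homMk
    ⟨TensorProduct.map f.hom.lin LinearMap.id, h.map _ _ _ _ f (𝟙 N)⟩
  associator M N P := ObjectProperty.isoMk _
    (YDData.isoOfBijective ⟨_, h.assoc M N P⟩ (h.assoc_bijective M N P))
  leftUnitor M := ObjectProperty.isoMk _
    (YDData.isoOfBijective ⟨_, h.leftUnit M⟩ (TensorProduct.lid k M.obj.carrier).bijective)
  rightUnitor M := ObjectProperty.isoMk _
    (YDData.isoOfBijective ⟨_, h.rightUnit M⟩ (TensorProduct.rid k M.obj.carrier).bijective)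

/-- The above structure satisfies the axioms of a monoidal category. -/
structure IsMonoidal (K : YDKind k H) : Prop extends K.IsClosed where
  laws : ∃ m : MonoidalCategory K.Mod, m.toMonoidalCategoryStruct = toIsClosed.monoidalStruct

/-- The resulting monoidal category. -/
noncomputable abbrev IsMonoidal.monoidalCategory {K : YDKind k H} (h : K.IsMonoidal) :
    MonoidalCategory K.Mod where
  __ := h.toIsClosed.monoidalStruct
  tensorHom_def := by obtain ⟨m, hm⟩ := h.laws; rw [← hm]; exact m.tensorHom_def
  id_tensorHom_id := by obtain ⟨m, hm⟩ := h.laws; rw [← hm]; exact m.id_tensorHom_id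
  tensorHom_comp_tensorHom := by
    obtain ⟨m, hm⟩ := h.laws; rw [← hm]; exact m.tensorHom_comp_tensorHom
  whiskerLeft_id := by obtain ⟨m, hm⟩ := h.laws; rw [← hm]; exact m.whiskerLeft_id
  id_whiskerRight := by obtain ⟨m, hm⟩ := h.laws; rw [← hm]; exact m.id_whiskerRight
  associator_naturality := by obtain ⟨m, hm⟩ := h.laws; rw [← hm]; exact m.associator_naturality
  leftUnitor_naturality := by obtain ⟨m, hm⟩ := h.laws; rw [← hm]; exact m.leftUnitor_naturality
  rightUnitor_naturality := by obtain ⟨m, hm⟩ := h.laws; rw [← hm]; exact m.rightUnitor_naturality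
  pentagon := by obtain ⟨m, hm⟩ := h.laws; rw [← hm]; exact m.pentagon
  triangle := by obtain ⟨m, hm⟩ := h.laws; rw [← hm]; exact m.triangle

/-- The above monoidal category is braided, with the braiding prescribed by `K.braid`. -/
structure IsBraidedMonoidal (K : YDKind k H) : Prop extends K.IsMonoidal where
  braided : ∃ b : @BraidedCategory K.Mod _ toIsMonoidal.monoidalCategory,
    ∀ M N : K.Mod, (b.braiding M N).hom.hom.lin = K.braid M.obj N.obj

/-- The resulting braiding. -/
noncomputable abbrev IsBraidedMonoidal.braidedCategory {K : YDKind k H}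
    (h : K.IsBraidedMonoidal) : @BraidedCategory K.Mod _ h.toIsMonoidal.monoidalCategory :=
  h.braided.choose

end YDKind

/-! ### The functor from right-left to left-left Yetter-Drinfeld modules -/

section Transfer

open DualQuasiBialgebra DualQuasiHopfAlgebra

variable (k : Type u) {H : Type u} [Field k] [AddCommGroup H] [Module k H] [Coalgebra k H]
  [DualQuasiHopfAlgebra k H]

/-- The inverse of the antipode. -/
noncomputable def antipodeInv [BijectiveAntipode k H] : H →ₗ[k] H :=
  (LinearEquiv.ofBijective (s (k := k) (H := H)) BijectiveAntipode.bijective).symm.toLinearMap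

/-- `q^R(a, b) = σ(a, b₃, s⁻¹(b₁)) α(s⁻¹(b₂))`. -/
noncomputable def qR [BijectiveAntipode k H] : H ⊗[k] H →ₗ[k] k :=
  σ ∘ₗ ((TensorProduct.comm k H H).toLinearMap ∘ₗ (antipodeInv k).rTensor H ∘ₗ
    contractMid (α ∘ₗ antipodeInv k)).lTensor H

/-- `p^L(a, b) = σ(s⁻¹(a₃), a₁, b) β(s⁻¹(a₂))`. -/
noncomputable def pL [BijectiveAntipode k H] : H ⊗[k] H →ₗ[k] k :=
  σ ∘ₗ (TensorProduct.assoc k H H H).toLinearMap ∘ₗ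
    ((antipodeInv k).rTensor H ∘ₗ (TensorProduct.comm k H H).toLinearMap ∘ₗ
      contractMid (β ∘ₗ antipodeInv k)).rTensor H

/-- `h ↦ (h₁ ⊗ s(h₃)) ⊗ h₂`. -/
noncomputable def outerCoact : H →ₗ[k] (H ⊗[k] H) ⊗[k] H :=
  (s.lTensor H).rTensor H ∘ₗ (TensorProduct.assoc k H H H).symm.toLinearMap ∘ₗ
    ((TensorProduct.comm k H H).toLinearMap ∘ₗ comul).lTensor H ∘ₗ comul

variable {k}

/-- `h ⊗ m ↦ φ(h₁, m₋₁, s(h₃)) h₂ ⊗ m₀`. -/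
noncomputable def outerTwist (φ : H ⊗[k] (H ⊗[k] H) →ₗ[k] k) (M : YDData k H) :
    H ⊗[k] M.carrier →ₗ[k] H ⊗[k] M.carrier :=
  hit (φ ∘ₗ (TensorProduct.comm k H H).toLinearMap.lTensor H ∘ₗ
      (TensorProduct.assoc k H H H).toLinearMap)
    (coactProd (outerCoact k) M.coact)

/-- `h ⊗ m ↦ p^L(s(h₁), (m · s(h₂))₋₁) (m · s(h₂))₀`. -/
noncomputable def innerAct [BijectiveAntipode k H] (M : YDData k H) :
    H ⊗[k] M.carrier →ₗ[k] M.carrier :=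
  contractAfter (pL k ∘ₗ s.rTensor H) M.coact ∘ₗ
    (TensorProduct.lift (M.act ∘ₗ s)).lTensor H ∘ₗ
    (TensorProduct.assoc k H H M.carrier).toLinearMap ∘ₗ
    comul.rTensor M.carrier

/-- The left action `h ▷ m` built from a right action `m · h`:
`h ▷ m = q^R(h₁ m₋₁₁, s(h₆)) σ⁻¹(h₂, m₋₁₂, s(h₅))
  p^L(s(h₃), (m₀ · s(h₄))₋₁) (m₀ · s(h₄))₀`. -/
noncomputable def transferAct [BijectiveAntipode k H] (M : YDData k H) :
    H →ₗ[k] M.carrier →ₗ[k] M.carrier :=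
  TensorProduct.curry <| innerAct M ∘ₗ outerTwist σinv M ∘ₗ
    outerTwist (qR k ∘ₗ mul.rTensor H ∘ₗ (TensorProduct.assoc k H H H).symm.toLinearMap) M

/-- The same space with the same coaction, and with the action `h ▷ m`. -/
noncomputable abbrev transferObj [BijectiveAntipode k H] (M : YDData k H) : YDData k H where
  carrier := M.carrier
  coact := M.coact
  act := transferAct M

variable (k H)

/-- `▷` turns right-left Yetter-Drinfeld modules into left-left ones, and morphisms between the
former are morphisms between the latter. -/
structure IsTransfer [BijectiveAntipode k H] : Prop where
  obj : ∀ M : (rightLeft k H).Mod, (leftLeft k H).prop (transferObj M.obj)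
  map : ∀ (M N : (rightLeft k H).Mod) (f : M ⟶ N),
    YDData.IsHom (transferObj M.obj) (transferObj N.obj) f.hom.lin

variable {k H}

/-- The functor `T`: the action is replaced by `▷`, the space, the coaction and the morphisms
are kept. -/
noncomputable def IsTransfer.functor [BijectiveAntipode k H] (h : IsTransfer k H) :
    (rightLeft k H).Mod ⥤ (leftLeft k H).Mod where
  obj M := ⟨transferObj M.obj, h.obj M⟩
  map f := ObjectProperty.homMk ⟨f.hom.lin, h.map _ _ f⟩

end Transfer

/-! The category of left `H`-comodules is monoidal, with associativity constraint given by `σ⁻¹`.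
A right-left Yetter-Drinfeld structure on a comodule `M` is the same as a family of maps
`M ⊗ U ⟶ U ⊗ M`, `m ⊗ u ↦ u₀ ⊗ m · u₋₁`, natural in the comodule `U`, that satisfies the axioms of a
half-braiding: the compatibility axiom says that these maps are colinear, and the action axioms are
the hexagon and unit axioms. A left-left structure is likewise a natural family `U ⊗ M ⟶ M ⊗ U`,
`u ⊗ m ↦ u₋₁ · m ⊗ u₀`. In both cases the action is recovered from the map for the regular comodule
`U = H` by applying the counit, and equalities of natural maps can be tested there (`natural_ext`).

The families are invertible. By naturality and local finiteness it suffices to look at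
finite-dimensional comodules `U`, given by matrix coefficients `h i j`. The antipode together with
`α` and `β` makes `s (h j i)` the coefficients of a dual of `U` (`MatrixCoefficients.exactPairing`),
and the hexagon axiom for `U` and its dual gives an inverse (`RightLaxHalfBraiding.inv`). Hence both
kinds of Yetter-Drinfeld modules are the objects of the Drinfeld center of the category of comodules
(`rightModel`, `leftModel`), with right-left modules giving the half-braiding and left-left modules
its inverse. Tensor products, morphisms and braidings correspond as well, so that the axioms of a
braided monoidal category are inherited from the Drinfeld center; for left-left modules the braiding
is the reversed one.

Writing out the inverse obtained from the dual yields exactly the action `▷`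
(`MatrixCoefficients.laxHalfBraiding_inv`). Therefore `M` and `T M` stand for the same object of the
Drinfeld center (`RightRep.transferObj`). So `T` is well defined, is inverted by reading off the
right action from the half-braiding, and is strictly compatible with tensor products and braidings. -/

/-! ### Coactions -/

section Coactions

variable {k : Type u} [Field k]
  {A C D X Y Z : Type u} [AddCommGroup A] [Module k A] [AddCommGroup C] [Module k C]
  [AddCommGroup D] [Module k D] [AddCommGroup X] [Module k X] [AddCommGroup Y] [Module k Y]
  [AddCommGroup Z] [Module k Z]

/-- A coassociative and counital left coaction of a coalgebra `C` on `X`. -/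
structure IsCoaction [Coalgebra k C] (ρ : X →ₗ[k] C ⊗[k] X) : Prop where
  coassoc : ρ.lTensor C ∘ₗ ρ =
    (TensorProduct.assoc k C C X).toLinearMap ∘ₗ comul.rTensor X ∘ₗ ρ
  counit : (TensorProduct.lid k X).toLinearMap ∘ₗ counit.rTensor X ∘ₗ ρ = LinearMap.id

lemma isCoaction_comul [Coalgebra k C] : IsCoaction (comul (R := k) (A := C)) where
  coassoc := Coalgebra.coassoc.symm
  counit := by ext; simp

namespace IsCoaction

variable [Coalgebra k C] [Coalgebra k D] {ρ : X →ₗ[k] C ⊗[k] X} {τ : Y →ₗ[k] D ⊗[k] Y}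

lemma coassoc_apply (hρ : IsCoaction ρ) (x : X) :
    ρ.lTensor C (ρ x) = TensorProduct.assoc k C C X (comul.rTensor X (ρ x)) :=
  LinearMap.congr_fun hρ.coassoc x

lemma counit_apply (hρ : IsCoaction ρ) (x : X) :
    TensorProduct.lid k X (Coalgebra.counit.rTensor X (ρ x)) = x :=
  LinearMap.congr_fun hρ.counit x

/-- Coactions of `C` on `X` and of `D` on `Y` give a coaction of `C ⊗ D` on `X ⊗ Y`. -/
lemma prod (hρ : IsCoaction ρ) (hτ : IsCoaction τ) : IsCoaction (coactProd ρ τ) where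
  coassoc := by
    let S : (C ⊗[k] (C ⊗[k] X)) ⊗[k] (D ⊗[k] (D ⊗[k] Y)) →ₗ[k]
        (C ⊗[k] D) ⊗[k] ((C ⊗[k] D) ⊗[k] (X ⊗[k] Y)) :=
      (TensorProduct.tensorTensorTensorComm k C X D Y).toLinearMap.lTensor _ ∘ₗ
      (TensorProduct.tensorTensorTensorComm k C (C ⊗[k] X) D (D ⊗[k] Y)).toLinearMap
    have h1 : (coactProd ρ τ).lTensor (C ⊗[k] D) ∘ₗ
        (TensorProduct.tensorTensorTensorComm k C X D Y).toLinearMap =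
        S ∘ₗ TensorProduct.map (ρ.lTensor C) (τ.lTensor D) := by
      ext; simp [S, coactProd]
    have h2 : (TensorProduct.assoc k _ _ _).toLinearMap ∘ₗ
        (comul (R := k) (A := C ⊗[k] D)).rTensor (X ⊗[k] Y) ∘ₗ
        (TensorProduct.tensorTensorTensorComm k C X D Y).toLinearMap =
        S ∘ₗ TensorProduct.map ((TensorProduct.assoc k C C X).toLinearMap ∘ₗ comul.rTensor X)
          ((TensorProduct.assoc k D D Y).toLinearMap ∘ₗ comul.rTensor Y) := by
      ext c x d y
      simp only [TensorProduct.AlgebraTensorModule.curry_apply, LinearMap.restrictScalars_self,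
        TensorProduct.curry_apply, LinearMap.coe_comp, LinearEquiv.coe_coe, Function.comp_apply,
        TensorProduct.tensorTensorTensorComm_tmul, LinearMap.rTensor_tmul, TensorProduct.comul_tmul,
        TensorProduct.AlgebraTensorModule.tensorTensorTensorComm_eq, TensorProduct.map_tmul]
      generalize comul (R := k) c = s
      generalize comul (R := k) d = t
      induction s with
      | zero => simp
      | add s s' h h' =>
        simp only [TensorProduct.add_tmul, map_add]
        rw [h, h']
      | tmul c c' =>
        induction t with
        | zero => simp
        | add t t' h h' =>
          simp only [TensorProduct.add_tmul, TensorProduct.tmul_add, map_add]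
          rw [h, h']
        | tmul d d' => simp [S]
    refine (congrArg (fun f => f ∘ₗ TensorProduct.map ρ τ) h1).trans
      (Eq.trans ?_ (congrArg (fun f => f ∘ₗ TensorProduct.map ρ τ) h2).symm)
    have h3 := congrArg₂ TensorProduct.map hρ.coassoc hτ.coassoc
    rw [TensorProduct.map_comp, ← LinearMap.comp_assoc, ← LinearMap.comp_assoc,
      TensorProduct.map_comp] at h3
    exact congrArg (fun f => S ∘ₗ f) h3
  counit := by
    have h1 : (TensorProduct.lid k (X ⊗[k] Y)).toLinearMap ∘ₗ
        Coalgebra.counit.rTensor (X ⊗[k] Y) ∘ₗ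
        (TensorProduct.tensorTensorTensorComm k C X D Y).toLinearMap =
        TensorProduct.map ((TensorProduct.lid k X).toLinearMap ∘ₗ Coalgebra.counit.rTensor X)
          ((TensorProduct.lid k Y).toLinearMap ∘ₗ Coalgebra.counit.rTensor Y) := by
      ext; simp [TensorProduct.smul_tmul', TensorProduct.tmul_smul, smul_smul, mul_comm]
    have h3 := congrArg₂ TensorProduct.map hρ.counit hτ.counit
    rw [← LinearMap.comp_assoc, ← LinearMap.comp_assoc] at h3
    rw [TensorProduct.map_comp, ← h1, TensorProduct.map_id] at h3
    rw [← h3]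
    rfl

end IsCoaction

/-- Pushing a coaction forward along a morphism of coalgebras. -/
lemma IsCoaction.push [Coalgebra k C] [Coalgebra k D] {ρ : X →ₗ[k] C ⊗[k] X} (hρ : IsCoaction ρ)
    {f : C →ₗ[k] D} (hf : comul ∘ₗ f = TensorProduct.map f f ∘ₗ comul)
    (hf' : Coalgebra.counit ∘ₗ f = Coalgebra.counit (R := k) (A := C)) :
    IsCoaction (f.rTensor X ∘ₗ ρ) where
  coassoc := by
    have h1 : (f.rTensor X ∘ₗ ρ).lTensor D ∘ₗ f.rTensor X =
        TensorProduct.map f (f.rTensor X) ∘ₗ ρ.lTensor C := by ext; simp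
    have h2 : (TensorProduct.assoc k D D X).toLinearMap ∘ₗ comul.rTensor X ∘ₗ f.rTensor X =
        TensorProduct.map f (f.rTensor X) ∘ₗ (TensorProduct.assoc k C C X).toLinearMap ∘ₗ
          comul.rTensor X := by
      rw [← LinearMap.rTensor_comp, hf, LinearMap.rTensor_comp, ← LinearMap.comp_assoc,
        ← LinearMap.comp_assoc]
      congr 1
      ext; simp
    rw [← LinearMap.comp_assoc, h1, LinearMap.comp_assoc, hρ.coassoc]
    simp only [← LinearMap.comp_assoc] at h2 ⊢
    rw [h2]
  counit := by
    have := hρ.counit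
    rwa [← hf', LinearMap.rTensor_comp] at this

/-- `hit` is natural with respect to a map of spaces that is compatible with the coactions along
a map `f : C → D`. -/
lemma hit_natural {ρ : X →ₗ[k] C ⊗[k] X} {τ : Y →ₗ[k] D ⊗[k] Y} {e : X →ₗ[k] Y} {f : C →ₗ[k] D}
    (h : τ ∘ₗ e = TensorProduct.map f e ∘ₗ ρ) (φ : D →ₗ[k] k) :
    hit φ τ ∘ₗ e = e ∘ₗ hit (φ ∘ₗ f) ρ := by
  unfold hit
  rw [LinearMap.comp_assoc, LinearMap.comp_assoc, h]
  simp only [← LinearMap.comp_assoc]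
  congr 1
  ext; simp

/-- `φ(x₋₁) f(x₀₋₁) ⊗ x₀₀ = φ(x₋₁₁) f(x₋₁₂) ⊗ x₀`. -/
lemma rTensor_comp_hit [Coalgebra k C] {ρ : X →ₗ[k] C ⊗[k] X} (hρ : IsCoaction ρ) (φ : C →ₗ[k] k)
    (f : C →ₗ[k] D) : f.rTensor X ∘ₗ ρ ∘ₗ hit φ ρ =
      ((TensorProduct.lid k D).toLinearMap ∘ₗ TensorProduct.map φ f ∘ₗ comul).rTensor X ∘ₗ ρ := by
  have h1 : f.rTensor X ∘ₗ ρ ∘ₗ hit φ ρ =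
      ((TensorProduct.lid k (D ⊗[k] X)).toLinearMap ∘ₗ TensorProduct.map φ (f.rTensor X)) ∘ₗ
        ρ.lTensor C ∘ₗ ρ := by
    unfold hit
    simp only [← LinearMap.comp_assoc]
    congr 1
    ext; simp
  rw [h1, hρ.coassoc]
  simp only [LinearMap.rTensor_comp, ← LinearMap.comp_assoc]
  congr 2
  ext; simp [TensorProduct.smul_tmul']

/-- `f(x₋₁) ⊗ φ(x₀₋₁) x₀₀ = f(x₋₁₁) φ(x₋₁₂) ⊗ x₀`. -/
lemma lTensor_hit_comp [Coalgebra k C] {ρ : X →ₗ[k] C ⊗[k] X} (hρ : IsCoaction ρ) (φ : C →ₗ[k] k)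
    (f : C →ₗ[k] D) : (hit φ ρ).lTensor D ∘ₗ f.rTensor X ∘ₗ ρ =
      ((TensorProduct.rid k D).toLinearMap ∘ₗ TensorProduct.map f φ ∘ₗ comul).rTensor X ∘ₗ ρ := by
  have h1 : (hit φ ρ).lTensor D ∘ₗ f.rTensor X ∘ₗ ρ =
      (TensorProduct.map f ((TensorProduct.lid k X).toLinearMap ∘ₗ φ.rTensor X)) ∘ₗ
        ρ.lTensor C ∘ₗ ρ := by
    simp only [← LinearMap.comp_assoc]
    congr 1
    ext; simp [hit]
  rw [h1, hρ.coassoc]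
  simp only [LinearMap.rTensor_comp, ← LinearMap.comp_assoc]
  congr 2
  ext; simp [TensorProduct.smul_tmul']

/-- The maps `x ↦ φ(x₋₁) x₀` multiply like the convolution algebra. -/
lemma hit_hit [Coalgebra k C] {ρ : X →ₗ[k] C ⊗[k] X} (hρ : IsCoaction ρ) (φ ψ : C →ₗ[k] k) :
    hit ψ ρ ∘ₗ hit φ ρ = hit (toConv φ * toConv ψ).ofConv ρ := by
  have h := rTensor_comp_hit hρ φ ψ
  unfold hit at h ⊢
  simp only [LinearMap.comp_assoc] at h ⊢
  rw [h]
  congr 3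

lemma hit_one [Coalgebra k C] {ρ : X →ₗ[k] C ⊗[k] X} (hρ : IsCoaction ρ) :
    hit (1 : WithConv (C →ₗ[k] k)).ofConv ρ = LinearMap.id := by
  rw [← hρ.counit]
  unfold hit
  congr 3

end Coactions

/-! ### Coactions and associativity on tensor products -/

section TensorCoactions

open DualQuasiBialgebra

variable {k H : Type u} [Field k] [AddCommGroup H] [Module k H] [Coalgebra k H]
  [DualQuasiBialgebra k H] {X Y Z W X' Y' Z' : Type u}
  [AddCommGroup X] [Module k X] [AddCommGroup Y] [Module k Y] [AddCommGroup Z] [Module k Z]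
  [AddCommGroup W] [Module k W] [AddCommGroup X'] [Module k X'] [AddCommGroup Y'] [Module k Y']
  [AddCommGroup Z'] [Module k Z']
  {ρ : X →ₗ[k] H ⊗[k] X} {τ : Y →ₗ[k] H ⊗[k] Y} {υ : Z →ₗ[k] H ⊗[k] Z} {ω : W →ₗ[k] H ⊗[k] W}
  {ρ' : X' →ₗ[k] H ⊗[k] X'} {τ' : Y' →ₗ[k] H ⊗[k] Y'} {υ' : Z' →ₗ[k] H ⊗[k] Z'}

lemma IsCoaction.tensor (hρ : IsCoaction ρ) (hτ : IsCoaction τ) :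
    IsCoaction (tensorCoact ρ τ) :=
  (hρ.prod hτ).push comul_mul counit_mul

/-- `(ab)c`, as a linear map on `H ⊗ (H ⊗ H)`. -/
noncomputable abbrev mulLeft₃ (k H : Type u) [Field k] [AddCommGroup H] [Module k H]
    [Coalgebra k H] [DualQuasiBialgebra k H] : H ⊗[k] (H ⊗[k] H) →ₗ[k] H :=
  mul ∘ₗ mul.rTensor H ∘ₗ (TensorProduct.assoc k H H H).symm.toLinearMap

/-- `a(bc)`, as a linear map on `H ⊗ (H ⊗ H)`. -/
noncomputable abbrev mulRight₃ (k H : Type u) [Field k] [AddCommGroup H] [Module k H]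
    [Coalgebra k H] [DualQuasiBialgebra k H] : H ⊗[k] (H ⊗[k] H) →ₗ[k] H :=
  mul ∘ₗ mul.lTensor H

lemma tensorCoact_tensorCoact_right (ρ : X →ₗ[k] H ⊗[k] X) (τ : Y →ₗ[k] H ⊗[k] Y)
    (υ : Z →ₗ[k] H ⊗[k] Z) : tensorCoact ρ (tensorCoact τ υ) =
      (mulRight₃ k H).rTensor _ ∘ₗ coactProd ρ (coactProd τ υ) := by
  have : coactProd ρ (tensorCoact τ υ) =
      (mul.lTensor H).rTensor _ ∘ₗ coactProd ρ (coactProd τ υ) := by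
    rw [tensorCoact]
    ext x y z
    simp only [coactProd, TensorProduct.AlgebraTensorModule.curry_apply,
      LinearMap.restrictScalars_self, TensorProduct.curry_apply, LinearMap.coe_comp,
      LinearEquiv.coe_coe, Function.comp_apply, TensorProduct.map_tmul]
    generalize ρ x = r
    generalize TensorProduct.tensorTensorTensorComm k H Y H Z (τ y ⊗ₜ υ z) = s
    induction r with
    | zero => simp
    | add r r' h h' => simp only [TensorProduct.add_tmul, map_add, h, h']
    | tmul a x =>
      induction s with
      | zero => simp
      | add s s' h h' => simp only [TensorProduct.tmul_add, map_add, h, h']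
      | tmul b y => simp
  rw [tensorCoact, this, LinearMap.rTensor_comp]
  rfl

lemma tensorCoact_tensorCoact_left (ρ : X →ₗ[k] H ⊗[k] X) (τ : Y →ₗ[k] H ⊗[k] Y)
    (υ : Z →ₗ[k] H ⊗[k] Z) : tensorCoact (tensorCoact ρ τ) υ ∘ₗ
      (TensorProduct.assoc k X Y Z).symm.toLinearMap =
      (TensorProduct.assoc k X Y Z).symm.toLinearMap.lTensor H ∘ₗ
        (mulLeft₃ k H).rTensor _ ∘ₗ coactProd ρ (coactProd τ υ) := by
  ext x y z
  simp only [coactProd, tensorCoact, TensorProduct.AlgebraTensorModule.curry_apply,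
    LinearMap.restrictScalars_self, TensorProduct.curry_apply, LinearMap.coe_comp,
    LinearEquiv.coe_coe, Function.comp_apply, TensorProduct.map_tmul,
    TensorProduct.assoc_symm_tmul]
  generalize ρ x = r
  generalize τ y = s
  generalize υ z = t
  induction r with
  | zero => simp
  | add r r' h h' => simp only [TensorProduct.add_tmul, map_add, h, h']
  | tmul a x =>
    induction s with
    | zero => simp
    | add s s' h h' => simp only [TensorProduct.tmul_add, TensorProduct.add_tmul, map_add, h, h']
    | tmul b y =>
      induction t with
      | zero => simp
      | add t t' h h' => simp only [TensorProduct.tmul_add, map_add, h, h']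
      | tmul c z => simp

omit [DualQuasiBialgebra k H] in
lemma twist_comp_twist {φ ψ : H ⊗[k] (H ⊗[k] H) →ₗ[k] k} (h : toConv φ * toConv ψ = 1)
    (hρ : IsCoaction ρ) (hτ : IsCoaction τ) (hυ : IsCoaction υ) :
    twist ψ ρ τ υ ∘ₗ twist φ ρ τ υ = LinearMap.id := by
  rw [twist, twist, hit_hit (hρ.prod (hτ.prod hυ)), h, hit_one (hρ.prod (hτ.prod hυ))]

lemma assocMap_comp_assocInvMap (hρ : IsCoaction ρ) (hτ : IsCoaction τ) (hυ : IsCoaction υ) :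
    assocMap ρ τ υ ∘ₗ assocInvMap ρ τ υ = LinearMap.id := by
  have h := twist_comp_twist σ_mul_σinv hρ hτ hυ
  refine LinearMap.ext fun x => ?_
  simpa [assocMap, assocInvMap] using LinearMap.congr_fun h x

lemma assocInvMap_comp_assocMap (hρ : IsCoaction ρ) (hτ : IsCoaction τ) (hυ : IsCoaction υ) :
    assocInvMap ρ τ υ ∘ₗ assocMap ρ τ υ = LinearMap.id := by
  have h := twist_comp_twist σinv_mul_σ hρ hτ hυ
  refine LinearMap.ext fun x => ?_
  simpa [assocMap, assocInvMap] using congrArg (TensorProduct.assoc k X Y Z).symm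
    (LinearMap.congr_fun h (TensorProduct.assoc k X Y Z x))

/-- The associativity constraint is colinear: this is the quasi-associativity of `H`. -/
lemma tensorCoact_comp_assocInvMap (hρ : IsCoaction ρ) (hτ : IsCoaction τ) (hυ : IsCoaction υ) :
    tensorCoact (tensorCoact ρ τ) υ ∘ₗ assocInvMap ρ τ υ =
      (assocInvMap ρ τ υ).lTensor H ∘ₗ tensorCoact ρ (tensorCoact τ υ) := by
  have h3 := hρ.prod (hτ.prod hυ)
  rw [assocInvMap, ← LinearMap.comp_assoc, tensorCoact_tensorCoact_left, LinearMap.lTensor_comp,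
    LinearMap.comp_assoc, LinearMap.comp_assoc, LinearMap.comp_assoc,
    tensorCoact_tensorCoact_right, twist, rTensor_comp_hit h3, lTensor_hit_comp h3, quasi_assoc]

lemma tensorCoact_comp_assocMap (hρ : IsCoaction ρ) (hτ : IsCoaction τ) (hυ : IsCoaction υ) :
    tensorCoact ρ (tensorCoact τ υ) ∘ₗ assocMap ρ τ υ =
      (assocMap ρ τ υ).lTensor H ∘ₗ tensorCoact (tensorCoact ρ τ) υ := by
  have h := tensorCoact_comp_assocInvMap hρ hτ hυ
  have h1 := congrArg (fun f => (assocMap ρ τ υ).lTensor H ∘ₗ f ∘ₗ assocMap ρ τ υ) h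
  simp only [LinearMap.comp_assoc, assocInvMap_comp_assocMap hρ hτ hυ, LinearMap.comp_id] at h1
  rw [h1, ← LinearMap.comp_assoc, ← LinearMap.lTensor_comp, assocMap_comp_assocInvMap hρ hτ hυ,
    LinearMap.lTensor_id, LinearMap.id_comp]

lemma coactProd_comp_map {C D : Type u} [AddCommGroup C] [Module k C] [AddCommGroup D] [Module k D]
    {ρ : X →ₗ[k] C ⊗[k] X} {τ : Y →ₗ[k] D ⊗[k] Y} {ρ' : X' →ₗ[k] C ⊗[k] X'}
    {τ' : Y' →ₗ[k] D ⊗[k] Y'} {f : X →ₗ[k] X'} {g : Y →ₗ[k] Y'}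
    (hf : ρ' ∘ₗ f = f.lTensor C ∘ₗ ρ) (hg : τ' ∘ₗ g = g.lTensor D ∘ₗ τ) :
    coactProd ρ' τ' ∘ₗ TensorProduct.map f g =
      (TensorProduct.map f g).lTensor (C ⊗[k] D) ∘ₗ coactProd ρ τ := by
  rw [coactProd, coactProd, LinearMap.comp_assoc, ← TensorProduct.map_comp, hf, hg,
    TensorProduct.map_comp, ← LinearMap.comp_assoc, ← LinearMap.comp_assoc]
  congr 1
  ext; simp

lemma tensorCoact_comp_map {f : X →ₗ[k] X'} {g : Y →ₗ[k] Y'}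
    (hf : ρ' ∘ₗ f = f.lTensor H ∘ₗ ρ) (hg : τ' ∘ₗ g = g.lTensor H ∘ₗ τ) :
    tensorCoact ρ' τ' ∘ₗ TensorProduct.map f g =
      (TensorProduct.map f g).lTensor H ∘ₗ tensorCoact ρ τ := by
  rw [tensorCoact, LinearMap.comp_assoc, coactProd_comp_map hf hg, ← LinearMap.comp_assoc,
    LinearMap.rTensor_comp_lTensor, ← LinearMap.lTensor_comp_rTensor]
  rfl

omit [Coalgebra k H] [DualQuasiBialgebra k H] in
lemma twist_comp_map (φ : H ⊗[k] (H ⊗[k] H) →ₗ[k] k)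
    {f : X →ₗ[k] X'} {g : Y →ₗ[k] Y'} {h : Z →ₗ[k] Z'}
    (hf : ρ' ∘ₗ f = f.lTensor H ∘ₗ ρ) (hg : τ' ∘ₗ g = g.lTensor H ∘ₗ τ)
    (hh : υ' ∘ₗ h = h.lTensor H ∘ₗ υ) :
    twist φ ρ' τ' υ' ∘ₗ TensorProduct.map f (TensorProduct.map g h) =
      TensorProduct.map f (TensorProduct.map g h) ∘ₗ twist φ ρ τ υ := by
  rw [twist, hit_natural (coactProd_comp_map hf (coactProd_comp_map hg hh))]
  rfl

lemma assocMap_comp_map {f : X →ₗ[k] X'} {g : Y →ₗ[k] Y'} {h : Z →ₗ[k] Z'}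
    (hf : ρ' ∘ₗ f = f.lTensor H ∘ₗ ρ) (hg : τ' ∘ₗ g = g.lTensor H ∘ₗ τ)
    (hh : υ' ∘ₗ h = h.lTensor H ∘ₗ υ) :
    assocMap ρ' τ' υ' ∘ₗ TensorProduct.map (TensorProduct.map f g) h =
      TensorProduct.map f (TensorProduct.map g h) ∘ₗ assocMap ρ τ υ := by
  rw [assocMap, assocMap, ← LinearMap.comp_assoc, ← twist_comp_map _ hf hg hh,
    LinearMap.comp_assoc, LinearMap.comp_assoc]
  congr 1
  ext; simp

/-- The coaction `1 ↦ 1_H ⊗ 1` on the ground field. -/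
noncomputable abbrev unitCoact (k H : Type u) [Field k] [AddCommGroup H] [Module k H]
    [Coalgebra k H] [DualQuasiBialgebra k H] : k →ₗ[k] H ⊗[k] k :=
  LinearMap.toSpanSingleton k (H ⊗[k] k) (one k ⊗ₜ 1)

lemma isCoaction_unitCoact : IsCoaction (unitCoact k H) where
  coassoc := by ext; simp [comul_one]
  counit := by ext; simp [counit_one]

lemma tensorCoact_unitCoact_left (τ : Y →ₗ[k] H ⊗[k] Y) :
    τ ∘ₗ (TensorProduct.lid k Y).toLinearMap =
      (TensorProduct.lid k Y).toLinearMap.lTensor H ∘ₗ tensorCoact (unitCoact k H) τ := by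
  ext y
  simp only [tensorCoact, coactProd, TensorProduct.AlgebraTensorModule.curry_apply,
    LinearMap.restrictScalars_self, TensorProduct.curry_apply, LinearMap.coe_comp,
    LinearEquiv.coe_coe, Function.comp_apply, TensorProduct.map_tmul, TensorProduct.lid_tmul,
    one_smul, LinearMap.toSpanSingleton_apply]
  generalize τ y = s
  induction s with
  | zero => simp
  | add s s' h h' => simp only [TensorProduct.tmul_add, map_add, ← h, ← h']
  | tmul b y => simp [DualQuasiBialgebra.one_mul]

lemma tensorCoact_unitCoact_right (τ : Y →ₗ[k] H ⊗[k] Y) :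
    τ ∘ₗ (TensorProduct.rid k Y).toLinearMap =
      (TensorProduct.rid k Y).toLinearMap.lTensor H ∘ₗ tensorCoact τ (unitCoact k H) := by
  ext y
  simp only [tensorCoact, coactProd, TensorProduct.AlgebraTensorModule.curry_apply,
    LinearMap.restrictScalars_self, TensorProduct.curry_apply, LinearMap.coe_comp,
    LinearEquiv.coe_coe, Function.comp_apply, TensorProduct.map_tmul, TensorProduct.rid_tmul,
    one_smul, LinearMap.toSpanSingleton_apply]
  generalize τ y = s
  induction s with
  | zero => simp
  | add s s' h h' => simp only [TensorProduct.add_tmul, map_add, ← h, ← h']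
  | tmul b y => simp [DualQuasiBialgebra.mul_one]

/-- The triangle identity, for the inverse of the associativity constraint. -/
lemma triangle_assocInvMap (hρ : IsCoaction ρ) (hτ : IsCoaction τ) :
    (TensorProduct.rid k X).toLinearMap.rTensor Y ∘ₗ assocInvMap ρ (unitCoact k H) τ =
      (TensorProduct.lid k Y).toLinearMap.lTensor X := by
  ext x y
  have hx := hρ.counit_apply x
  have hy := hτ.counit_apply y
  simp only [assocInvMap, twist, hit, coactProd, TensorProduct.AlgebraTensorModule.curry_apply,
    LinearMap.restrictScalars_self, TensorProduct.curry_apply, LinearMap.coe_comp,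
    LinearEquiv.coe_coe, Function.comp_apply, TensorProduct.map_tmul, TensorProduct.lid_tmul,
    one_smul, LinearMap.toSpanSingleton_apply, LinearMap.lTensor_tmul]
  conv_rhs => rw [← hx, ← hy]
  generalize ρ x = r
  generalize τ y = s
  induction r with
  | zero => simp
  | add r r' h h' => simp only [TensorProduct.add_tmul, map_add, h, h']
  | tmul a x =>
    induction s with
    | zero => simp
    | add s s' h h' => simp only [TensorProduct.tmul_add, map_add, h, h']
    | tmul b y =>
      simp [σ_one, TensorProduct.smul_tmul', TensorProduct.tmul_smul, smul_smul, mul_comm]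

end TensorCoactions

/-! ### The pentagon identity -/

section Pentagon

open DualQuasiBialgebra

variable {k H : Type u} [Field k] [AddCommGroup H] [Module k H] [Coalgebra k H]
  {X Y Z W : Type u}
  [AddCommGroup X] [Module k X] [AddCommGroup Y] [Module k Y] [AddCommGroup Z] [Module k Z]
  [AddCommGroup W] [Module k W]
  {ρ : X →ₗ[k] H ⊗[k] X} {τ : Y →ₗ[k] H ⊗[k] Y} {υ : Z →ₗ[k] H ⊗[k] Z} {ω : W →ₗ[k] H ⊗[k] W}

lemma coactProd_tmul {C D : Type u} [AddCommGroup C] [Module k C] [AddCommGroup D] [Module k D]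
    (ρ : X →ₗ[k] C ⊗[k] X) (τ : Y →ₗ[k] D ⊗[k] Y) (x : X) (y : Y) : coactProd ρ τ (x ⊗ₜ y) =
      TensorProduct.tensorTensorTensorComm k C X D Y (ρ x ⊗ₜ τ y) := rfl

lemma hit_mul {C : Type u} [AddCommGroup C] [Module k C] [Coalgebra k C] {ρ : X →ₗ[k] C ⊗[k] X}
    (hρ : IsCoaction ρ) (φ ψ : WithConv (C →ₗ[k] k)) :
    hit (φ * ψ).ofConv ρ = hit ψ.ofConv ρ ∘ₗ hit φ.ofConv ρ :=
  (hit_hit hρ φ.ofConv ψ.ofConv).symm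

lemma hit_coactProd_counit_left {D : Type u} [AddCommGroup D] [Module k D]
    (hρ : IsCoaction ρ) (τ : Y →ₗ[k] D ⊗[k] Y) (φ : D →ₗ[k] k) :
    hit ((TensorProduct.lid k k).toLinearMap ∘ₗ TensorProduct.map counit φ) (coactProd ρ τ) =
      (hit φ τ).lTensor X := by
  ext x y
  have hx := hρ.counit_apply x
  simp only [hit, coactProd, TensorProduct.AlgebraTensorModule.curry_apply,
    LinearMap.restrictScalars_self, TensorProduct.curry_apply, LinearMap.coe_comp,
    LinearEquiv.coe_coe, Function.comp_apply, TensorProduct.map_tmul, LinearMap.lTensor_tmul]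
  conv_rhs => rw [← hx]
  generalize ρ x = r
  generalize τ y = s
  induction r with
  | zero => simp
  | add r r' h h' => simp only [TensorProduct.add_tmul, map_add, h, h']
  | tmul a x =>
    induction s with
    | zero => simp
    | add s s' h h' => simp only [TensorProduct.tmul_add, map_add, h, h']
    | tmul b y => simp [TensorProduct.smul_tmul', TensorProduct.tmul_smul, smul_smul, mul_comm]

variable [DualQuasiBialgebra k H]

lemma twist_tensorCoact_right (φ : H ⊗[k] (H ⊗[k] H) →ₗ[k] k) :
    twist φ ρ τ (tensorCoact υ ω) = hit (φ ∘ₗ (mul.lTensor H).lTensor H)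
      (coactProd ρ (coactProd τ (coactProd υ ω))) := by
  have h : coactProd ρ (coactProd τ (tensorCoact υ ω)) ∘ₗ LinearMap.id =
      TensorProduct.map ((mul.lTensor H).lTensor H) LinearMap.id ∘ₗ
        coactProd ρ (coactProd τ (coactProd υ ω)) := by
    rw [tensorCoact]
    ext x y z w
    simp only [coactProd, TensorProduct.AlgebraTensorModule.curry_apply,
      LinearMap.restrictScalars_self, TensorProduct.curry_apply, LinearMap.coe_comp,
      LinearEquiv.coe_coe, Function.comp_apply, TensorProduct.map_tmul, LinearMap.id_apply]
    generalize ρ x = r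
    generalize τ y = s
    generalize TensorProduct.tensorTensorTensorComm k H Z H W (υ z ⊗ₜ ω w) = t
    induction r with
    | zero => simp
    | add r r' h h' => simp only [TensorProduct.add_tmul, map_add, h, h']
    | tmul a x =>
      induction s with
      | zero => simp
      | add s s' h h' => simp only [TensorProduct.tmul_add, TensorProduct.add_tmul, map_add, h, h']
      | tmul b y =>
        induction t with
        | zero => simp
        | add t t' h h' => simp only [TensorProduct.tmul_add, map_add, h, h']
        | tmul c z => simp
  have := hit_natural h φ
  rwa [LinearMap.comp_id, LinearMap.id_comp] at this

lemma twist_tensorCoact_left (φ : H ⊗[k] (H ⊗[k] H) →ₗ[k] k) :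
    twist φ (tensorCoact ρ τ) υ ω ∘ₗ (TensorProduct.assoc k X Y (Z ⊗[k] W)).symm.toLinearMap =
      (TensorProduct.assoc k X Y (Z ⊗[k] W)).symm.toLinearMap ∘ₗ
        hit (φ ∘ₗ mul.rTensor (H ⊗[k] H) ∘ₗ
          (TensorProduct.assoc k H H (H ⊗[k] H)).symm.toLinearMap)
      (coactProd ρ (coactProd τ (coactProd υ ω))) := by
  refine hit_natural ?_ φ
  refine TensorProduct.ext' fun x v => ?_
  induction v with
  | zero => simp
  | add v v' h h' => simp only [TensorProduct.tmul_add, map_add, h, h']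
  | tmul y v =>
    simp only [tensorCoact, coactProd, LinearMap.coe_comp,
      LinearEquiv.coe_coe, Function.comp_apply, TensorProduct.map_tmul,
      TensorProduct.assoc_symm_tmul]
    generalize ρ x = r
    generalize τ y = s
    generalize TensorProduct.tensorTensorTensorComm k H Z H W (TensorProduct.map υ ω v) = t
    induction r with
    | zero => simp
    | add r r' h h' => simp only [TensorProduct.add_tmul, map_add, h, h']
    | tmul a x =>
      induction s with
      | zero => simp
      | add s s' h h' => simp only [TensorProduct.tmul_add, TensorProduct.add_tmul, map_add, h, h']
      | tmul b y =>
        induction t with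
        | zero => simp
        | add t t' h h' => simp only [TensorProduct.tmul_add, map_add, h, h']
        | tmul c z => simp

lemma twist_tensorCoact_middle (φ : H ⊗[k] (H ⊗[k] H) →ₗ[k] k) :
    twist φ ρ (tensorCoact τ υ) ω ∘ₗ (TensorProduct.assoc k Y Z W).symm.toLinearMap.lTensor X =
      (TensorProduct.assoc k Y Z W).symm.toLinearMap.lTensor X ∘ₗ
        hit (φ ∘ₗ (mul.rTensor H ∘ₗ (TensorProduct.assoc k H H H).symm.toLinearMap).lTensor H)
      (coactProd ρ (coactProd τ (coactProd υ ω))) := by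
  refine hit_natural ?_ φ
  have h : coactProd (tensorCoact τ υ) ω ∘ₗ (TensorProduct.assoc k Y Z W).symm.toLinearMap =
      TensorProduct.map (mul.rTensor H ∘ₗ (TensorProduct.assoc k H H H).symm.toLinearMap)
        (TensorProduct.assoc k Y Z W).symm.toLinearMap ∘ₗ coactProd τ (coactProd υ ω) := by
    ext x y z
    simp only [coactProd, tensorCoact, TensorProduct.AlgebraTensorModule.curry_apply,
      LinearMap.restrictScalars_self, TensorProduct.curry_apply, LinearMap.coe_comp,
      LinearEquiv.coe_coe, Function.comp_apply, TensorProduct.map_tmul,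
      TensorProduct.assoc_symm_tmul]
    generalize τ x = r
    generalize υ y = s
    generalize ω z = t
    induction r with
    | zero => simp
    | add r r' h h' => simp only [TensorProduct.add_tmul, map_add, h, h']
    | tmul a x =>
      induction s with
      | zero => simp
      | add s s' h h' => simp only [TensorProduct.tmul_add, TensorProduct.add_tmul, map_add, h, h']
      | tmul b y =>
        induction t with
        | zero => simp
        | add t t' h h' => simp only [TensorProduct.tmul_add, map_add, h, h']
        | tmul c z => simp
  refine TensorProduct.ext' fun x v => ?_
  have hv := LinearMap.congr_fun h v
  simp only [LinearMap.coe_comp, Function.comp_apply, LinearEquiv.coe_coe] at hv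
  rw [LinearMap.comp_apply, LinearMap.comp_apply, LinearMap.lTensor_tmul, coactProd_tmul,
    coactProd_tmul, LinearEquiv.coe_coe, hv]
  generalize ρ x = r
  generalize coactProd τ (coactProd υ ω) v = s
  induction r with
  | zero => simp
  | add r r' h h' => simp only [TensorProduct.add_tmul, map_add, h, h']
  | tmul a x =>
    induction s with
    | zero => simp
    | add s s' h h' => simp only [TensorProduct.tmul_add, map_add, h, h']
    | tmul b y => simp

omit [DualQuasiBialgebra k H] in
lemma rTensor_twist (φ : H ⊗[k] (H ⊗[k] H) →ₗ[k] k) (hω : IsCoaction ω) :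
    (twist φ ρ τ υ).rTensor W ∘ₗ (TensorProduct.assoc k X (Y ⊗[k] Z) W).symm.toLinearMap ∘ₗ
        (TensorProduct.assoc k Y Z W).symm.toLinearMap.lTensor X =
      (TensorProduct.assoc k X (Y ⊗[k] Z) W).symm.toLinearMap ∘ₗ
        (TensorProduct.assoc k Y Z W).symm.toLinearMap.lTensor X ∘ₗ
        hit (φ ∘ₗ (((TensorProduct.rid k H).toLinearMap ∘ₗ counit.lTensor H).lTensor H).lTensor H)
      (coactProd ρ (coactProd τ (coactProd υ ω))) := by
  ext x y z w
  have hw := hω.counit_apply w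
  simp only [hit, twist, coactProd, TensorProduct.AlgebraTensorModule.curry_apply,
    LinearMap.restrictScalars_self, TensorProduct.curry_apply, LinearMap.coe_comp,
    LinearEquiv.coe_coe, Function.comp_apply, TensorProduct.map_tmul, LinearMap.lTensor_tmul,
    TensorProduct.assoc_symm_tmul, LinearMap.rTensor_tmul]
  conv_lhs => rw [← hw]
  generalize ρ x = r
  generalize τ y = s
  generalize υ z = t
  generalize ω w = q
  induction r with
  | zero => simp
  | add r r' h h' => simp only [TensorProduct.add_tmul, map_add, h, h']
  | tmul a x =>
    induction s with
    | zero => simp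
    | add s s' h h' => simp only [TensorProduct.tmul_add, TensorProduct.add_tmul, map_add, h, h']
    | tmul b y =>
      induction t with
      | zero => simp
      | add t t' h h' => simp only [TensorProduct.tmul_add, TensorProduct.add_tmul, map_add, h, h']
      | tmul c z =>
        induction q with
        | zero => simp
        | add q q' h h' =>
          simp only [TensorProduct.tmul_add, map_add, h, h']
        | tmul d w =>
          simp [← TensorProduct.smul_tmul', TensorProduct.tmul_smul, smul_smul]

/-- The pentagon identity, for the inverse of the associativity constraint: it is the cocycle
identity for `σ`, applied to the coaction of `H ⊗ (H ⊗ (H ⊗ H))` on `X ⊗ (Y ⊗ (Z ⊗ W))`. -/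
lemma pentagon_assocInvMap (hρ : IsCoaction ρ) (hτ : IsCoaction τ) (hυ : IsCoaction υ)
    (hω : IsCoaction ω) :
    assocInvMap (tensorCoact ρ τ) υ ω ∘ₗ assocInvMap ρ τ (tensorCoact υ ω) =
      (assocInvMap ρ τ υ).rTensor W ∘ₗ assocInvMap ρ (tensorCoact τ υ) ω ∘ₗ
        (assocInvMap τ υ ω).lTensor X := by
  have h4 := hρ.prod (hτ.prod (hυ.prod hω))
  have hc := congrArg (fun φ => hit φ.ofConv (coactProd ρ (coactProd τ (coactProd υ ω))))
    (cocycle (k := k) (H := H))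
  rw [hit_mul h4, hit_mul h4, hit_mul h4] at hc
  rw [← twist_tensorCoact_right, hit_coactProd_counit_left hρ] at hc
  have h1 := twist_tensorCoact_left (ρ := ρ) (τ := τ) (υ := υ) (ω := ω) σ
  have h2 := twist_tensorCoact_middle (ρ := ρ) (τ := τ) (υ := υ) (ω := ω) σ
  have h3 := rTensor_twist (ρ := ρ) (τ := τ) (υ := υ) σ hω
  refine LinearMap.ext fun x => ?_
  simp only [LinearMap.ext_iff, LinearMap.comp_apply, LinearEquiv.coe_coe] at h1 h2 h3 hc
  simp only [assocInvMap, LinearMap.lTensor_comp, LinearMap.rTensor_comp, LinearMap.comp_apply,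
    LinearEquiv.coe_coe]
  rw [h1, hc, h2, h3]
  have key : (TensorProduct.assoc k (X ⊗[k] Y) Z W).symm.toLinearMap ∘ₗ
      (TensorProduct.assoc k X Y (Z ⊗[k] W)).symm.toLinearMap =
      (TensorProduct.assoc k X Y Z).symm.toLinearMap.rTensor W ∘ₗ
        (TensorProduct.assoc k X (Y ⊗[k] Z) W).symm.toLinearMap ∘ₗ
        (TensorProduct.assoc k Y Z W).symm.toLinearMap.lTensor X := by
    ext; simp
  exact LinearMap.congr_fun key _

end Pentagon

/-! ### The monoidal category of comodules -/

/-- Left comodules over the coalgebra `H`. -/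
structure LComod (k H : Type u) [Field k] [AddCommGroup H] [Module k H] [Coalgebra k H] where
  carrier : Type u
  [addCommGroup : AddCommGroup carrier]
  [module : Module k carrier]
  coact : carrier →ₗ[k] H ⊗[k] carrier
  isCoaction : IsCoaction coact

namespace LComod

attribute [instance] LComod.addCommGroup LComod.module

section Category

variable {k H : Type u} [Field k] [AddCommGroup H] [Module k H] [Coalgebra k H]

/-- Colinear maps. -/
@[ext]
structure Hom (X Y : LComod k H) where
  lin : X.carrier →ₗ[k] Y.carrier
  colinear : Y.coact ∘ₗ lin = lin.lTensor H ∘ₗ X.coact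

noncomputable instance : Category (LComod k H) where
  Hom := Hom
  id X := ⟨LinearMap.id, by rw [LinearMap.lTensor_id]; rfl⟩
  comp f g := ⟨g.lin ∘ₗ f.lin, by
    rw [← LinearMap.comp_assoc, g.colinear, LinearMap.comp_assoc, f.colinear,
      LinearMap.lTensor_comp, LinearMap.comp_assoc]⟩

@[ext]
lemma hom_ext {X Y : LComod k H} {f g : X ⟶ Y} (h : f.lin = g.lin) : f = g := Hom.ext h

@[simp]
lemma id_lin (X : LComod k H) : Hom.lin (𝟙 X) = LinearMap.id := rfl

@[simp]
lemma comp_lin {X Y Z : LComod k H} (f : X ⟶ Y) (g : Y ⟶ Z) : (f ≫ g).lin = g.lin ∘ₗ f.lin := rfl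

/-- A colinear map with a linear two-sided inverse is an isomorphism of comodules. -/
noncomputable def isoMk {X Y : LComod k H} (f : X ⟶ Y) (g : Y.carrier →ₗ[k] X.carrier)
    (h : g ∘ₗ f.lin = LinearMap.id) (h' : f.lin ∘ₗ g = LinearMap.id) : X ≅ Y where
  hom := f
  inv := ⟨g, by
    have h1 := congrArg (fun e => g.lTensor H ∘ₗ e ∘ₗ g) f.colinear
    simp only [LinearMap.comp_assoc, h', LinearMap.comp_id] at h1
    rw [h1, ← LinearMap.comp_assoc, ← LinearMap.lTensor_comp, h, LinearMap.lTensor_id,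
      LinearMap.id_comp]⟩
  hom_inv_id := hom_ext h
  inv_hom_id := hom_ext h'

@[simp]
lemma hom_inv_lin {X Y : LComod k H} (e : X ≅ Y) : e.inv.lin ∘ₗ e.hom.lin = LinearMap.id :=
  congrArg Hom.lin e.hom_inv_id

@[simp]
lemma inv_hom_lin {X Y : LComod k H} (e : X ≅ Y) : e.hom.lin ∘ₗ e.inv.lin = LinearMap.id :=
  congrArg Hom.lin e.inv_hom_id

end Category

section Monoidal

variable {k H : Type u} [Field k] [AddCommGroup H] [Module k H] [Coalgebra k H]
  [DualQuasiBialgebra k H]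

noncomputable instance : MonoidalCategoryStruct (LComod k H) where
  tensorObj X Y := ⟨X.carrier ⊗[k] Y.carrier, tensorCoact X.coact Y.coact,
    X.isCoaction.tensor Y.isCoaction⟩
  tensorUnit := ⟨k, unitCoact k H, isCoaction_unitCoact⟩
  tensorHom f g := ⟨TensorProduct.map f.lin g.lin, tensorCoact_comp_map f.colinear g.colinear⟩
  whiskerLeft X _ _ g := ⟨TensorProduct.map LinearMap.id g.lin,
    tensorCoact_comp_map (Hom.colinear (𝟙 X)) g.colinear⟩
  whiskerRight f Y := ⟨TensorProduct.map f.lin LinearMap.id,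
    tensorCoact_comp_map f.colinear (Hom.colinear (𝟙 Y))⟩
  associator X Y Z := isoMk ⟨assocMap X.coact Y.coact Z.coact,
      tensorCoact_comp_assocMap X.isCoaction Y.isCoaction Z.isCoaction⟩
    (assocInvMap X.coact Y.coact Z.coact)
    (assocInvMap_comp_assocMap X.isCoaction Y.isCoaction Z.isCoaction)
    (assocMap_comp_assocInvMap X.isCoaction Y.isCoaction Z.isCoaction)
  leftUnitor X := isoMk ⟨(TensorProduct.lid k X.carrier).toLinearMap,
      tensorCoact_unitCoact_left X.coact⟩ (TensorProduct.lid k X.carrier).symm.toLinearMap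
    (by simp) (by simp)
  rightUnitor X := isoMk ⟨(TensorProduct.rid k X.carrier).toLinearMap,
      tensorCoact_unitCoact_right X.coact⟩ (TensorProduct.rid k X.carrier).symm.toLinearMap
    (by simp) (by simp)

open MonoidalCategory

@[simp]
lemma whiskerLeft_lin (X : LComod k H) {Y Y' : LComod k H} (g : Y ⟶ Y') :
    (X ◁ g).lin = TensorProduct.map LinearMap.id g.lin := rfl

@[simp]
lemma whiskerRight_lin {X X' : LComod k H} (f : X ⟶ X') (Y : LComod k H) :
    (f ▷ Y).lin = TensorProduct.map f.lin LinearMap.id := rfl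

lemma whiskerLeft_comp_whiskerLeft (X : LComod k H) {Y Y' Y'' : LComod k H} (f : Y ⟶ Y')
    (g : Y' ⟶ Y'') : X ◁ f ≫ X ◁ g = X ◁ (f ≫ g) := by
  ext1
  exact (TensorProduct.map_comp LinearMap.id g.lin LinearMap.id f.lin).symm

lemma whiskerRight_comp_whiskerRight {X X' X'' : LComod k H} (f : X ⟶ X') (g : X' ⟶ X'')
    (Y : LComod k H) : f ▷ Y ≫ g ▷ Y = (f ≫ g) ▷ Y := by
  ext1
  exact (TensorProduct.map_comp g.lin LinearMap.id f.lin LinearMap.id).symm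

omit [DualQuasiBialgebra k H] in
/-- Two maps that have a common inverse are equal. -/
lemma eq_of_inv {X Y : LComod k H} {f g : X ⟶ Y} {h : Y ⟶ X} (h1 : f ≫ h = 𝟙 X)
    (h2 : h ≫ g = 𝟙 Y) : f = g := by
  rw [← Category.comp_id f, ← h2, ← Category.assoc, h1, Category.id_comp]

/-- Left comodules over a dual quasi-bialgebra form a monoidal category. -/
noncomputable instance : MonoidalCategory (LComod k H) where
  tensorHom_def f g := by
    ext1
    exact TensorProduct.map_comp LinearMap.id g.lin f.lin LinearMap.id
  id_tensorHom_id X Y := by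
    ext1
    exact TensorProduct.map_id
  tensorHom_comp_tensorHom f g f' g' := by
    ext1
    exact (TensorProduct.map_comp f'.lin g'.lin f.lin g.lin).symm
  whiskerLeft_id X Y := by
    ext1
    exact TensorProduct.map_id
  id_whiskerRight X Y := by
    ext1
    exact TensorProduct.map_id
  associator_naturality f g h := by
    ext1
    exact assocMap_comp_map f.colinear g.colinear h.colinear
  leftUnitor_naturality f := by
    ext1
    exact TensorProduct.ext' fun a b => (map_smul f.lin a b).symm
  rightUnitor_naturality f := by
    ext1
    exact TensorProduct.ext' fun a b => (map_smul f.lin b a).symm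
  pentagon W X Y Z := by
    refine eq_of_inv (h := (α_ W X (Y ⊗ Z)).inv ≫ (α_ (W ⊗ X) Y Z).inv) ?_ ?_
    · have hp : (α_ W X (Y ⊗ Z)).inv ≫ (α_ (W ⊗ X) Y Z).inv =
          W ◁ (α_ X Y Z).inv ≫ (α_ W (X ⊗ Y) Z).inv ≫ (α_ W X Y).inv ▷ Z := by
        ext1
        exact pentagon_assocInvMap W.isCoaction X.isCoaction Y.isCoaction Z.isCoaction
      have h1 : W ◁ (α_ X Y Z).hom ≫ W ◁ (α_ X Y Z).inv = 𝟙 _ := by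
        rw [whiskerLeft_comp_whiskerLeft, Iso.hom_inv_id]
        ext1
        exact TensorProduct.map_id
      have h2 : (α_ W X Y).hom ▷ Z ≫ (α_ W X Y).inv ▷ Z = 𝟙 _ := by
        rw [whiskerRight_comp_whiskerRight, Iso.hom_inv_id]
        ext1
        exact TensorProduct.map_id
      rw [hp]
      simp only [Category.assoc]
      rw [reassoc_of% h1, Iso.hom_inv_id_assoc, h2]
    · simp
  triangle X Y := by
    have h : (α_ X (𝟙_ (LComod k H)) Y).inv ≫ (ρ_ X).hom ▷ Y = X ◁ (λ_ Y).hom := by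
      ext1
      exact triangle_assocInvMap X.isCoaction Y.isCoaction
    rw [← h, Iso.hom_inv_id_assoc]

end Monoidal

end LComod

/-! ### Maps given by an action, and natural families -/

section Cross

variable {k H : Type u} [Field k] [AddCommGroup H] [Module k H]
  {M N X Y : Type u} [AddCommGroup M] [Module k M] [AddCommGroup N] [Module k N]
  [AddCommGroup X] [Module k X] [AddCommGroup Y] [Module k Y]

lemma crossLeft_tmul (act : H →ₗ[k] M →ₗ[k] M) (τ : X →ₗ[k] H ⊗[k] X) (x : X) (m : M) :
    crossLeft act τ (x ⊗ₜ m) = TensorProduct.map (act.flip m) LinearMap.id (τ x) := by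
  simp only [crossLeft, LinearMap.coe_comp, LinearEquiv.coe_coe, Function.comp_apply,
    LinearMap.rTensor_tmul]
  generalize τ x = r
  induction r with
  | zero => simp
  | add r r' h h' => simp only [TensorProduct.add_tmul, map_add, h, h']
  | tmul a x => simp

lemma crossRight_tmul (act : H →ₗ[k] M →ₗ[k] M) (τ : X →ₗ[k] H ⊗[k] X) (x : X) (m : M) :
    crossRight act τ (m ⊗ₜ x) =
      TensorProduct.comm k M X (TensorProduct.map (act.flip m) LinearMap.id (τ x)) := by
  simp only [crossRight, LinearMap.coe_comp, LinearEquiv.coe_coe, Function.comp_apply,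
    LinearMap.lTensor_tmul]
  generalize τ x = r
  induction r with
  | zero => simp
  | add r r' h h' => simp only [TensorProduct.tmul_add, map_add, h, h']
  | tmul a x => simp

lemma crossRight_eq (act : H →ₗ[k] M →ₗ[k] M) (τ : X →ₗ[k] H ⊗[k] X) :
    crossRight act τ = (TensorProduct.comm k M X).toLinearMap ∘ₗ crossLeft act τ ∘ₗ
      (TensorProduct.comm k M X).toLinearMap :=
  TensorProduct.ext' fun m x => by simp [crossRight_tmul, crossLeft_tmul]

lemma crossLeft_comp_map (act : H →ₗ[k] M →ₗ[k] M) {τ : X →ₗ[k] H ⊗[k] X}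
    {τ' : Y →ₗ[k] H ⊗[k] Y} {f : X →ₗ[k] Y} (hf : τ' ∘ₗ f = f.lTensor H ∘ₗ τ) :
    crossLeft act τ' ∘ₗ TensorProduct.map f LinearMap.id =
      TensorProduct.map LinearMap.id f ∘ₗ crossLeft act τ :=
  TensorProduct.ext' fun x m => by
    have := LinearMap.congr_fun hf x
    simp only [LinearMap.comp_apply] at this
    simp only [LinearMap.comp_apply, TensorProduct.map_tmul, crossLeft_tmul, this,
      LinearMap.lTensor, TensorProduct.map_map, LinearMap.id_comp, LinearMap.comp_id,
      LinearMap.id_apply]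

lemma crossRight_comp_map (act : H →ₗ[k] M →ₗ[k] M) {τ : X →ₗ[k] H ⊗[k] X}
    {τ' : Y →ₗ[k] H ⊗[k] Y} {f : X →ₗ[k] Y} (hf : τ' ∘ₗ f = f.lTensor H ∘ₗ τ) :
    crossRight act τ' ∘ₗ TensorProduct.map LinearMap.id f =
      TensorProduct.map f LinearMap.id ∘ₗ crossRight act τ := by
  have h := crossLeft_comp_map act hf
  refine TensorProduct.ext' fun m x => ?_
  have := LinearMap.congr_fun h (x ⊗ₜ m)
  simp only [LinearMap.comp_apply, TensorProduct.map_tmul, LinearMap.id_apply] at this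
  simp [crossRight_eq, this, TensorProduct.map_comm]

/-- Maps commuting with the operators of `H` commute with the braiding. -/
lemma map_comp_crossLeft {act : H →ₗ[k] M →ₗ[k] M} {act' : H →ₗ[k] N →ₗ[k] N}
    {f : M →ₗ[k] N} (hf : ∀ h m, f (act h m) = act' h (f m)) (τ : X →ₗ[k] H ⊗[k] X) :
    TensorProduct.map f LinearMap.id ∘ₗ crossLeft act τ =
      crossLeft act' τ ∘ₗ TensorProduct.map LinearMap.id f :=
  TensorProduct.ext' fun x m => by
    have : f ∘ₗ act.flip m = act'.flip (f m) := LinearMap.ext fun h => hf h m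
    simp only [LinearMap.comp_apply, TensorProduct.map_tmul, crossLeft_tmul,
      TensorProduct.map_map, LinearMap.comp_id,
      LinearMap.id_apply, this]

lemma map_comp_crossRight {act : H →ₗ[k] M →ₗ[k] M} {act' : H →ₗ[k] N →ₗ[k] N}
    {f : M →ₗ[k] N} (hf : ∀ h m, f (act h m) = act' h (f m)) (τ : X →ₗ[k] H ⊗[k] X) :
    TensorProduct.map LinearMap.id f ∘ₗ crossRight act τ =
      crossRight act' τ ∘ₗ TensorProduct.map f LinearMap.id := by
  have h := map_comp_crossLeft hf τ
  refine TensorProduct.ext' fun m x => ?_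
  have := LinearMap.congr_fun h (x ⊗ₜ m)
  simp only [LinearMap.comp_apply, TensorProduct.map_tmul, LinearMap.id_apply] at this
  simp [crossRight_eq, ← this, TensorProduct.map_comm]

variable [Coalgebra k H]

/-- `n ⊗ h ↦ ε(h) n`. -/
noncomputable abbrev counitRight (k H N : Type u) [Field k] [AddCommGroup H] [Module k H]
    [Coalgebra k H] [AddCommGroup N] [Module k N] : N ⊗[k] H →ₗ[k] N :=
  (TensorProduct.rid k N).toLinearMap ∘ₗ TensorProduct.map LinearMap.id counit

/-- `h ⊗ n ↦ ε(h) n`. -/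
noncomputable abbrev counitLeft (k H N : Type u) [Field k] [AddCommGroup H] [Module k H]
    [Coalgebra k H] [AddCommGroup N] [Module k N] : H ⊗[k] N →ₗ[k] N :=
  (TensorProduct.lid k N).toLinearMap ∘ₗ TensorProduct.map counit LinearMap.id

/-- The operators `m ↦ h · m` are recovered from `h ⊗ m ↦ h₁ · m ⊗ h₂`. -/
lemma counitRight_crossLeft (act : H →ₗ[k] M →ₗ[k] M) (h : H) (m : M) :
    counitRight k H M (crossLeft act comul (h ⊗ₜ m)) = act h m := by
  rw [crossLeft_tmul]
  have := Coalgebra.lTensor_counit_comul (R := k) h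
  rw [LinearMap.comp_apply, TensorProduct.map_map, LinearMap.id_comp, LinearMap.comp_id,
    ← LinearMap.comp_id (act.flip m), ← LinearMap.id_comp counit, ← TensorProduct.map_map,
    ← LinearMap.lTensor, this]
  simp

lemma counitLeft_crossRight (act : H →ₗ[k] M →ₗ[k] M) (h : H) (m : M) :
    counitLeft k H M (crossRight act comul (m ⊗ₜ h)) = act h m := by
  rw [← counitRight_crossLeft, crossRight_eq]
  simp only [LinearMap.comp_apply, LinearEquiv.coe_coe, TensorProduct.comm_tmul]
  generalize crossLeft act comul (h ⊗ₜ m) = t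
  induction t with
  | zero => simp
  | add t t' h h' => simp only [map_add, h, h']
  | tmul m g => simp

/-- The regular comodule. -/
noncomputable abbrev LComod.regular (k H : Type u) [Field k] [AddCommGroup H] [Module k H]
    [Coalgebra k H] : LComod k H :=
  ⟨H, comul, isCoaction_comul⟩

/-- The cofree comodule `H ⊗ V`. -/
noncomputable abbrev LComod.cofree (k H V : Type u) [Field k] [AddCommGroup H] [Module k H]
    [Coalgebra k H] [AddCommGroup V] [Module k V] : LComod k H :=
  ⟨H ⊗[k] V, (TensorProduct.assoc k H H V).toLinearMap ∘ₗ comul.rTensor V, by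
    constructor
    · refine TensorProduct.ext' fun h v => ?_
      have h1 := Coalgebra.coassoc_apply (R := k) h
      simp only [LinearMap.comp_apply, LinearMap.rTensor_tmul, LinearEquiv.coe_coe]
      have h2 : ∀ t : H ⊗[k] H, ((TensorProduct.assoc k H H V).toLinearMap ∘ₗ
          comul.rTensor V).lTensor H (TensorProduct.assoc k H H V (t ⊗ₜ v)) =
          (TensorProduct.assoc k H H V).toLinearMap.lTensor H
            (TensorProduct.assoc k H (H ⊗[k] H) V (comul.lTensor H t ⊗ₜ v)) := fun t => by
        induction t with
        | zero => simp
        | add t t' h h' => simp only [TensorProduct.add_tmul, map_add, h, h']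
        | tmul a b => simp
      have h3 : ∀ t : H ⊗[k] H, comul.rTensor (H ⊗[k] V) (TensorProduct.assoc k H H V (t ⊗ₜ v)) =
          TensorProduct.assoc k (H ⊗[k] H) H V (comul.rTensor H t ⊗ₜ v) := fun t => by
        induction t with
        | zero => simp
        | add t t' h h' => simp only [TensorProduct.add_tmul, map_add, h, h']
        | tmul a b => simp
      rw [h2, h3, ← h1]
      generalize (comul (R := k)).rTensor H (comul h) = t
      induction t with
      | zero => simp
      | add t t' h h' => simp only [TensorProduct.add_tmul, map_add, h, h']
      | tmul a b =>
        induction a with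
        | zero => simp
        | add t t' h h' => simp only [TensorProduct.add_tmul, map_add, h, h']
        | tmul a c => simp
    · refine TensorProduct.ext' fun h v => ?_
      have h1 := Coalgebra.rTensor_counit_comul (R := k) h
      have h3 : ∀ t : H ⊗[k] H, counit.rTensor (H ⊗[k] V) (TensorProduct.assoc k H H V (t ⊗ₜ v)) =
          TensorProduct.assoc k k H V (counit.rTensor H t ⊗ₜ v) := fun t => by
        induction t with
        | zero => simp
        | add t t' h h' => simp only [TensorProduct.add_tmul, map_add, h, h']
        | tmul a b => simp
      simp only [LinearMap.comp_apply, LinearMap.rTensor_tmul, LinearEquiv.coe_coe, h3, h1]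
      simp⟩

/-- A natural family of maps `F X : X ⊗ N → M ⊗ X` is determined by the composite
`(M ⊗ ε) ∘ F H`: the coaction embeds `X` into the cofree comodule `H ⊗ X`. -/
lemma natural_ext {F G : ∀ X : LComod k H, X.carrier ⊗[k] N →ₗ[k] M ⊗[k] X.carrier}
    (hF : ∀ {X Y : LComod k H} (f : X ⟶ Y), F Y ∘ₗ TensorProduct.map f.lin LinearMap.id =
      TensorProduct.map LinearMap.id f.lin ∘ₗ F X)
    (hG : ∀ {X Y : LComod k H} (f : X ⟶ Y), G Y ∘ₗ TensorProduct.map f.lin LinearMap.id =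
      TensorProduct.map LinearMap.id f.lin ∘ₗ G X)
    (h : counitRight k H M ∘ₗ F (LComod.regular k H) = counitRight k H M ∘ₗ G (LComod.regular k H))
    (X : LComod k H) : F X = G X := by
  have key : ∀ {F : ∀ X : LComod k H, X.carrier ⊗[k] N →ₗ[k] M ⊗[k] X.carrier}
      (_ : ∀ {X Y : LComod k H} (f : X ⟶ Y), F Y ∘ₗ TensorProduct.map f.lin LinearMap.id =
      TensorProduct.map LinearMap.id f.lin ∘ₗ F X),
      F X = (counitRight k H M ∘ₗ F (LComod.regular k H)).rTensor X.carrier ∘ₗ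
        (TensorProduct.rightComm k H X.carrier N).toLinearMap ∘ₗ X.coact.rTensor N := by
    intro F hF
    let i : X ⟶ LComod.cofree k H X.carrier := ⟨X.coact, X.isCoaction.coassoc.symm⟩
    let j : X.carrier → (LComod.regular k H ⟶ LComod.cofree k H X.carrier) := fun v =>
      ⟨(TensorProduct.mk k H X.carrier).flip v, by
        refine LinearMap.ext fun h => ?_
        simp only [LinearMap.comp_apply, LinearMap.flip_apply, TensorProduct.mk_apply,
          LinearMap.rTensor_tmul, LinearEquiv.coe_coe]
        generalize comul (R := k) h = t
        induction t with
        | zero => simp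
        | add t t' h h' => simp only [TensorProduct.add_tmul, map_add, h, h']
        | tmul a b => simp⟩
    refine TensorProduct.ext' fun x n => ?_
    have h1 := LinearMap.congr_fun (hF i) (x ⊗ₜ n)
    simp only [LinearMap.comp_apply, TensorProduct.map_tmul, LinearMap.id_apply, i] at h1
    have h2 : TensorProduct.map LinearMap.id ((TensorProduct.lid k X.carrier).toLinearMap ∘ₗ
        counit.rTensor X.carrier) (TensorProduct.map LinearMap.id X.coact (F X (x ⊗ₜ n))) =
        F X (x ⊗ₜ n) := by
      rw [TensorProduct.map_map, LinearMap.comp_assoc, X.isCoaction.counit]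
      simp
    rw [← h2, ← h1]
    simp only [LinearMap.comp_apply, LinearMap.rTensor_tmul, LinearEquiv.coe_coe]
    generalize X.coact x = t
    induction t with
    | zero => simp
    | add t t' h h' => simp only [TensorProduct.add_tmul, map_add, h, h']
    | tmul a v =>
      have h3 := LinearMap.congr_fun (hF (j v)) (a ⊗ₜ n)
      simp only [LinearMap.comp_apply, TensorProduct.map_tmul, LinearMap.id_apply, j,
        LinearMap.flip_apply, TensorProduct.mk_apply] at h3
      rw [h3]
      simp only [TensorProduct.rightComm_tmul, LinearMap.rTensor_tmul, LinearMap.comp_apply]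
      generalize F (LComod.regular k H) (a ⊗ₜ n) = w
      induction w with
      | zero => simp
      | add t t' h h' => simp only [TensorProduct.add_tmul, map_add, h, h']
      | tmul m b => simp [TensorProduct.smul_tmul]
  rw [key hF, key hG, h]

end Cross

/-! ### Natural families in two variables -/

section NaturalExt

variable {k H : Type u} [Field k] [AddCommGroup H] [Module k H] [Coalgebra k H]
  {M N : Type u} [AddCommGroup M] [Module k M] [AddCommGroup N] [Module k N]

/-- The mirror image of `natural_ext`. -/
lemma natural_ext_right {F G : ∀ X : LComod k H, N ⊗[k] X.carrier →ₗ[k] X.carrier ⊗[k] M}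
    (hF : ∀ {X Y : LComod k H} (f : X ⟶ Y), F Y ∘ₗ TensorProduct.map LinearMap.id f.lin =
      TensorProduct.map f.lin LinearMap.id ∘ₗ F X)
    (hG : ∀ {X Y : LComod k H} (f : X ⟶ Y), G Y ∘ₗ TensorProduct.map LinearMap.id f.lin =
      TensorProduct.map f.lin LinearMap.id ∘ₗ G X)
    (h : counitLeft k H M ∘ₗ F (LComod.regular k H) = counitLeft k H M ∘ₗ G (LComod.regular k H))
    (X : LComod k H) : F X = G X := by
  have nat : ∀ {F : ∀ X : LComod k H, N ⊗[k] X.carrier →ₗ[k] X.carrier ⊗[k] M}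
      (_ : ∀ {X Y : LComod k H} (f : X ⟶ Y), F Y ∘ₗ TensorProduct.map LinearMap.id f.lin =
        TensorProduct.map f.lin LinearMap.id ∘ₗ F X) {X Y : LComod k H} (f : X ⟶ Y),
      ((TensorProduct.comm k Y.carrier M).toLinearMap ∘ₗ F Y ∘ₗ
          (TensorProduct.comm k Y.carrier N).toLinearMap) ∘ₗ
        TensorProduct.map f.lin LinearMap.id = TensorProduct.map LinearMap.id f.lin ∘ₗ
        ((TensorProduct.comm k X.carrier M).toLinearMap ∘ₗ F X ∘ₗ
          (TensorProduct.comm k X.carrier N).toLinearMap) := fun {F} hF {X Y} f => by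
    refine TensorProduct.ext' fun x n => ?_
    have := LinearMap.congr_fun (hF f) (n ⊗ₜ x)
    simp only [LinearMap.comp_apply, TensorProduct.map_tmul, LinearMap.id_apply] at this
    simp [this, TensorProduct.map_comm]
  have hε : ∀ t, counitRight k H M (TensorProduct.comm k H M t) = counitLeft k H M t := fun t => by
    induction t with
    | zero => simp
    | add t t' h h' => simp only [map_add, h, h']
    | tmul m g => simp
  have := natural_ext (nat hF) (nat hG) (LinearMap.ext fun v => by
    have := LinearMap.congr_fun h (TensorProduct.comm k H N v)
    simpa only [LinearMap.comp_apply, LinearEquiv.coe_coe, hε] using this) X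
  refine LinearMap.ext fun v => (TensorProduct.comm k X.carrier M).injective ?_
  simpa using LinearMap.congr_fun this (TensorProduct.comm k N X.carrier v)

/-- A family of maps `X ⊗ (Y ⊗ N) → (M ⊗ X) ⊗ Y` that is natural in `X` and `Y` is determined by
its composite with the counits for `X = Y = H`. -/
lemma natural_ext₂ {F G : ∀ X Y : LComod k H,
      X.carrier ⊗[k] (Y.carrier ⊗[k] N) →ₗ[k] (M ⊗[k] X.carrier) ⊗[k] Y.carrier}
    (hF : ∀ {X Y X' Y' : LComod k H} (f : X ⟶ X') (g : Y ⟶ Y'),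
      F X' Y' ∘ₗ TensorProduct.map f.lin (TensorProduct.map g.lin LinearMap.id) =
      TensorProduct.map (TensorProduct.map LinearMap.id f.lin) g.lin ∘ₗ F X Y)
    (hG : ∀ {X Y X' Y' : LComod k H} (f : X ⟶ X') (g : Y ⟶ Y'),
      G X' Y' ∘ₗ TensorProduct.map f.lin (TensorProduct.map g.lin LinearMap.id) =
      TensorProduct.map (TensorProduct.map LinearMap.id f.lin) g.lin ∘ₗ G X Y)
    (h : counitRight k H M ∘ₗ counitRight k H (M ⊗[k] H) ∘ₗ
        F (LComod.regular k H) (LComod.regular k H) =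
      counitRight k H M ∘ₗ counitRight k H (M ⊗[k] H) ∘ₗ
        G (LComod.regular k H) (LComod.regular k H))
    (X Y : LComod k H) : F X Y = G X Y := by
  let R := LComod.regular k H
  -- The two families, with the factor `X` moved to the outside.
  let A (F : ∀ X Y : LComod k H, X.carrier ⊗[k] (Y.carrier ⊗[k] N) →ₗ[k]
      (M ⊗[k] X.carrier) ⊗[k] Y.carrier) (Y X : LComod k H) :
      X.carrier ⊗[k] (Y.carrier ⊗[k] N) →ₗ[k] (M ⊗[k] Y.carrier) ⊗[k] X.carrier :=
    (TensorProduct.rightComm k M X.carrier Y.carrier).toLinearMap ∘ₗ F X Y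
  let B (F : ∀ X Y : LComod k H, X.carrier ⊗[k] (Y.carrier ⊗[k] N) →ₗ[k]
      (M ⊗[k] X.carrier) ⊗[k] Y.carrier) (Y : LComod k H) :
      Y.carrier ⊗[k] (H ⊗[k] N) →ₗ[k] M ⊗[k] Y.carrier :=
    counitRight k H (M ⊗[k] Y.carrier) ∘ₗ A F Y R ∘ₗ
      (TensorProduct.leftComm k Y.carrier H N).toLinearMap
  have natA : ∀ {F : ∀ X Y : LComod k H, X.carrier ⊗[k] (Y.carrier ⊗[k] N) →ₗ[k]
      (M ⊗[k] X.carrier) ⊗[k] Y.carrier}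
      (_ : ∀ {X Y X' Y' : LComod k H} (f : X ⟶ X') (g : Y ⟶ Y'),
        F X' Y' ∘ₗ TensorProduct.map f.lin (TensorProduct.map g.lin LinearMap.id) =
        TensorProduct.map (TensorProduct.map LinearMap.id f.lin) g.lin ∘ₗ F X Y)
      {X Y X' Y' : LComod k H} (f : X ⟶ X') (g : Y ⟶ Y'),
        A F Y' X' ∘ₗ TensorProduct.map f.lin (TensorProduct.map g.lin LinearMap.id) =
        TensorProduct.map (TensorProduct.map LinearMap.id g.lin) f.lin ∘ₗ A F Y X := by
    intro F hF X Y X' Y' f g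
    refine LinearMap.ext fun v => ?_
    have := LinearMap.congr_fun (hF f g) v
    simp only [LinearMap.comp_apply] at this
    simp only [A, LinearMap.comp_apply, this, LinearEquiv.coe_coe]
    generalize F X Y v = t
    induction t with
    | zero => simp
    | add t t' h h' => simp only [map_add, h, h']
    | tmul m g =>
      induction m with
      | zero => simp
      | add t t' h h' => simp only [TensorProduct.add_tmul, map_add, h, h']
      | tmul a b => simp
  have natB : ∀ {F : ∀ X Y : LComod k H, X.carrier ⊗[k] (Y.carrier ⊗[k] N) →ₗ[k]
      (M ⊗[k] X.carrier) ⊗[k] Y.carrier}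
      (_ : ∀ {X Y X' Y' : LComod k H} (f : X ⟶ X') (g : Y ⟶ Y'),
        F X' Y' ∘ₗ TensorProduct.map f.lin (TensorProduct.map g.lin LinearMap.id) =
        TensorProduct.map (TensorProduct.map LinearMap.id f.lin) g.lin ∘ₗ F X Y)
      {Y Y' : LComod k H} (g : Y ⟶ Y'),
        B F Y' ∘ₗ TensorProduct.map g.lin LinearMap.id =
        TensorProduct.map LinearMap.id g.lin ∘ₗ B F Y := by
    intro F hF Y Y' g
    refine TensorProduct.ext' fun y v => ?_
    induction v with
    | zero => simp
    | add t t' h h' => simp only [TensorProduct.tmul_add, map_add, h, h']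
    | tmul a n =>
      have := LinearMap.congr_fun (natA hF (𝟙 R) g) (a ⊗ₜ (y ⊗ₜ n))
      simp only [LinearMap.comp_apply, TensorProduct.map_tmul, LinearMap.id_apply,
        LComod.id_lin] at this
      simp only [B, LinearMap.comp_apply, TensorProduct.map_tmul, LinearMap.id_apply,
        LinearEquiv.coe_coe, TensorProduct.leftComm_tmul]
      rw [this]
      generalize A F Y R _ = t
      induction t with
      | zero => simp
      | add t t' h h' => simp only [map_add, h, h']
      | tmul m g => simp
  have hε : ∀ t, counitRight k H M (counitRight k H (M ⊗[k] H)
      (TensorProduct.rightComm k M H H t)) =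
      counitRight k H M (counitRight k H (M ⊗[k] H) t) := fun t => by
    induction t with
    | zero => simp
    | add t t' h h' => simp only [map_add, h, h']
    | tmul m g =>
      induction m with
      | zero => simp
      | add t t' h h' => simp only [TensorProduct.add_tmul, map_add, h, h']
      | tmul a b => simp [smul_smul, mul_comm]
  have hB : ∀ Y, B F Y = B G Y := natural_ext (natB hF) (natB hG) (LinearMap.ext fun v => by
    have := LinearMap.congr_fun h (TensorProduct.leftComm k H H N v)
    exact (hε _).trans (Eq.trans this (hε _).symm))
  have hA : ∀ X, A F Y X = A G Y X := natural_ext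
    (fun f => by simpa using natA hF f (𝟙 Y)) (fun f => by simpa using natA hG f (𝟙 Y)) (by
      refine LinearMap.ext fun v => ?_
      simpa [B, R] using LinearMap.congr_fun (hB Y)
        ((TensorProduct.leftComm k Y.carrier H N).symm v))
  refine LinearMap.ext fun v => (TensorProduct.rightComm k M X.carrier Y.carrier).injective ?_
  exact LinearMap.congr_fun (hA X) v

/-- The mirror image of `natural_ext₂`. -/
lemma natural_ext₂_right {F G : ∀ X Y : LComod k H,
      (N ⊗[k] X.carrier) ⊗[k] Y.carrier →ₗ[k] X.carrier ⊗[k] (Y.carrier ⊗[k] M)}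
    (hF : ∀ {X Y X' Y' : LComod k H} (f : X ⟶ X') (g : Y ⟶ Y'),
      F X' Y' ∘ₗ TensorProduct.map (TensorProduct.map LinearMap.id f.lin) g.lin =
      TensorProduct.map f.lin (TensorProduct.map g.lin LinearMap.id) ∘ₗ F X Y)
    (hG : ∀ {X Y X' Y' : LComod k H} (f : X ⟶ X') (g : Y ⟶ Y'),
      G X' Y' ∘ₗ TensorProduct.map (TensorProduct.map LinearMap.id f.lin) g.lin =
      TensorProduct.map f.lin (TensorProduct.map g.lin LinearMap.id) ∘ₗ G X Y)
    (h : counitLeft k H M ∘ₗ counitLeft k H (H ⊗[k] M) ∘ₗ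
        F (LComod.regular k H) (LComod.regular k H) =
      counitLeft k H M ∘ₗ counitLeft k H (H ⊗[k] M) ∘ₗ
        G (LComod.regular k H) (LComod.regular k H))
    (X Y : LComod k H) : F X Y = G X Y := by
  let c (X Y N : Type u) [AddCommGroup X] [Module k X] [AddCommGroup Y] [Module k Y]
      [AddCommGroup N] [Module k N] : X ⊗[k] (Y ⊗[k] N) ≃ₗ[k] (N ⊗[k] Y) ⊗[k] X :=
    TensorProduct.comm k X (Y ⊗[k] N) ≪≫ₗ
      TensorProduct.congr (TensorProduct.comm k Y N) (LinearEquiv.refl k X)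
  let A (F : ∀ X Y : LComod k H, (N ⊗[k] X.carrier) ⊗[k] Y.carrier →ₗ[k]
      X.carrier ⊗[k] (Y.carrier ⊗[k] M)) (Y X : LComod k H) :
      Y.carrier ⊗[k] (X.carrier ⊗[k] N) →ₗ[k] (M ⊗[k] Y.carrier) ⊗[k] X.carrier :=
    (c X.carrier Y.carrier M).toLinearMap ∘ₗ F X Y ∘ₗ (c Y.carrier X.carrier N).toLinearMap
  have hc : ∀ {X Y N X' Y' N' : Type u} [AddCommGroup X] [Module k X] [AddCommGroup Y] [Module k Y]
      [AddCommGroup N] [Module k N] [AddCommGroup X'] [Module k X'] [AddCommGroup Y'] [Module k Y']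
      [AddCommGroup N'] [Module k N'] (f : X →ₗ[k] X') (g : Y →ₗ[k] Y') (e : N →ₗ[k] N') (v),
      c X' Y' N' (TensorProduct.map f (TensorProduct.map g e) v) =
        TensorProduct.map (TensorProduct.map e g) f (c X Y N v) := by
    intro X Y N X' Y' N' _ _ _ _ _ _ _ _ _ _ _ _ f g e v
    induction v with
    | zero => simp
    | add t t' h h' => simp only [map_add, h, h']
    | tmul x v =>
      induction v with
      | zero => simp
      | add t t' h h' => simp only [TensorProduct.tmul_add, map_add, h, h']
      | tmul a b => simp [c]
  have nat : ∀ {F : ∀ X Y : LComod k H, (N ⊗[k] X.carrier) ⊗[k] Y.carrier →ₗ[k]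
      X.carrier ⊗[k] (Y.carrier ⊗[k] M)}
      (_ : ∀ {X Y X' Y' : LComod k H} (f : X ⟶ X') (g : Y ⟶ Y'),
        F X' Y' ∘ₗ TensorProduct.map (TensorProduct.map LinearMap.id f.lin) g.lin =
        TensorProduct.map f.lin (TensorProduct.map g.lin LinearMap.id) ∘ₗ F X Y)
      {X Y X' Y' : LComod k H} (f : X ⟶ X') (g : Y ⟶ Y'),
        A F X' Y' ∘ₗ TensorProduct.map f.lin (TensorProduct.map g.lin LinearMap.id) =
        TensorProduct.map (TensorProduct.map LinearMap.id f.lin) g.lin ∘ₗ A F X Y := by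
    intro F hF X Y X' Y' f g
    refine LinearMap.ext fun v => ?_
    have := LinearMap.congr_fun (hF g f) (c X.carrier Y.carrier N v)
    simp only [LinearMap.comp_apply] at this
    simp only [A, LinearMap.comp_apply, LinearEquiv.coe_coe, hc, this]
  have hε : ∀ t, counitRight k H M (counitRight k H (M ⊗[k] H) (c H H M t)) =
      counitLeft k H M (counitLeft k H (H ⊗[k] M) t) := fun t => by
    induction t with
    | zero => simp
    | add t t' h h' => simp only [map_add, h, h']
    | tmul g m =>
      induction m with
      | zero => simp
      | add t t' h h' => simp only [TensorProduct.tmul_add, map_add, h, h']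
      | tmul a b => simp [c]
  have := natural_ext₂ (nat hF) (nat hG) (LinearMap.ext fun v => by
    have := LinearMap.congr_fun h (c H H N v)
    exact (hε _).trans (Eq.trans this (hε _).symm)) Y X
  refine LinearMap.ext fun v => (c X.carrier Y.carrier M).injective ?_
  simpa [A] using LinearMap.congr_fun this ((c Y.carrier X.carrier N).symm v)

end NaturalExt

/-! ### Colinearity and counits -/

section HalfBraidings

open DualQuasiBialgebra

variable {k H : Type u} [Field k] [AddCommGroup H] [Module k H] [Coalgebra k H]
  [DualQuasiBialgebra k H]
  {M X Y : Type u} [AddCommGroup M] [Module k M] [AddCommGroup X] [Module k X]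
  [AddCommGroup Y] [Module k Y]

lemma counitRight_tensorCoact (μ : M →ₗ[k] H ⊗[k] M) (v : M ⊗[k] H) :
    counitRight k H (H ⊗[k] M) ((TensorProduct.assoc k H M H).symm (tensorCoact μ comul v)) =
      mul.rTensor M (coactBefore H μ v) := by
  induction v with
  | zero => simp
  | add t t' h h' => simp only [map_add, h, h']
  | tmul m h =>
    have hh := Coalgebra.lTensor_counit_comul (R := k) h
    have h2 : (TensorProduct.rid k H).toLinearMap (counit.lTensor H (comul (R := k) h)) = h := by
      rw [hh]; simp
    simp only [tensorCoact, coactProd, coactBefore, LinearMap.comp_apply, LinearEquiv.coe_coe,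
      TensorProduct.map_tmul, LinearMap.rTensor_tmul]
    conv_rhs => rw [← h2]
    generalize μ m = s
    generalize comul (R := k) h = t
    induction s with
    | zero => simp
    | add t t' h h' => simp only [TensorProduct.add_tmul, map_add, h, h']
    | tmul a m =>
      induction t with
      | zero => simp
      | add t t' h h' => simp only [TensorProduct.tmul_add, map_add, h, h']
      | tmul b c => simp

lemma counitLeft_tensorCoact (μ : M →ₗ[k] H ⊗[k] M) (v : H ⊗[k] M) :
    counitLeft k H (H ⊗[k] M) (TensorProduct.leftComm k H H M (tensorCoact comul μ v)) =
      mul.rTensor M (coactAfter H μ v) := by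
  induction v with
  | zero => simp
  | add t t' h h' => simp only [map_add, h, h']
  | tmul h m =>
    have hh := Coalgebra.lTensor_counit_comul (R := k) h
    have h2 : (TensorProduct.rid k H).toLinearMap (counit.lTensor H (comul (R := k) h)) = h := by
      rw [hh]; simp
    simp only [tensorCoact, coactProd, coactAfter, LinearMap.comp_apply, LinearEquiv.coe_coe,
      TensorProduct.map_tmul, LinearMap.lTensor_tmul]
    conv_rhs => rw [← h2]
    generalize μ m = s
    generalize comul (R := k) h = t
    induction s with
    | zero => simp
    | add t t' h h' => simp only [TensorProduct.tmul_add, map_add, h, h']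
    | tmul a m =>
      induction t with
      | zero => simp
      | add t t' h h' => simp only [TensorProduct.add_tmul, map_add, h, h']
      | tmul b c => simp [← TensorProduct.smul_tmul']

lemma counitRight_lTensor_crossLeft (act : H →ₗ[k] M →ₗ[k] M) (μ : M →ₗ[k] H ⊗[k] M)
    (v : H ⊗[k] M) :
    counitRight k H (H ⊗[k] M) ((TensorProduct.assoc k H M H).symm
      ((crossLeft act comul).lTensor H (tensorCoact comul μ v))) =
      TensorProduct.map mul (TensorProduct.lift act) (coactProd comul μ v) := by
  have h1 : ∀ w : H ⊗[k] (M ⊗[k] H), counitRight k H (H ⊗[k] M)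
      ((TensorProduct.assoc k H M H).symm w) = (counitRight k H M).lTensor H w := fun w => by
    induction w with
    | zero => simp
    | add t t' h h' => simp only [map_add, h, h']
    | tmul h w =>
      induction w with
      | zero => simp
      | add t t' h h' => simp only [TensorProduct.tmul_add, map_add, h, h']
      | tmul m g => simp
  have h2 : counitRight k H M ∘ₗ crossLeft act comul = TensorProduct.lift act :=
    TensorProduct.ext' fun h m => counitRight_crossLeft act h m
  rw [h1, ← LinearMap.lTensor_comp_apply, h2, tensorCoact, LinearMap.comp_apply,
    ← LinearMap.comp_apply, LinearMap.lTensor_comp_rTensor]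

lemma counitLeft_lTensor_crossRight (act : H →ₗ[k] M →ₗ[k] M) (μ : M →ₗ[k] H ⊗[k] M)
    (v : M ⊗[k] H) :
    counitLeft k H (H ⊗[k] M) (TensorProduct.leftComm k H H M
      ((crossRight act comul).lTensor H (tensorCoact μ comul v))) =
      TensorProduct.map mul (TensorProduct.lift act.flip) (coactProd μ comul v) := by
  have h1 : ∀ w : H ⊗[k] (H ⊗[k] M), counitLeft k H (H ⊗[k] M)
      (TensorProduct.leftComm k H H M w) = (counitLeft k H M).lTensor H w := fun w => by
    induction w with
    | zero => simp
    | add t t' h h' => simp only [map_add, h, h']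
    | tmul h w =>
      induction w with
      | zero => simp
      | add t t' h h' => simp only [TensorProduct.tmul_add, map_add, h, h']
      | tmul m g => simp
  have h2 : counitLeft k H M ∘ₗ crossRight act comul = TensorProduct.lift act.flip :=
    TensorProduct.ext' fun m h => counitLeft_crossRight act h m
  rw [h1, ← LinearMap.lTensor_comp_apply, h2, tensorCoact, LinearMap.comp_apply,
    ← LinearMap.comp_apply, LinearMap.lTensor_comp_rTensor]

/-- The compatibility axiom of left-left Yetter-Drinfeld modules says that the maps
`x ⊗ m ↦ x₋₁ · m ⊗ x₀` are colinear. -/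
lemma left_compat_iff (act : H →ₗ[k] M →ₗ[k] M) (μ : M →ₗ[k] H ⊗[k] M) :
    (∀ h m, TensorProduct.map mul (TensorProduct.lift act) (coactProd comul μ (h ⊗ₜ m)) =
      mul.rTensor M (coactBefore H μ (crossLeft act comul (h ⊗ₜ m)))) ↔
    ∀ X : LComod k H, tensorCoact μ X.coact ∘ₗ crossLeft act X.coact =
      (crossLeft act X.coact).lTensor H ∘ₗ tensorCoact X.coact μ := by
  constructor
  · intro hc X
    have := natural_ext (k := k) (H := H) (M := H ⊗[k] M) (N := M)
      (F := fun X => (TensorProduct.assoc k H M X.carrier).symm.toLinearMap ∘ₗ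
        tensorCoact μ X.coact ∘ₗ crossLeft act X.coact)
      (G := fun X => (TensorProduct.assoc k H M X.carrier).symm.toLinearMap ∘ₗ
        (crossLeft act X.coact).lTensor H ∘ₗ tensorCoact X.coact μ) ?_ ?_ ?_ X
    · refine LinearMap.ext fun v => (TensorProduct.assoc k H M X.carrier).symm.injective ?_
      exact LinearMap.congr_fun this v
    · intro X Y f
      have h1 := crossLeft_comp_map act f.colinear
      have h2 := tensorCoact_comp_map (ρ := μ) (ρ' := μ) (f := LinearMap.id) (by simp) f.colinear
      refine LinearMap.ext fun v => ?_
      have h1 := LinearMap.congr_fun h1 v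
      have h2 := LinearMap.congr_fun h2 (crossLeft act X.coact v)
      simp only [LinearMap.comp_apply] at h1 h2
      simp only [LinearMap.comp_apply, LinearEquiv.coe_coe, h1, h2]
      rw [LinearMap.lTensor, ← TensorProduct.map_map_assoc_symm, TensorProduct.map_id]
    · intro X Y f
      have h1 := crossLeft_comp_map act f.colinear
      have h2 := tensorCoact_comp_map (τ := μ) (τ' := μ) (g := LinearMap.id) f.colinear (by simp)
      refine LinearMap.ext fun v => ?_
      have h2 := LinearMap.congr_fun h2 v
      simp only [LinearMap.comp_apply] at h2
      simp only [LinearMap.comp_apply, LinearEquiv.coe_coe, h2, ← LinearMap.lTensor_comp_apply, h1]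
      rw [LinearMap.lTensor_comp_apply, LinearMap.lTensor, ← TensorProduct.map_map_assoc_symm,
        TensorProduct.map_id]
    · refine TensorProduct.ext' fun h m => ?_
      exact (counitRight_tensorCoact μ _).trans ((hc h m).symm.trans
        (counitRight_lTensor_crossLeft act μ (h ⊗ₜ m)).symm)
  · intro hX h m
    rw [← counitRight_tensorCoact, ← counitRight_lTensor_crossLeft]
    exact (congrArg (fun w => counitRight k H (H ⊗[k] M) ((TensorProduct.assoc k H M H).symm w))
      (LinearMap.congr_fun (hX (LComod.regular k H)) (h ⊗ₜ m))).symm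

/-- The compatibility axiom of right-left Yetter-Drinfeld modules says that the maps
`m ⊗ x ↦ x₀ ⊗ m · x₋₁` are colinear. -/
lemma right_compat_iff (act : H →ₗ[k] M →ₗ[k] M) (μ : M →ₗ[k] H ⊗[k] M) :
    (∀ h m, mul.rTensor M (coactAfter H μ (crossRight act comul (m ⊗ₜ h))) =
      TensorProduct.map mul (TensorProduct.lift act.flip) (coactProd μ comul (m ⊗ₜ h))) ↔
    ∀ X : LComod k H, tensorCoact X.coact μ ∘ₗ crossRight act X.coact =
      (crossRight act X.coact).lTensor H ∘ₗ tensorCoact μ X.coact := by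
  constructor
  · intro hc X
    have hlc : ∀ {X Y : LComod k H} (f : X ⟶ Y) (w), TensorProduct.leftComm k H Y.carrier M
        (TensorProduct.map LinearMap.id (TensorProduct.map f.lin LinearMap.id) w) =
        TensorProduct.map f.lin LinearMap.id (TensorProduct.leftComm k H X.carrier M w) := by
      intro X Y f w
      induction w with
      | zero => simp
      | add t t' h h' => simp only [map_add, h, h']
      | tmul h w =>
        induction w with
        | zero => simp
        | add t t' h h' => simp only [TensorProduct.tmul_add, map_add, h, h']
        | tmul m g => simp
    have := natural_ext_right (k := k) (H := H) (M := H ⊗[k] M) (N := M)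
      (F := fun X => (TensorProduct.leftComm k H X.carrier M).toLinearMap ∘ₗ
        tensorCoact X.coact μ ∘ₗ crossRight act X.coact)
      (G := fun X => (TensorProduct.leftComm k H X.carrier M).toLinearMap ∘ₗ
        (crossRight act X.coact).lTensor H ∘ₗ tensorCoact μ X.coact) ?_ ?_ ?_ X
    · refine LinearMap.ext fun v => (TensorProduct.leftComm k H X.carrier M).injective ?_
      exact LinearMap.congr_fun this v
    · intro X Y f
      have h1 := crossRight_comp_map act f.colinear
      have h2 := tensorCoact_comp_map (τ := μ) (τ' := μ) (g := LinearMap.id) f.colinear (by simp)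
      refine LinearMap.ext fun v => ?_
      have h1 := LinearMap.congr_fun h1 v
      have h2 := LinearMap.congr_fun h2 (crossRight act X.coact v)
      simp only [LinearMap.comp_apply] at h1 h2
      simp only [LinearMap.comp_apply, LinearEquiv.coe_coe, h1, h2]
      rw [LinearMap.lTensor, hlc]
    · intro X Y f
      have h1 := crossRight_comp_map act f.colinear
      have h2 := tensorCoact_comp_map (ρ := μ) (ρ' := μ) (f := LinearMap.id) (by simp) f.colinear
      refine LinearMap.ext fun v => ?_
      have h2 := LinearMap.congr_fun h2 v
      simp only [LinearMap.comp_apply] at h2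
      simp only [LinearMap.comp_apply, LinearEquiv.coe_coe, h2, ← LinearMap.lTensor_comp_apply, h1]
      rw [LinearMap.lTensor_comp_apply, LinearMap.lTensor, hlc]
    · refine TensorProduct.ext' fun m h => ?_
      exact (counitLeft_tensorCoact μ _).trans ((hc h m).trans
        (counitLeft_lTensor_crossRight act μ (m ⊗ₜ h)).symm)
  · intro hX h m
    rw [← counitLeft_tensorCoact, ← counitLeft_lTensor_crossRight]
    exact congrArg (fun w => counitLeft k H (H ⊗[k] M) (TensorProduct.leftComm k H H M w))
      (LinearMap.congr_fun (hX (LComod.regular k H)) (m ⊗ₜ h))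

/-- The associativity constraint with an outer factor `H`, contracted with the counit there, is an
evaluation of `σ`. -/
lemma counitRight_assocInvMap (ρ : X →ₗ[k] H ⊗[k] X) (τ : Y →ₗ[k] H ⊗[k] Y)
    (v : X ⊗[k] (Y ⊗[k] H)) :
    counitRight k H (X ⊗[k] Y) (assocInvMap ρ τ comul v) =
      contractBefore (σ ∘ₗ (TensorProduct.assoc k H H H).toLinearMap) (coactProd ρ τ)
        ((TensorProduct.assoc k X Y H).symm v) := by
  induction v with
  | zero => simp
  | add t t' h h' => simp only [map_add, h, h']
  | tmul x v =>
    induction v with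
    | zero => simp
    | add t t' h h' => simp only [TensorProduct.tmul_add, map_add, h, h']
    | tmul y h =>
      have hh := Coalgebra.lTensor_counit_comul (R := k) h
      have h2 : (TensorProduct.rid k H).toLinearMap (counit.lTensor H (comul (R := k) h)) = h := by
        rw [hh]; simp
      simp only [assocInvMap, contractBefore, coactBefore, twist, hit, coactProd,
        LinearMap.comp_apply, LinearEquiv.coe_coe, TensorProduct.map_tmul, LinearMap.rTensor_tmul,
        TensorProduct.assoc_symm_tmul]
      conv_rhs => rw [← h2]
      generalize ρ x = r
      generalize τ y = s
      generalize comul (R := k) h = t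
      induction r with
      | zero => simp
      | add t t' h h' => simp only [TensorProduct.add_tmul, map_add, h, h']
      | tmul a x =>
        induction s with
        | zero => simp
        | add t t' h h' =>
          simp only [TensorProduct.add_tmul, TensorProduct.tmul_add, map_add, h, h']
        | tmul b y =>
          induction t with
          | zero => simp
          | add t t' h h' => simp only [TensorProduct.tmul_add, map_add, h, h']
          | tmul c d =>
            simp [TensorProduct.tmul_smul, smul_smul, mul_comm]

lemma counitLeft_assocMap (ρ : X →ₗ[k] H ⊗[k] X) (τ : Y →ₗ[k] H ⊗[k] Y)
    (v : (H ⊗[k] X) ⊗[k] Y) :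
    counitLeft k H (X ⊗[k] Y) (assocMap comul ρ τ v) =
      contractAfter σinv (coactProd ρ τ) (TensorProduct.assoc k H X Y v) := by
  induction v with
  | zero => simp
  | add t t' h h' => simp only [map_add, h, h']
  | tmul v y =>
    induction v with
    | zero => simp
    | add t t' h h' => simp only [TensorProduct.add_tmul, map_add, h, h']
    | tmul h x =>
      have hh := Coalgebra.lTensor_counit_comul (R := k) h
      have h2 : (TensorProduct.rid k H).toLinearMap (counit.lTensor H (comul (R := k) h)) = h := by
        rw [hh]; simp
      simp only [assocMap, contractAfter, coactAfter, twist, hit, coactProd,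
        LinearMap.comp_apply, LinearEquiv.coe_coe, TensorProduct.map_tmul, LinearMap.lTensor_tmul,
        TensorProduct.assoc_tmul]
      conv_rhs => rw [← h2]
      generalize ρ x = r
      generalize τ y = s
      generalize comul (R := k) h = t
      induction r with
      | zero => simp
      | add t t' h h' =>
        simp only [TensorProduct.add_tmul, TensorProduct.tmul_add, map_add, h, h']
      | tmul a x =>
        induction s with
        | zero => simp
        | add t t' h h' => simp only [TensorProduct.tmul_add, map_add, h, h']
        | tmul b y =>
          induction t with
          | zero => simp
          | add t t' h h' => simp only [TensorProduct.add_tmul, map_add, h, h']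
          | tmul c d =>
            simp [← TensorProduct.smul_tmul', smul_smul, mul_comm]

lemma counitRight₂_assocInvMap (μ : M →ₗ[k] H ⊗[k] M) (v : M ⊗[k] (H ⊗[k] H)) :
    counitRight k H M (counitRight k H (M ⊗[k] H) (assocInvMap μ comul comul v)) =
      contractBefore σ μ v := by
  rw [counitRight_assocInvMap]
  induction v with
  | zero => simp
  | add t t' h h' => simp only [map_add, h, h']
  | tmul m v =>
    induction v with
    | zero => simp
    | add t t' h h' => simp only [TensorProduct.tmul_add, map_add, h, h']
    | tmul h g =>
      have hh := Coalgebra.lTensor_counit_comul (R := k) h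
      have h2 : (TensorProduct.rid k H).toLinearMap (counit.lTensor H (comul (R := k) h)) = h := by
        rw [hh]; simp
      simp only [contractBefore, coactBefore, coactProd,
        LinearMap.comp_apply, LinearEquiv.coe_coe, TensorProduct.map_tmul, LinearMap.rTensor_tmul,
        TensorProduct.assoc_symm_tmul]
      conv_rhs => rw [← h2]
      generalize μ m = r
      generalize comul (R := k) h = t
      induction r with
      | zero => simp
      | add t t' h h' => simp only [TensorProduct.add_tmul, map_add, h, h']
      | tmul a x =>
        induction t with
        | zero => simp
        | add t t' h h' =>
          simp only [TensorProduct.add_tmul, TensorProduct.tmul_add, map_add, h, h']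
        | tmul c d =>
          simp [← TensorProduct.smul_tmul', TensorProduct.tmul_smul, smul_smul, mul_comm]

lemma counitLeft₂_assocMap (μ : M →ₗ[k] H ⊗[k] M) (v : (H ⊗[k] H) ⊗[k] M) :
    counitLeft k H M (counitLeft k H (H ⊗[k] M) (assocMap comul comul μ v)) =
      contractAfter (σinv ∘ₗ (TensorProduct.assoc k H H H).toLinearMap) μ v := by
  rw [counitLeft_assocMap]
  induction v with
  | zero => simp
  | add t t' h h' => simp only [map_add, h, h']
  | tmul v m =>
    induction v with
    | zero => simp
    | add t t' h h' => simp only [TensorProduct.add_tmul, map_add, h, h']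
    | tmul g h =>
      have hh := Coalgebra.lTensor_counit_comul (R := k) h
      have h2 : (TensorProduct.rid k H).toLinearMap (counit.lTensor H (comul (R := k) h)) = h := by
        rw [hh]; simp
      simp only [contractAfter, coactAfter, coactProd,
        LinearMap.comp_apply, LinearEquiv.coe_coe, TensorProduct.map_tmul, LinearMap.lTensor_tmul,
        TensorProduct.assoc_tmul]
      conv_rhs => rw [← h2]
      generalize μ m = r
      generalize comul (R := k) h = t
      induction r with
      | zero => simp
      | add t t' h h' => simp only [TensorProduct.tmul_add, map_add, h, h']
      | tmul a x =>
        induction t with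
        | zero => simp
        | add t t' h h' =>
          simp only [TensorProduct.add_tmul, TensorProduct.tmul_add, map_add, h, h']
        | tmul c d =>
          simp [← TensorProduct.smul_tmul', TensorProduct.tmul_smul, smul_smul, mul_comm]

end HalfBraidings

/-! ### The hexagon and unit axioms -/

section HalfBraidings

open DualQuasiBialgebra

variable {k H : Type u} [Field k] [AddCommGroup H] [Module k H] [Coalgebra k H]
  [DualQuasiBialgebra k H]
  {M X Y X' Y' Z Z' : Type u} [AddCommGroup M] [Module k M] [AddCommGroup X] [Module k X]
  [AddCommGroup Y] [Module k Y] [AddCommGroup X'] [Module k X'] [AddCommGroup Y'] [Module k Y']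
  [AddCommGroup Z] [Module k Z] [AddCommGroup Z'] [Module k Z']

lemma assocInvMap_comp_map
    {ρ : X →ₗ[k] H ⊗[k] X} {τ : Y →ₗ[k] H ⊗[k] Y} {υ : Z →ₗ[k] H ⊗[k] Z}
    {ρ' : X' →ₗ[k] H ⊗[k] X'} {τ' : Y' →ₗ[k] H ⊗[k] Y'} {υ' : Z' →ₗ[k] H ⊗[k] Z'}
    {f : X →ₗ[k] X'} {g : Y →ₗ[k] Y'} {h : Z →ₗ[k] Z'}
    (hf : ρ' ∘ₗ f = f.lTensor H ∘ₗ ρ) (hg : τ' ∘ₗ g = g.lTensor H ∘ₗ τ)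
    (hh : υ' ∘ₗ h = h.lTensor H ∘ₗ υ) :
    assocInvMap ρ' τ' υ' ∘ₗ TensorProduct.map f (TensorProduct.map g h) =
      TensorProduct.map (TensorProduct.map f g) h ∘ₗ assocInvMap ρ τ υ := by
  refine LinearMap.ext fun v => ?_
  have := LinearMap.congr_fun (twist_comp_map σ hf hg hh) v
  simp only [LinearMap.comp_apply] at this
  simp only [assocInvMap, LinearMap.comp_apply, this, LinearEquiv.coe_coe,
    ← TensorProduct.map_map_assoc_symm]

/-- The first of the action axioms of left-left Yetter-Drinfeld modules is the hexagon identity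
for the maps `x ⊗ m ↦ x₋₁ · m ⊗ x₀`. -/
lemma left_hexagon_iff (act : H →ₗ[k] M →ₗ[k] M) (μ : M →ₗ[k] H ⊗[k] M) :
    (∀ (h g : H) (m : M), contractBefore σ μ (crossLeft act (tensorCoact comul comul)
      (assocInvMap comul comul μ (h ⊗ₜ (g ⊗ₜ m)))) =
    TensorProduct.lift act (contractBefore (σ ∘ₗ (TensorProduct.assoc k H H H).toLinearMap)
      (coactProd comul μ) ((TensorProduct.assoc k H M H).symm
        (h ⊗ₜ crossLeft act comul (g ⊗ₜ m))))) ↔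
    ∀ X Y : LComod k H, assocInvMap μ X.coact Y.coact ∘ₗ
        crossLeft act (tensorCoact X.coact Y.coact) ∘ₗ assocInvMap X.coact Y.coact μ =
      TensorProduct.map (crossLeft act X.coact) LinearMap.id ∘ₗ
        assocInvMap X.coact μ Y.coact ∘ₗ
        TensorProduct.map LinearMap.id (crossLeft act Y.coact) := by
  let F (X Y : LComod k H) : X.carrier ⊗[k] (Y.carrier ⊗[k] M) →ₗ[k]
      (M ⊗[k] X.carrier) ⊗[k] Y.carrier := assocInvMap μ X.coact Y.coact ∘ₗ
        crossLeft act (tensorCoact X.coact Y.coact) ∘ₗ assocInvMap X.coact Y.coact μ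
  let G (X Y : LComod k H) : X.carrier ⊗[k] (Y.carrier ⊗[k] M) →ₗ[k]
      (M ⊗[k] X.carrier) ⊗[k] Y.carrier :=
    TensorProduct.map (crossLeft act X.coact) LinearMap.id ∘ₗ
        assocInvMap X.coact μ Y.coact ∘ₗ
        TensorProduct.map LinearMap.id (crossLeft act Y.coact)
  let R := LComod.regular k H
  have hF : ∀ h g m, counitRight k H M (counitRight k H (M ⊗[k] H) (F R R (h ⊗ₜ (g ⊗ₜ m)))) =
      contractBefore σ μ (crossLeft act (tensorCoact comul comul)
        (assocInvMap comul comul μ (h ⊗ₜ (g ⊗ₜ m)))) :=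
    fun h g m => counitRight₂_assocInvMap μ _
  have hG : ∀ h g m, counitRight k H M (counitRight k H (M ⊗[k] H) (G R R (h ⊗ₜ (g ⊗ₜ m)))) =
      TensorProduct.lift act (contractBefore (σ ∘ₗ (TensorProduct.assoc k H H H).toLinearMap)
      (coactProd comul μ) ((TensorProduct.assoc k H M H).symm
        (h ⊗ₜ crossLeft act comul (g ⊗ₜ m)))) := fun h g m => by
    rw [← counitRight_assocInvMap]
    simp only [G, R, LinearMap.comp_apply (TensorProduct.map (crossLeft _ _) _),
      LinearMap.comp_apply (assocInvMap _ _ _), TensorProduct.map_tmul, LinearMap.id_apply]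
    generalize assocInvMap comul μ comul (h ⊗ₜ[k] (crossLeft act comul) (g ⊗ₜ[k] m)) = w
    induction w with
    | zero => simp
    | add t t' h h' => simp only [map_add, h, h']
    | tmul w g =>
      induction w with
      | zero => simp
      | add t t' h h' => simp only [TensorProduct.add_tmul, map_add, h, h']
      | tmul h m =>
        have := counitRight_crossLeft act h m
        rw [TensorProduct.map_tmul, LinearMap.id_apply, LinearMap.comp_apply _ _ (_ ⊗ₜ g),
          TensorProduct.map_tmul, LinearEquiv.coe_coe, TensorProduct.rid_tmul, map_smul,
          LinearMap.id_apply, this]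
        simp
  have natF : ∀ {X Y X' Y' : LComod k H} (f : X ⟶ X') (g : Y ⟶ Y'),
      F X' Y' ∘ₗ TensorProduct.map f.lin (TensorProduct.map g.lin LinearMap.id) =
      TensorProduct.map (TensorProduct.map LinearMap.id f.lin) g.lin ∘ₗ F X Y := by
    intro X Y X' Y' f g
    have h1 := assocInvMap_comp_map (υ := μ) (υ' := μ) (h := LinearMap.id)
      f.colinear g.colinear (by simp)
    have h2 := crossLeft_comp_map act (tensorCoact_comp_map f.colinear g.colinear)
    have h3 := assocInvMap_comp_map (ρ := μ) (ρ' := μ) (f := LinearMap.id) (by simp)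
      f.colinear g.colinear
    simp only [F, LinearMap.comp_assoc, h1]
    rw [← LinearMap.comp_assoc (assocInvMap X.coact _ _), h2, LinearMap.comp_assoc,
      ← LinearMap.comp_assoc _ _ (assocInvMap _ _ _), h3, LinearMap.comp_assoc]
  have natG : ∀ {X Y X' Y' : LComod k H} (f : X ⟶ X') (g : Y ⟶ Y'),
      G X' Y' ∘ₗ TensorProduct.map f.lin (TensorProduct.map g.lin LinearMap.id) =
      TensorProduct.map (TensorProduct.map LinearMap.id f.lin) g.lin ∘ₗ G X Y := by
    intro X Y X' Y' f g
    have h1 := crossLeft_comp_map act g.colinear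
    have h2 := assocInvMap_comp_map (τ := μ) (τ' := μ) (g := LinearMap.id)
      f.colinear (by simp) g.colinear
    have h3 := crossLeft_comp_map act f.colinear
    simp only [G, LinearMap.comp_assoc, ← TensorProduct.map_comp, h1, LinearMap.id_comp]
    rw [← LinearMap.comp_id f.lin, TensorProduct.map_comp, LinearMap.comp_id,
      ← LinearMap.comp_assoc _ _ (assocInvMap _ _ _), h2, LinearMap.comp_assoc,
      ← LinearMap.comp_assoc, ← TensorProduct.map_comp, h3, LinearMap.id_comp,
      ← LinearMap.comp_id g.lin, TensorProduct.map_comp, LinearMap.comp_id, LinearMap.comp_assoc]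
  change _ ↔ ∀ X Y, F X Y = G X Y
  constructor
  · intro h
    refine natural_ext₂ natF natG ?_
    refine TensorProduct.ext_threefold' fun a b m => ?_
    exact (hF a b m).trans ((h a b m).trans (hG a b m).symm)
  · intro h a b m
    rw [← hF, ← hG, h]

/-- The first of the action axioms of right-left Yetter-Drinfeld modules is the hexagon identity
for the maps `m ⊗ x ↦ x₀ ⊗ m · x₋₁`. -/
lemma right_hexagon_iff (act : H →ₗ[k] M →ₗ[k] M) (μ : M →ₗ[k] H ⊗[k] M) :
    (∀ (h g : H) (m : M),
      contractAfter (σinv ∘ₗ (TensorProduct.assoc k H H H).toLinearMap) μ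
      (crossRight act (tensorCoact comul comul) (assocMap μ comul comul ((m ⊗ₜ h) ⊗ₜ g))) =
    TensorProduct.lift act.flip (contractAfter σinv (coactProd μ comul)
      (TensorProduct.assoc k H M H (crossRight act comul (m ⊗ₜ h) ⊗ₜ g)))) ↔
    ∀ X Y : LComod k H, assocMap X.coact Y.coact μ ∘ₗ
        crossRight act (tensorCoact X.coact Y.coact) ∘ₗ assocMap μ X.coact Y.coact =
      TensorProduct.map LinearMap.id (crossRight act Y.coact) ∘ₗ
        assocMap X.coact μ Y.coact ∘ₗ
        TensorProduct.map (crossRight act X.coact) LinearMap.id := by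
  let F (X Y : LComod k H) : (M ⊗[k] X.carrier) ⊗[k] Y.carrier →ₗ[k]
      X.carrier ⊗[k] (Y.carrier ⊗[k] M) := assocMap X.coact Y.coact μ ∘ₗ
        crossRight act (tensorCoact X.coact Y.coact) ∘ₗ assocMap μ X.coact Y.coact
  let G (X Y : LComod k H) : (M ⊗[k] X.carrier) ⊗[k] Y.carrier →ₗ[k]
      X.carrier ⊗[k] (Y.carrier ⊗[k] M) :=
    TensorProduct.map LinearMap.id (crossRight act Y.coact) ∘ₗ
        assocMap X.coact μ Y.coact ∘ₗ
        TensorProduct.map (crossRight act X.coact) LinearMap.id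
  let R := LComod.regular k H
  have hF : ∀ h g m, counitLeft k H M (counitLeft k H (H ⊗[k] M) (F R R ((m ⊗ₜ h) ⊗ₜ g))) =
      contractAfter (σinv ∘ₗ (TensorProduct.assoc k H H H).toLinearMap) μ
      (crossRight act (tensorCoact comul comul) (assocMap μ comul comul ((m ⊗ₜ h) ⊗ₜ g))) :=
    fun h g m => counitLeft₂_assocMap μ _
  have hG : ∀ h g m, counitLeft k H M (counitLeft k H (H ⊗[k] M) (G R R ((m ⊗ₜ h) ⊗ₜ g))) =
      TensorProduct.lift act.flip (contractAfter σinv (coactProd μ comul)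
      (TensorProduct.assoc k H M H (crossRight act comul (m ⊗ₜ h) ⊗ₜ g))) := fun h g m => by
    rw [← counitLeft_assocMap]
    simp only [G, R, LinearMap.comp_apply (TensorProduct.map _ (crossRight _ _)),
      LinearMap.comp_apply (assocMap _ _ _), TensorProduct.map_tmul, LinearMap.id_apply]
    generalize assocMap comul μ comul (crossRight act comul (m ⊗ₜ[k] h) ⊗ₜ[k] g) = w
    induction w with
    | zero => simp
    | add t t' h h' => simp only [map_add, h, h']
    | tmul g w =>
      induction w with
      | zero => simp
      | add t t' h h' => simp only [TensorProduct.tmul_add, map_add, h, h']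
      | tmul m h =>
        have := counitLeft_crossRight act h m
        rw [TensorProduct.map_tmul, LinearMap.id_apply, LinearMap.comp_apply _ _ (g ⊗ₜ _),
          TensorProduct.map_tmul, LinearEquiv.coe_coe, TensorProduct.lid_tmul, map_smul,
          LinearMap.id_apply, this]
        simp
  have natF : ∀ {X Y X' Y' : LComod k H} (f : X ⟶ X') (g : Y ⟶ Y'),
      F X' Y' ∘ₗ TensorProduct.map (TensorProduct.map LinearMap.id f.lin) g.lin =
      TensorProduct.map f.lin (TensorProduct.map g.lin LinearMap.id) ∘ₗ F X Y := by
    intro X Y X' Y' f g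
    have h1 := assocMap_comp_map (υ := μ) (υ' := μ) (h := LinearMap.id)
      f.colinear g.colinear (by simp)
    have h2 := crossRight_comp_map act (tensorCoact_comp_map f.colinear g.colinear)
    have h3 := assocMap_comp_map (ρ := μ) (ρ' := μ) (f := LinearMap.id) (by simp)
      f.colinear g.colinear
    simp only [F, LinearMap.comp_assoc, h3]
    rw [← LinearMap.comp_assoc (assocMap μ _ _), h2, LinearMap.comp_assoc,
      ← LinearMap.comp_assoc _ _ (assocMap _ _ _), h1, LinearMap.comp_assoc]
  have natG : ∀ {X Y X' Y' : LComod k H} (f : X ⟶ X') (g : Y ⟶ Y'),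
      G X' Y' ∘ₗ TensorProduct.map (TensorProduct.map LinearMap.id f.lin) g.lin =
      TensorProduct.map f.lin (TensorProduct.map g.lin LinearMap.id) ∘ₗ G X Y := by
    intro X Y X' Y' f g
    have h1 := crossRight_comp_map act g.colinear
    have h2 := assocMap_comp_map (τ := μ) (τ' := μ) (g := LinearMap.id)
      f.colinear (by simp) g.colinear
    have h3 := crossRight_comp_map act f.colinear
    simp only [G, LinearMap.comp_assoc, ← TensorProduct.map_comp, h3, LinearMap.id_comp]
    rw [← LinearMap.comp_id g.lin, TensorProduct.map_comp, LinearMap.comp_id,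
      ← LinearMap.comp_assoc _ _ (assocMap _ _ _), h2, LinearMap.comp_assoc,
      ← LinearMap.comp_assoc, ← TensorProduct.map_comp, h1, LinearMap.id_comp,
      ← LinearMap.comp_id f.lin, TensorProduct.map_comp, LinearMap.comp_id, LinearMap.comp_assoc]
  change _ ↔ ∀ X Y, F X Y = G X Y
  constructor
  · intro h
    refine natural_ext₂_right natF natG ?_
    refine TensorProduct.ext_threefold fun m a b => ?_
    exact (hF a b m).trans ((h a b m).trans (hG a b m).symm)
  · intro h a b m
    rw [← hF, ← hG, h]

/-- The unit axiom of Yetter-Drinfeld modules is the unit axiom for the maps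
`x ⊗ m ↦ x₋₁ · m ⊗ x₀`. -/
lemma left_unit_iff (act : H →ₗ[k] M →ₗ[k] M) :
    (∀ m, act (one k) m = m) ↔ crossLeft act (unitCoact k H) =
      (TensorProduct.rid k M).symm.toLinearMap ∘ₗ (TensorProduct.lid k M).toLinearMap := by
  constructor
  · intro h
    refine TensorProduct.ext' fun c m => ?_
    simp [crossLeft_tmul, h]
  · intro h m
    have := congrArg (TensorProduct.rid k M) (LinearMap.congr_fun h (1 ⊗ₜ m))
    simpa [crossLeft_tmul] using this

lemma right_unit_iff (act : H →ₗ[k] M →ₗ[k] M) :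
    (∀ m, act (one k) m = m) ↔ crossRight act (unitCoact k H) =
      (TensorProduct.lid k M).symm.toLinearMap ∘ₗ (TensorProduct.rid k M).toLinearMap := by
  constructor
  · intro h
    refine TensorProduct.ext' fun m c => ?_
    simp [crossRight_tmul, h]
  · intro h m
    have := congrArg (TensorProduct.lid k M) (LinearMap.congr_fun h (m ⊗ₜ 1))
    simpa [crossRight_tmul] using this

end HalfBraidings

/-! ### Lax half-braidings and duals -/

section LaxHalfBraidings

open MonoidalCategory

variable {C : Type*} [Category C] [MonoidalCategory C]

/-- A natural family of maps `M ⊗ U ⟶ U ⊗ M`, not assumed to be invertible, that satisfies the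
hexagon and unit axioms. -/
structure RightLaxHalfBraiding (M : C) where
  β : ∀ U : C, M ⊗ U ⟶ U ⊗ M
  naturality : ∀ {U V : C} (f : U ⟶ V), M ◁ f ≫ β V = β U ≫ f ▷ M
  monoidal : ∀ U V : C, β (U ⊗ V) =
    (α_ M U V).inv ≫ β U ▷ V ≫ (α_ U M V).hom ≫ U ◁ β V ≫ (α_ U V M).inv
  unit : β (𝟙_ C) = (ρ_ M).hom ≫ (λ_ M).inv

namespace RightLaxHalfBraiding

variable {M : C} (b : RightLaxHalfBraiding M) (Y X : C) [ExactPairing Y X]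

/-- The inverse of `M ⊗ X ⟶ X ⊗ M`, built from a dual `Y` of `X`: create `Y ⊗ X`, move `M` past `Y`,
and evaluate `X ⊗ Y`. -/
def inv : X ⊗ M ⟶ M ⊗ X :=
  (ρ_ (X ⊗ M)).inv ≫ (X ⊗ M) ◁ η_ Y X ≫ (α_ (X ⊗ M) Y X).inv ≫ (α_ X M Y).hom ▷ X ≫
    (X ◁ b.β Y) ▷ X ≫ (α_ X Y M).inv ▷ X ≫ (ε_ Y X ▷ M) ▷ X ≫ (λ_ M).hom ▷ X

/-- By the hexagon axiom and naturality, `M` moves past `X ⊗ Y` and the evaluation at once, so that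
a triangle identity for `X` is left. -/
lemma hom_inv : b.β X ≫ b.inv Y X = 𝟙 _ := by
  have h1 : M ◁ ε_ Y X ≫ (ρ_ M).hom ≫ (λ_ M).inv = b.β (X ⊗ Y) ≫ ε_ Y X ▷ M := by
    rw [← b.unit, b.naturality]
  rw [b.monoidal] at h1
  calc b.β X ≫ b.inv Y X = 𝟙 _ ⊗≫ (b.β X ▷ (𝟙_ C) ≫ (X ⊗ M) ◁ η_ Y X) ⊗≫
        (X ◁ b.β Y) ▷ X ⊗≫ (ε_ Y X ▷ M) ▷ X ⊗≫ 𝟙 _ := by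
        rw [inv]; monoidal
    _ = 𝟙 _ ⊗≫ (M ⊗ X) ◁ η_ Y X ⊗≫ (((α_ M X Y).inv ≫ b.β X ▷ Y ≫ (α_ X M Y).hom ≫
          X ◁ b.β Y ≫ (α_ X Y M).inv) ≫ ε_ Y X ▷ M) ▷ X ⊗≫ 𝟙 _ := by
        rw [← whisker_exchange]; monoidal
    _ = 𝟙 _ ⊗≫ M ◁ (X ◁ η_ Y X ⊗≫ ε_ Y X ▷ X) ⊗≫ 𝟙 _ := by
        rw [← h1]; monoidal
    _ = 𝟙 _ := by
        rw [ExactPairing.coevaluation_evaluation'']; monoidal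

/-- By the hexagon axiom and naturality, `M` moves past `Y ⊗ X` and the coevaluation at once, so
that a triangle identity for `X` is left. -/
lemma inv_hom : b.inv Y X ≫ b.β X = 𝟙 _ := by
  have h1 : M ◁ η_ Y X ≫ b.β (Y ⊗ X) = ((ρ_ M).hom ≫ (λ_ M).inv) ≫ η_ Y X ▷ M := by
    rw [← b.unit, b.naturality]
  rw [b.monoidal] at h1
  calc b.inv Y X ≫ b.β X = 𝟙 _ ⊗≫ X ◁ M ◁ η_ Y X ⊗≫ X ◁ b.β Y ▷ X ⊗≫
        (ε_ Y X ▷ (M ⊗ X) ≫ (𝟙_ C) ◁ b.β X) ⊗≫ 𝟙 _ := by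
        rw [inv]; monoidal
    _ = 𝟙 _ ⊗≫ X ◁ (M ◁ η_ Y X ≫ ((α_ M Y X).inv ≫ b.β Y ▷ X ≫ (α_ Y M X).hom ≫
          Y ◁ b.β X ≫ (α_ Y X M).inv)) ⊗≫ (ε_ Y X ▷ (X ⊗ M)) ⊗≫ 𝟙 _ := by
        rw [← whisker_exchange]; monoidal
    _ = 𝟙 _ ⊗≫ (X ◁ η_ Y X ⊗≫ ε_ Y X ▷ X) ▷ M ⊗≫ 𝟙 _ := by
        rw [h1]; monoidal
    _ = 𝟙 _ := by
        rw [ExactPairing.coevaluation_evaluation'']; monoidal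

end RightLaxHalfBraiding

/-- The mirror image of `RightLaxHalfBraiding`. -/
structure LeftLaxHalfBraiding (M : C) where
  β : ∀ U : C, U ⊗ M ⟶ M ⊗ U
  naturality : ∀ {U V : C} (f : U ⟶ V), f ▷ M ≫ β V = β U ≫ M ◁ f
  monoidal : ∀ U V : C, β (U ⊗ V) =
    (α_ U V M).hom ≫ U ◁ β V ≫ (α_ U M V).inv ≫ β U ▷ V ≫ (α_ M U V).hom
  unit : β (𝟙_ C) = (λ_ M).hom ≫ (ρ_ M).inv

namespace LeftLaxHalfBraiding

variable {M : C} (b : LeftLaxHalfBraiding M) (X Y : C) [ExactPairing X Y]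

/-- The inverse of `X ⊗ M ⟶ M ⊗ X`, built from a dual `Y` of `X`. -/
def inv : M ⊗ X ⟶ X ⊗ M :=
  (λ_ (M ⊗ X)).inv ≫ η_ X Y ▷ (M ⊗ X) ≫ (α_ X Y (M ⊗ X)).hom ≫ X ◁ (α_ Y M X).inv ≫
    X ◁ (b.β Y ▷ X) ≫ X ◁ (α_ M Y X).hom ≫ X ◁ (M ◁ ε_ X Y) ≫ X ◁ (ρ_ M).hom

lemma hom_inv : b.β X ≫ b.inv X Y = 𝟙 _ := by
  have h1 : ε_ X Y ▷ M ≫ (λ_ M).hom ≫ (ρ_ M).inv = b.β (Y ⊗ X) ≫ M ◁ ε_ X Y := by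
    rw [← b.unit, b.naturality]
  rw [b.monoidal] at h1
  calc b.β X ≫ b.inv X Y = 𝟙 _ ⊗≫ ((𝟙_ C) ◁ b.β X ≫ η_ X Y ▷ (M ⊗ X)) ⊗≫
        X ◁ (b.β Y ▷ X) ⊗≫ X ◁ (M ◁ ε_ X Y) ⊗≫ 𝟙 _ := by
        rw [inv]; monoidal
    _ = 𝟙 _ ⊗≫ η_ X Y ▷ (X ⊗ M) ⊗≫ X ◁ (((α_ Y X M).hom ≫ Y ◁ b.β X ≫ (α_ Y M X).inv ≫
          b.β Y ▷ X ≫ (α_ M Y X).hom) ≫ M ◁ ε_ X Y) ⊗≫ 𝟙 _ := by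
        rw [whisker_exchange]; monoidal
    _ = 𝟙 _ ⊗≫ (η_ X Y ▷ X ⊗≫ X ◁ ε_ X Y) ▷ M ⊗≫ 𝟙 _ := by
        rw [← h1]; monoidal
    _ = 𝟙 _ := by
        rw [ExactPairing.evaluation_coevaluation'']; monoidal

lemma inv_hom : b.inv X Y ≫ b.β X = 𝟙 _ := by
  have h1 : η_ X Y ▷ M ≫ b.β (X ⊗ Y) = ((λ_ M).hom ≫ (ρ_ M).inv) ≫ M ◁ η_ X Y := by
    rw [← b.unit, b.naturality]
  rw [b.monoidal] at h1
  calc b.inv X Y ≫ b.β X = 𝟙 _ ⊗≫ η_ X Y ▷ M ▷ X ⊗≫ X ◁ b.β Y ▷ X ⊗≫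
        ((X ⊗ M) ◁ ε_ X Y ≫ b.β X ▷ (𝟙_ C)) ⊗≫ 𝟙 _ := by
        rw [inv]; monoidal
    _ = 𝟙 _ ⊗≫ (η_ X Y ▷ M ≫ ((α_ X Y M).hom ≫ X ◁ b.β Y ≫ (α_ X M Y).inv ≫
          b.β X ▷ Y ≫ (α_ M X Y).hom)) ▷ X ⊗≫ ((M ⊗ X) ◁ ε_ X Y) ⊗≫ 𝟙 _ := by
        rw [whisker_exchange]; monoidal
    _ = 𝟙 _ ⊗≫ M ◁ (η_ X Y ▷ X ⊗≫ X ◁ ε_ X Y) ⊗≫ 𝟙 _ := by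
        rw [h1]; monoidal
    _ = 𝟙 _ := by
        rw [ExactPairing.evaluation_coevaluation'']; monoidal

end LeftLaxHalfBraiding

end LaxHalfBraidings

/-! ### Local finiteness of comodules -/

section LocalFiniteness

variable {k H : Type u} [Field k] [AddCommGroup H] [Module k H] [Coalgebra k H]

/-- Elements `h i j` of a coalgebra with `Δ (h i j) = ∑ l, h i l ⊗ h l j` and `ε (h i j) = δ i j`:
the matrix coefficients of a finite-dimensional comodule with a basis. -/
structure MatrixCoefficients (k H : Type u) [Field k] [AddCommGroup H] [Module k H]
    [Coalgebra k H] (n : ℕ) where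
  entry : Fin n → Fin n → H
  comul_entry : ∀ i j, comul (R := k) (entry i j) = ∑ l, entry i l ⊗ₜ[k] entry l j
  counit_entry : ∀ i j, counit (R := k) (entry i j) = if i = j then 1 else 0

namespace MatrixCoefficients

variable {n : ℕ} (A : MatrixCoefficients k H n)

/-- The coaction `e i ↦ ∑ j, h i j ⊗ e j` on `k ^ n`. -/
noncomputable def coact : (Fin n → k) →ₗ[k] H ⊗[k] (Fin n → k) :=
  (Pi.basisFun k (Fin n)).constr k fun i => ∑ j, A.entry i j ⊗ₜ Pi.single j 1

@[simp]
lemma coact_single (i : Fin n) : A.coact (Pi.single i 1) =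
    ∑ j, A.entry i j ⊗ₜ Pi.single j 1 := by
  rw [← Pi.basisFun_apply, coact, Module.Basis.constr_basis]

lemma isCoaction : IsCoaction A.coact where
  coassoc := (Pi.basisFun k (Fin n)).ext fun i => by
    simp only [Pi.basisFun_apply, LinearMap.comp_apply, coact_single, map_sum,
      LinearMap.lTensor_tmul, LinearMap.rTensor_tmul, comul_entry, TensorProduct.tmul_sum,
      TensorProduct.sum_tmul, LinearEquiv.coe_coe, TensorProduct.assoc_tmul]
    exact Finset.sum_comm
  counit := (Pi.basisFun k (Fin n)).ext fun i => by
    simp [LinearMap.comp_apply, counit_entry]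

/-- The comodule `k ^ n` with the given matrix coefficients. -/
noncomputable abbrev toComod : LComod k H := ⟨Fin n → k, A.coact, A.isCoaction⟩

lemma contractMid_entry (χ : H →ₗ[k] k) (i j : Fin n) : contractMid χ (A.entry i j) =
    ∑ p, ∑ q, χ (A.entry p q) • A.entry i p ⊗ₜ[k] A.entry q j := by
  simp [contractMid, comul_entry, TensorProduct.tmul_sum]

end MatrixCoefficients

namespace LComod

/-- The subspace `W` is a subcomodule. -/
def IsSubcomodule (X : LComod k H) (W : Submodule k X.carrier) : Prop :=
  ∀ w ∈ W, X.coact w ∈ LinearMap.range (W.subtype.lTensor H)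

lemma IsSubcomodule.sup {X : LComod k H} {W W' : Submodule k X.carrier}
    (h : X.IsSubcomodule W) (h' : X.IsSubcomodule W') : X.IsSubcomodule (W ⊔ W') := by
  have mono : ∀ {V V' : Submodule k X.carrier}, V ≤ V' →
      LinearMap.range (V.subtype.lTensor H) ≤ LinearMap.range (V'.subtype.lTensor H) := by
    rintro V V' hV _ ⟨t, rfl⟩
    refine ⟨(Submodule.inclusion hV).lTensor H t, ?_⟩
    rw [← LinearMap.comp_apply, ← LinearMap.lTensor_comp, Submodule.subtype_comp_inclusion]
  intro w hw
  obtain ⟨a, ha, b, hb, rfl⟩ := Submodule.mem_sup.mp hw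
  rw [map_add]
  exact Submodule.add_mem _ (mono le_sup_left (h a ha)) (mono le_sup_right (h' b hb))

/-- The fundamental theorem of comodules: each element of a comodule lies in a finite-dimensional
subcomodule. -/
lemma exists_isSubcomodule (X : LComod k H) (x : X.carrier) :
    ∃ W : Submodule k X.carrier, FiniteDimensional k W ∧ X.IsSubcomodule W ∧ x ∈ W := by
  classical
  let b := Module.Basis.ofVectorSpace k H
  -- The coordinates of the coaction of `x` in a basis of `H`: they span the subcomodule.
  let c := TensorProduct.equivFinsuppOfBasisLeft (N := X.carrier) b (X.coact x)
  have hc : X.coact x = c.sum fun i y => b i ⊗ₜ y := by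
    rw [← TensorProduct.equivFinsuppOfBasisLeft_symm_apply, LinearEquiv.symm_apply_apply]
  let W : Submodule k X.carrier := Submodule.span k (c.support.image c : Finset X.carrier)
  have : FiniteDimensional k W := FiniteDimensional.span_finset k _
  obtain ⟨P, hP⟩ := W.subtype.exists_leftInverse_of_injective W.ker_subtype
  have hPW : ∀ w ∈ W, (W.subtype ∘ₗ P) w = w := fun w hw =>
    congrArg Subtype.val (LinearMap.congr_fun hP ⟨w, hw⟩)
  have hcW : ∀ i, c i ∈ W := fun i => by
    by_cases hi : i ∈ c.support
    · exact Submodule.subset_span (Finset.mem_coe.mpr (Finset.mem_image_of_mem c hi))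
    · rw [Finsupp.notMem_support_iff.mp hi]; exact W.zero_mem
  have hPx : (W.subtype ∘ₗ P).lTensor H (X.coact x) = X.coact x := by
    rw [hc, Finsupp.sum, map_sum]
    exact Finset.sum_congr rfl fun i _ => by rw [LinearMap.lTensor_tmul, hPW _ (hcW i)]
  have hit_c : ∀ i, hit (b.coord i) X.coact x = c i := fun i => by
    rw [hit, LinearMap.comp_apply, LinearMap.comp_apply, hc, Finsupp.sum, map_sum, map_sum]
    simp only [LinearMap.rTensor_tmul, LinearEquiv.coe_coe, TensorProduct.lid_tmul,
      Module.Basis.coord_apply, Module.Basis.repr_self, Finsupp.single_apply, ite_smul, one_smul,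
      zero_smul]
    simp only [Finset.sum_ite_eq', Finsupp.mem_support_iff, ne_eq, ite_not, ite_eq_right_iff]
    exact fun h => h.symm
  have hW : ∀ w ∈ W, (W.subtype ∘ₗ P).lTensor H (X.coact w) = X.coact w := by
    intro w hw
    induction hw using Submodule.span_induction with
    | zero => simp
    | add _ _ _ _ h h' => simp only [map_add, h, h']
    | smul a _ _ h => simp only [map_smul, h]
    | mem w hw =>
      obtain ⟨i, -, rfl⟩ := Finset.mem_image.mp (Finset.mem_coe.mp hw)
      rw [← hit_c]
      have := LinearMap.congr_fun
        (rTensor_comp_hit X.isCoaction (b.coord i) LinearMap.id) x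
      simp only [LinearMap.rTensor_id, LinearMap.comp_apply, LinearMap.id_apply] at this
      rw [this, ← LinearMap.comp_apply, LinearMap.lTensor_comp_rTensor,
        ← LinearMap.rTensor_comp_lTensor, LinearMap.comp_apply, hPx]
  have hxW : x ∈ W := by
    rw [← X.isCoaction.counit_apply x, ← hPx]
    generalize X.coact x = t
    induction t with
    | zero => simp
    | add t t' h h' => simp only [map_add]; exact W.add_mem h h'
    | tmul a y => simpa using W.smul_mem _ (P y).2
  refine ⟨W, this, fun w hw => ⟨P.lTensor H (X.coact w), ?_⟩, hxW⟩
  rw [← LinearMap.comp_apply, ← LinearMap.lTensor_comp, hW w hw]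

/-- A finite-dimensional subcomodule is spanned by the entries of a basis, which has matrix
coefficients. -/
lemma IsSubcomodule.exists_matrixCoefficients {X : LComod k H} {W : Submodule k X.carrier}
    [FiniteDimensional k W] (hXW : X.IsSubcomodule W) :
    ∃ (n : ℕ) (A : MatrixCoefficients k H n) (f : A.toComod ⟶ X) (e : (Fin n → k) ≃ₗ[k] W),
      f.lin = W.subtype ∘ₗ e.toLinearMap := by
  obtain ⟨P, hP⟩ := W.subtype.exists_leftInverse_of_injective W.ker_subtype
  have hW : ∀ w ∈ W, (W.subtype ∘ₗ P).lTensor H (X.coact w) = X.coact w := by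
    intro w hw
    obtain ⟨t, ht⟩ := hXW w hw
    rw [← ht, ← LinearMap.comp_apply, ← LinearMap.lTensor_comp, LinearMap.comp_assoc, hP,
      LinearMap.comp_id]
  let w := Module.finBasis k W
  let φ (j) : X.carrier →ₗ[k] k := w.coord j ∘ₗ P
  let h (i j) : H := TensorProduct.rid k H ((φ j).lTensor H (X.coact (w i)))
  have hsum : ∀ t : H ⊗[k] X.carrier, (W.subtype ∘ₗ P).lTensor H t =
      ∑ j, TensorProduct.rid k H ((φ j).lTensor H t) ⊗ₜ (w j : X.carrier) := fun t => by
    induction t with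
    | zero => simp
    | add t t' h h' => simp only [map_add, h, h', TensorProduct.add_tmul, Finset.sum_add_distrib]
    | tmul a y =>
      simp only [φ, LinearMap.lTensor_tmul, LinearMap.comp_apply, TensorProduct.rid_tmul,
        Module.Basis.coord_apply]
      conv_lhs => rw [← w.sum_repr (P y)]
      simp only [map_sum, map_smul, TensorProduct.tmul_sum, TensorProduct.tmul_smul,
        TensorProduct.smul_tmul', Submodule.subtype_apply]
  have hρ : ∀ i, X.coact (w i) = ∑ j, h i j ⊗ₜ (w j : X.carrier) := fun i => by
    rw [← hW _ (w i).2, hsum]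
  have hφ : ∀ i j, φ j (w i) = if i = j then 1 else 0 := fun i j => by
    have : P (w i) = w i := LinearMap.congr_fun hP (w i)
    simp [φ, this, Finsupp.single_apply]
  let A : MatrixCoefficients k H _ :=
    { entry := h
      comul_entry := fun i j => by
        have h1 : ∀ t : H ⊗[k] X.carrier, comul (TensorProduct.rid k H ((φ j).lTensor H t)) =
            (TensorProduct.rid k H).toLinearMap.lTensor H (((φ j).lTensor H).lTensor H
              (TensorProduct.assoc k H H X.carrier (comul.rTensor X.carrier t))) := fun t => by
          induction t with
          | zero => simp
          | add t t' h h' => simp only [map_add, h, h']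
          | tmul a y =>
            simp only [LinearMap.lTensor_tmul, LinearMap.rTensor_tmul, TensorProduct.rid_tmul,
              map_smul]
            generalize comul (R := k) a = t
            induction t with
            | zero => simp
            | add t t' h h' => simp only [smul_add, map_add, TensorProduct.add_tmul, h, h']
            | tmul a y => simp
        rw [h1, ← X.isCoaction.coassoc_apply, hρ]
        simp [h]
      counit_entry := fun i j => by
        have h1 : ∀ t : H ⊗[k] X.carrier, counit (TensorProduct.rid k H ((φ j).lTensor H t)) =
            φ j (TensorProduct.lid k X.carrier (counit.rTensor X.carrier t)) := fun t => by
          induction t with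
          | zero => simp
          | add t t' h h' => simp only [map_add, h, h']
          | tmul a y => simp [mul_comm]
        rw [h1, X.isCoaction.counit_apply, hφ] }
  have he : ∀ i, w.equivFun.symm (Pi.single i 1) = w i := fun i => by
    rw [LinearEquiv.symm_apply_eq]
    ext j
    rw [Module.Basis.equivFun_self, Pi.single_apply]
    simp only [eq_comm]
  refine ⟨_, A, ⟨W.subtype ∘ₗ w.equivFun.symm.toLinearMap, ?_⟩, w.equivFun.symm, rfl⟩
  refine (Pi.basisFun k _).ext fun i => ?_
  rw [Pi.basisFun_apply]
  simp only [LinearMap.comp_apply, LinearEquiv.coe_coe, he, Submodule.subtype_apply]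
  rw [hρ, A.coact_single, map_sum]
  refine Finset.sum_congr rfl fun j _ => ?_
  simp only [LinearMap.lTensor_tmul, LinearMap.comp_apply, LinearEquiv.coe_coe, he,
    Submodule.subtype_apply, A]

/-- A tensor whose first factor is in a comodule comes from a finite-dimensional subcomodule. -/
lemma exists_matrixCoefficients (X : LComod k H) {V : Type u} [AddCommGroup V] [Module k V]
    (t : X.carrier ⊗[k] V) : ∃ (n : ℕ) (A : MatrixCoefficients k H n) (f : A.toComod ⟶ X)
      (v : (Fin n → k) ⊗[k] V), Function.Injective f.lin ∧ f.lin.rTensor V v = t := by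
  have key : ∃ W : Submodule k X.carrier, FiniteDimensional k W ∧ X.IsSubcomodule W ∧
      t ∈ LinearMap.range (W.subtype.rTensor V) := by
    induction t with
    | zero => exact ⟨⊥, inferInstance, fun w hw => by simp [(Submodule.mem_bot k).mp hw],
        Submodule.zero_mem _⟩
    | tmul x v =>
      obtain ⟨W, hf, hW, hx⟩ := X.exists_isSubcomodule x
      exact ⟨W, hf, hW, ⟨⟨x, hx⟩ ⊗ₜ v, by simp⟩⟩
    | add t t' h h' =>
      obtain ⟨W, hf, hW, s, rfl⟩ := h
      obtain ⟨W', hf', hW', s', rfl⟩ := h'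
      refine ⟨W ⊔ W', inferInstance, hW.sup hW',
        (Submodule.inclusion le_sup_left).rTensor V s +
          (Submodule.inclusion le_sup_right).rTensor V s', ?_⟩
      simp only [map_add, ← LinearMap.comp_apply, ← LinearMap.rTensor_comp,
        Submodule.subtype_comp_inclusion]
  obtain ⟨W, hf, hW, s, rfl⟩ := key
  obtain ⟨n, A, f, e, hfe⟩ := hW.exists_matrixCoefficients
  refine ⟨n, A, f, e.symm.toLinearMap.rTensor V s, ?_, ?_⟩
  · rw [hfe]
    exact W.subtype_injective.comp e.injective
  · rw [hfe, ← LinearMap.comp_apply, ← LinearMap.rTensor_comp, LinearMap.comp_assoc]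
    simp

end LComod

end LocalFiniteness

/-! ### Duals of matrix comodules -/

namespace MatrixCoefficients

open DualQuasiBialgebra

section

variable {k H : Type u} [Field k] [AddCommGroup H] [Module k H] [Coalgebra k H]

lemma hit_single {n : ℕ} (A : MatrixCoefficients k H n) (i : Fin n) {M C : Type u}
    [AddCommGroup M] [Module k M] [AddCommGroup C] [Module k C] (μ : M →ₗ[k] C ⊗[k] M)
    (φ : H ⊗[k] C →ₗ[k] k) (m : M) :
    hit φ (coactProd A.coact μ) (Pi.single i 1 ⊗ₜ m) =
      ∑ p, Pi.single p 1 ⊗ₜ hit (φ ∘ₗ TensorProduct.mk k H C (A.entry i p)) μ m := by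
  simp only [hit, LinearMap.comp_apply, coactProd_tmul, coact_single, TensorProduct.sum_tmul,
    map_sum]
  refine Finset.sum_congr rfl fun p _ => ?_
  generalize μ m = t
  induction t with
  | zero => simp
  | add t t' h h' => simp only [TensorProduct.tmul_add, map_add, h, h']
  | tmul a y => simp [TensorProduct.smul_tmul']

lemma hit_coact_single {n : ℕ} (A : MatrixCoefficients k H n) (φ : H →ₗ[k] k) (i : Fin n) :
    hit φ A.coact (Pi.single i 1) = ∑ p, φ (A.entry i p) • Pi.single p 1 := by
  simp [hit]

lemma twist_single {a b c : ℕ} (A : MatrixCoefficients k H a) (B : MatrixCoefficients k H b)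
    (C : MatrixCoefficients k H c) (φ : H ⊗[k] (H ⊗[k] H) →ₗ[k] k) (i : Fin a) (j : Fin b)
    (l : Fin c) :
    twist φ A.coact B.coact C.coact (Pi.single i 1 ⊗ₜ (Pi.single j 1 ⊗ₜ Pi.single l 1)) =
      ∑ p, ∑ q, ∑ r, φ (A.entry i p ⊗ₜ (B.entry j q ⊗ₜ C.entry l r)) •
        (Pi.single p 1 ⊗ₜ (Pi.single q 1 ⊗ₜ Pi.single r 1)) := by
  simp only [twist, hit_single, hit_coact_single, TensorProduct.tmul_sum, LinearMap.comp_apply,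
    TensorProduct.mk_apply, TensorProduct.tmul_smul]

end

section

variable {k H : Type u} [Field k] [AddCommGroup H] [Module k H] [Coalgebra k H]
  [DualQuasiHopfAlgebra k H] {n : ℕ} (A : MatrixCoefficients k H n)

open DualQuasiHopfAlgebra MonoidalCategory

/-- The matrix coefficients `s (h j i)` of the dual comodule. -/
noncomputable def dual : MatrixCoefficients k H n where
  entry i j := s (k := k) (A.entry j i)
  comul_entry i j := by
    have := LinearMap.congr_fun (comul_s (k := k) (H := H)) (A.entry j i)
    simp only [LinearMap.comp_apply] at this
    simp [this, A.comul_entry]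
  counit_entry i j := by
    have := LinearMap.congr_fun (counit_s (k := k) (H := H)) (A.entry j i)
    simp only [LinearMap.comp_apply] at this
    simp [this, A.counit_entry, eq_comm]

@[simp]
lemma dual_entry (i j : Fin n) : A.dual.entry i j = s (k := k) (A.entry j i) := rfl

/-- The coevaluation `1 ↦ ∑ α(h r s) e^r ⊗ e_s`. -/
noncomputable def coev : k →ₗ[k] (Fin n → k) ⊗[k] (Fin n → k) :=
  LinearMap.toSpanSingleton k _
    (∑ r, ∑ t, α (k := k) (A.entry r t) • Pi.single r 1 ⊗ₜ Pi.single t 1)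

/-- The evaluation `e_i ⊗ e^j ↦ β(h i j)`. -/
noncomputable def ev : (Fin n → k) ⊗[k] (Fin n → k) →ₗ[k] k :=
  TensorProduct.lift ((Pi.basisFun k (Fin n)).constr k fun i =>
    (Pi.basisFun k (Fin n)).constr k fun j => β (k := k) (A.entry i j))

lemma ev_single (i j : Fin n) : A.ev (Pi.single i 1 ⊗ₜ Pi.single j 1) = β (A.entry i j) := by
  rw [ev, TensorProduct.lift.tmul]
  nth_rewrite 1 [← Pi.basisFun_apply]
  rw [Module.Basis.constr_basis, ← Pi.basisFun_apply, Module.Basis.constr_basis]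

lemma coev_one : A.coev 1 =
    ∑ r, ∑ t, α (k := k) (A.entry r t) • Pi.single r 1 ⊗ₜ[k] Pi.single t 1 := by
  rw [coev, LinearMap.toSpanSingleton_apply, one_smul]

lemma tensorCoact_single {b : ℕ} (B : MatrixCoefficients k H b) (i : Fin n) (j : Fin b) :
    tensorCoact A.coact B.coact (Pi.single i 1 ⊗ₜ Pi.single j 1) =
      ∑ p, ∑ q, mul (k := k) (A.entry i p ⊗ₜ B.entry j q) ⊗ₜ (Pi.single p 1 ⊗ₜ Pi.single q 1) := by
  simp only [tensorCoact, LinearMap.comp_apply, coactProd_tmul, coact_single,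
    TensorProduct.sum_tmul, TensorProduct.tmul_sum, map_sum,
    TensorProduct.tensorTensorTensorComm_tmul, LinearMap.rTensor_tmul]
  exact Finset.sum_comm

lemma sum_s_α (i j : Fin n) : ∑ p, ∑ q, α (k := k) (A.entry p q) •
    mul (k := k) (s (k := k) (A.entry i p) ⊗ₜ A.entry q j) = α (k := k) (A.entry i j) • one k := by
  simpa [contractMid_entry] using s_α (k := k) (A.entry i j)

lemma sum_β_s (i j : Fin n) : ∑ p, ∑ q, β (k := k) (A.entry p q) •
    mul (k := k) (A.entry i p ⊗ₜ s (k := k) (A.entry q j)) = β (k := k) (A.entry i j) • one k := by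
  simpa [contractMid_entry] using β_s (k := k) (A.entry i j)

lemma sum_σ (i j : Fin n) : ∑ p, ∑ q, ∑ r, ∑ t, β (k := k) (A.entry p q) * (α (k := k) (A.entry r t)
      * σ (k := k) (A.entry i p ⊗ₜ (s (k := k) (A.entry q r) ⊗ₜ A.entry t j))) =
    if i = j then 1 else 0 := by
  rw [← A.counit_entry, ← σ_βα]
  simp [contractMid_entry, TensorProduct.tmul_sum, Finset.mul_sum]

lemma sum_σinv (i j : Fin n) : ∑ p, ∑ q, ∑ r, ∑ t, α (k := k) (A.entry p q) *
      (β (k := k) (A.entry r t) * σinv (k := k)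
        (s (k := k) (A.entry i p) ⊗ₜ (A.entry q r ⊗ₜ s (k := k) (A.entry t j)))) =
    if i = j then 1 else 0 := by
  rw [← A.counit_entry, ← σinv_αβ]
  simp [contractMid_entry, TensorProduct.tmul_sum, Finset.mul_sum]

lemma sum_comm₄ {ι κ M : Type*} [Fintype ι] [Fintype κ] [AddCommMonoid M]
    (f : ι → ι → κ → κ → M) : ∑ a, ∑ b, ∑ c, ∑ d, f a b c d = ∑ c, ∑ d, ∑ a, ∑ b, f a b c d := by
  rw [Finset.sum_comm_cycle]
  exact Finset.sum_congr rfl fun c _ => Finset.sum_comm_cycle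

/-- The coevaluation is colinear, as `s(h₁)α(h₂)h₃ = α(h)1`. -/
lemma tensorCoact_coev : tensorCoact A.dual.coact A.coact (A.coev 1) =
    one k ⊗ₜ A.coev 1 := by
  simp only [coev_one, map_sum, map_smul, tensorCoact_single,
    dual_entry, TensorProduct.tmul_sum, TensorProduct.tmul_smul, Finset.smul_sum]
  rw [sum_comm₄]
  refine Finset.sum_congr rfl fun p _ => Finset.sum_congr rfl fun q _ => ?_
  rw [TensorProduct.smul_tmul', ← sum_s_α]
  simp only [TensorProduct.sum_tmul, TensorProduct.smul_tmul']

/-- The evaluation is colinear, as `h₁β(h₂)s(h₃) = β(h)1`. -/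
lemma lTensor_ev (i j : Fin n) : A.ev.lTensor H (tensorCoact A.coact A.dual.coact
    (Pi.single i 1 ⊗ₜ Pi.single j 1)) = β (k := k) (A.entry i j) • one (H := H) k ⊗ₜ[k] 1 := by
  simp only [map_sum, tensorCoact_single, dual_entry, LinearMap.lTensor_tmul, ev_single]
  rw [TensorProduct.smul_tmul', ← sum_β_s]
  simp only [TensorProduct.sum_tmul]
  refine Finset.sum_congr rfl fun p _ => Finset.sum_congr rfl fun q _ => ?_
  rw [← TensorProduct.smul_tmul', ← TensorProduct.tmul_smul, smul_eq_mul, _root_.mul_one]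

/-- The first triangle identity, which is the axiom `σ(h₁β(h₂), s(h₃), α(h₄)h₅) = ε(h)`. -/
lemma coev_ev (i : Fin n) : A.ev.rTensor _ (assocInvMap A.coact A.dual.coact A.coact
    (Pi.single i 1 ⊗ₜ A.coev 1)) = 1 ⊗ₜ Pi.single i 1 := by
  apply (TensorProduct.lid k _).injective
  ext j
  simp only [coev_one, assocInvMap, LinearMap.comp_apply, TensorProduct.tmul_sum, map_sum,
    TensorProduct.tmul_smul, map_smul, twist_single, LinearEquiv.coe_coe,
    TensorProduct.assoc_symm_tmul, LinearMap.rTensor_tmul, ev_single, TensorProduct.lid_tmul,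
    Finset.sum_apply, Pi.smul_apply, Pi.single_apply, smul_eq_mul, mul_ite, _root_.mul_one,
    mul_zero, dual_entry, Finset.sum_ite_eq, Finset.mem_univ, if_true, Finset.mul_sum]
  rw [sum_comm₄]
  simp only [@eq_comm _ j i]
  rw [← A.sum_σ]
  refine Finset.sum_congr rfl fun p _ => Finset.sum_congr rfl fun q _ =>
    Finset.sum_congr rfl fun r _ => Finset.sum_congr rfl fun t _ => ?_
  ring

/-- The second triangle identity, which is the axiom `σ⁻¹(s(h₁), α(h₂)h₃, β(h₄)s(h₅)) = ε(h)`. -/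
lemma ev_coev (i : Fin n) : A.ev.lTensor _ (assocMap A.dual.coact A.coact A.dual.coact
    (A.coev 1 ⊗ₜ Pi.single i 1)) = Pi.single i 1 ⊗ₜ 1 := by
  apply (TensorProduct.rid k _).injective
  ext j
  simp only [coev_one, assocMap, LinearMap.comp_apply, TensorProduct.sum_tmul, map_sum,
    ← TensorProduct.smul_tmul', map_smul, twist_single, LinearEquiv.coe_coe,
    TensorProduct.assoc_tmul, LinearMap.lTensor_tmul, ev_single, TensorProduct.rid_tmul,
    Finset.sum_apply, Pi.smul_apply, Pi.single_apply, smul_eq_mul, mul_ite, _root_.mul_one,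
    mul_zero, dual_entry, Finset.mul_sum]
  rw [← A.sum_σinv]
  refine Finset.sum_congr rfl fun p _ => Finset.sum_congr rfl fun q _ => ?_
  rw [Finset.sum_eq_single j (fun b _ hb => by simp [hb.symm]) (by simp)]
  simp only [if_true]
  refine Finset.sum_congr rfl fun r _ => Finset.sum_congr rfl fun t _ => ?_
  ring

/-- The comodule with matrix coefficients `s (h j i)` is a dual of the one with coefficients
`h i j`; the triangle identities are the axioms relating `σ`, `α` and `β`. -/
noncomputable instance exactPairing : ExactPairing A.dual.toComod A.toComod where
  coevaluation' := ⟨A.coev, by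
    refine LinearMap.ext_ring ?_
    refine A.tensorCoact_coev.trans ?_
    change _ = A.coev.lTensor H (unitCoact k H 1)
    rw [unitCoact, LinearMap.toSpanSingleton_apply, one_smul, LinearMap.lTensor_tmul]⟩
  evaluation' := ⟨A.ev, by
    refine TensorProduct.ext ((Pi.basisFun k _).ext fun i => (Pi.basisFun k _).ext fun j => ?_)
    rw [Pi.basisFun_apply, Pi.basisFun_apply]
    refine Eq.trans ?_ (A.lTensor_ev i j).symm
    change unitCoact k H (A.ev (Pi.single i 1 ⊗ₜ Pi.single j 1)) = _
    rw [A.ev_single, unitCoact, LinearMap.toSpanSingleton_apply]⟩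
  coevaluation_evaluation' := by
    ext1
    refine TensorProduct.ext ((Pi.basisFun k _).ext fun i => LinearMap.ext_ring ?_)
    rw [Pi.basisFun_apply]
    refine Eq.trans (A.coev_ev i) ?_
    change _ = (TensorProduct.lid k (Fin n → k)).symm
      (TensorProduct.rid k (Fin n → k) (Pi.single i 1 ⊗ₜ 1))
    simp
  evaluation_coevaluation' := by
    ext1
    refine TensorProduct.ext (LinearMap.ext_ring ((Pi.basisFun k _).ext fun i => ?_))
    rw [Pi.basisFun_apply]
    refine Eq.trans (A.ev_coev i) ?_
    change _ = (TensorProduct.rid k (Fin n → k)).symm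
      (TensorProduct.lid k (Fin n → k) (1 ⊗ₜ Pi.single i 1))
    simp

section

variable [BijectiveAntipode k H]

@[simp]
lemma s_antipodeInv (h : H) : s (k := k) (antipodeInv k h) = h :=
  (LinearEquiv.ofBijective (s (k := k) (H := H)) BijectiveAntipode.bijective).apply_symm_apply h

@[simp]
lemma antipodeInv_s (h : H) : antipodeInv k (s (k := k) h) = h :=
  (LinearEquiv.ofBijective (s (k := k) (H := H)) BijectiveAntipode.bijective).symm_apply_apply h

/-- The matrix coefficients `s⁻¹ (h j i)`. -/
noncomputable def predual : MatrixCoefficients k H n where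
  entry i j := antipodeInv k (A.entry j i)
  comul_entry i j := by
    have hs : Function.Injective (TensorProduct.map (s (k := k) (H := H)) (s (k := k) (H := H)) ∘ₗ
        (TensorProduct.comm k H H).toLinearMap) := by
      have h : Function.Bijective (s (k := k) (H := H)) := BijectiveAntipode.bijective
      exact (TensorProduct.map_bijective h h).injective.comp (TensorProduct.comm k H H).injective
    have := LinearMap.congr_fun (comul_s (k := k) (H := H)) (antipodeInv k (A.entry j i))
    simp only [LinearMap.comp_apply] at this
    apply hs
    simp only [LinearMap.comp_apply, ← this]
    simp [A.comul_entry]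
  counit_entry i j := by
    have := LinearMap.congr_fun (counit_s (k := k) (H := H)) (antipodeInv k (A.entry j i))
    simp only [LinearMap.comp_apply] at this
    rw [← this, s_antipodeInv, A.counit_entry]
    simp only [eq_comm]

lemma predual_dual : A.predual.dual = A := by
  cases A
  simp [dual, predual]

/-- Every matrix comodule is a left dual, as the antipode is bijective. -/
noncomputable abbrev exactPairingPredual : ExactPairing A.toComod A.predual.toComod := by
  have := A.predual.exactPairing
  rwa [predual_dual] at this

end

end

end MatrixCoefficients

/-! ### Lax half-braidings of Yetter-Drinfeld modules -/

section Rearrange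

open MonoidalCategory

variable {C : Type*} [Category C] [MonoidalCategory C] {M U V : C}

/-- The hexagon axiom with the associativity constraints moved to one side. -/
lemma right_hexagon_rearrange {b : M ⊗ (U ⊗ V) ⟶ (U ⊗ V) ⊗ M} {c : M ⊗ U ⟶ U ⊗ M}
    {d : M ⊗ V ⟶ V ⊗ M} : (α_ M U V).hom ≫ b ≫ (α_ U V M).hom =
      c ▷ V ≫ (α_ U M V).hom ≫ U ◁ d ↔
    b = (α_ M U V).inv ≫ c ▷ V ≫ (α_ U M V).hom ≫ U ◁ d ≫ (α_ U V M).inv := by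
  constructor
  · intro h
    rw [← reassoc_of% h]
    simp
  · rintro rfl
    simp

lemma left_hexagon_rearrange {b : (U ⊗ V) ⊗ M ⟶ M ⊗ (U ⊗ V)} {c : U ⊗ M ⟶ M ⊗ U}
    {d : V ⊗ M ⟶ M ⊗ V} : (α_ U V M).inv ≫ b ≫ (α_ M U V).inv =
      U ◁ d ≫ (α_ U M V).inv ≫ c ▷ V ↔
    b = (α_ U V M).hom ≫ U ◁ d ≫ (α_ U M V).inv ≫ c ▷ V ≫ (α_ M U V).hom := by
  constructor
  · intro h
    rw [← reassoc_of% h]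
    simp
  · rintro rfl
    simp

end Rearrange

section InvertibleCross

open MonoidalCategory DualQuasiBialgebra

variable {k H : Type u} [Field k] [AddCommGroup H] [Module k H] [Coalgebra k H]

/-- The comodule underlying a Yetter-Drinfeld module. -/
abbrev YDData.IsComodule.toComod {M : YDData k H} (h : M.IsComodule) : LComod k H :=
  ⟨M.carrier, M.coact, h.coassoc, h.counit⟩

section

variable [DualQuasiBialgebra k H]

/-- The maps `m ⊗ x ↦ x₀ ⊗ m · x₋₁` of a right-left Yetter-Drinfeld module. -/
noncomputable def IsRightLeftYD.laxHalfBraiding {M : YDData k H} (h : IsRightLeftYD M) :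
    RightLaxHalfBraiding h.toComod where
  β U := ⟨crossRight M.act U.coact, (right_compat_iff M.act M.coact).1 h.compat U⟩
  naturality f := by
    ext1
    exact crossRight_comp_map M.act f.colinear
  monoidal U V := by
    refine right_hexagon_rearrange.1 (LComod.hom_ext ?_)
    exact (right_hexagon_iff M.act M.coact).1 h.act_act U V
  unit := by
    ext1
    exact (right_unit_iff M.act).1 h.act_one

/-- The maps `x ⊗ m ↦ x₋₁ · m ⊗ x₀` of a left-left Yetter-Drinfeld module. -/
noncomputable def IsLeftLeftYD.laxHalfBraiding {M : YDData k H} (h : IsLeftLeftYD M) :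
    LeftLaxHalfBraiding h.toComod where
  β U := ⟨crossLeft M.act U.coact, (left_compat_iff M.act M.coact).1 h.compat U⟩
  naturality f := by
    ext1
    exact crossLeft_comp_map M.act f.colinear
  monoidal U V := by
    refine left_hexagon_rearrange.1 (LComod.hom_ext ?_)
    exact (left_hexagon_iff M.act M.coact).1 h.act_act U V
  unit := by
    ext1
    exact (left_unit_iff M.act).1 h.one_act

end

variable [DualQuasiHopfAlgebra k H]

/-- A lax half-braiding on a comodule is invertible: by naturality and local finiteness this can be
checked on matrix comodules, which have duals. -/
lemma LeftLaxHalfBraiding.bijective [BijectiveAntipode k H] {M : LComod k H}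
    (b : LeftLaxHalfBraiding M) (X : LComod k H) : Function.Bijective (b.β X).lin := by
  have hA : ∀ {n} (A : MatrixCoefficients k H n), Function.Bijective (b.β A.toComod).lin := by
    intro n A
    have := A.exactPairingPredual
    have h1 := congrArg LComod.Hom.lin (b.hom_inv A.toComod A.predual.toComod)
    have h2 := congrArg LComod.Hom.lin (b.inv_hom A.toComod A.predual.toComod)
    exact Function.bijective_iff_has_inverse.2
      ⟨_, fun x => LinearMap.congr_fun h1 x, fun x => LinearMap.congr_fun h2 x⟩
  have nat : ∀ {X Y : LComod k H} (f : X ⟶ Y) (v : X.carrier ⊗[k] M.carrier),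
      (b.β Y).lin (f.lin.rTensor M.carrier v) = f.lin.lTensor M.carrier ((b.β X).lin v) :=
    fun f v => LinearMap.congr_fun (congrArg LComod.Hom.lin (b.naturality f)) v
  constructor
  · refine (injective_iff_map_eq_zero _).2 fun t ht => ?_
    obtain ⟨n, A, f, v, hf, rfl⟩ := X.exists_matrixCoefficients t
    have h0 := (nat f v).symm.trans ht
    rw [← map_zero (f.lin.lTensor M.carrier)] at h0
    have h1 := Module.Flat.lTensor_preserves_injective_linearMap f.lin hf h0
    rw [← map_zero (b.β A.toComod).lin] at h1
    rw [(hA A).1 h1]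
    exact map_zero _
  · intro t
    obtain ⟨n, A, f, v, hf, hv⟩ := X.exists_matrixCoefficients
      (TensorProduct.comm k M.carrier X.carrier t)
    obtain ⟨w, hw⟩ := (hA A).2 (TensorProduct.comm k _ _ v)
    refine ⟨f.lin.rTensor M.carrier w, ?_⟩
    refine (nat f w).trans ((congrArg _ hw).trans ?_)
    apply (TensorProduct.comm k M.carrier X.carrier).injective
    rw [← hv]
    exact (congrArg (TensorProduct.comm k M.carrier X.carrier) (TensorProduct.map_comm
      (LinearMap.id : M.carrier →ₗ[k] M.carrier) f.lin v)).trans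
      ((TensorProduct.comm k X.carrier M.carrier).symm_apply_apply _)

end InvertibleCross

/-! ### The inverse half-braiding on matrix comodules -/

section HitLinear

variable {k : Type u} [Field k] {C X : Type u} [AddCommGroup C] [Module k C] [AddCommGroup X]
  [Module k X]

lemma hit_sum {ι : Type*} (s : Finset ι) (φ : ι → C →ₗ[k] k) (ρ : X →ₗ[k] C ⊗[k] X) (x : X) :
    hit (∑ i ∈ s, φ i) ρ x = ∑ i ∈ s, hit (φ i) ρ x := by
  simp only [hit, LinearMap.comp_apply]
  generalize ρ x = t
  induction t with
  | zero => simp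
  | add t t' h h' => simp only [map_add, h, h', Finset.sum_add_distrib]
  | tmul c y => simp [Finset.sum_smul]

lemma hit_smul (a : k) (φ : C →ₗ[k] k) (ρ : X →ₗ[k] C ⊗[k] X) (x : X) :
    hit (a • φ) ρ x = a • hit φ ρ x := by
  simp [hit]

end HitLinear

namespace MatrixCoefficients

open DualQuasiBialgebra DualQuasiHopfAlgebra MonoidalCategory

variable {k H : Type u} [Field k] [AddCommGroup H] [Module k H] [Coalgebra k H]

/-- The linear form `b ↦ φ(a, b, c)`. -/
noncomputable def evalOuter (φ : H ⊗[k] (H ⊗[k] H) →ₗ[k] k) (a c : H) : H →ₗ[k] k :=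
  φ ∘ₗ TensorProduct.mk k H (H ⊗[k] H) a ∘ₗ (TensorProduct.mk k H H).flip c

omit [Coalgebra k H] in
@[simp]
lemma evalOuter_apply (φ : H ⊗[k] (H ⊗[k] H) →ₗ[k] k) (a b c : H) :
    evalOuter φ a c b = φ (a ⊗ₜ (b ⊗ₜ c)) := rfl

section

variable {n b c : ℕ} (A : MatrixCoefficients k H n) (B : MatrixCoefficients k H b)
  (C : MatrixCoefficients k H c) {M : Type u} [AddCommGroup M] [Module k M]

lemma twist_single_single (φ : H ⊗[k] (H ⊗[k] H) →ₗ[k] k) (μ : M →ₗ[k] H ⊗[k] M) (i : Fin n)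
    (j : Fin b) (m : M) : twist φ A.coact B.coact μ (Pi.single i 1 ⊗ₜ (Pi.single j 1 ⊗ₜ m)) =
      ∑ p, ∑ q, Pi.single p 1 ⊗ₜ (Pi.single q 1 ⊗ₜ
        hit (φ ∘ₗ TensorProduct.mk k H (H ⊗[k] H) (A.entry i p) ∘ₗ
          TensorProduct.mk k H H (B.entry j q)) μ m) := by
  simp only [twist, hit_single, TensorProduct.tmul_sum, LinearMap.comp_assoc]

lemma hit_single_right (φ : H ⊗[k] H →ₗ[k] k) (μ : M →ₗ[k] H ⊗[k] M) (j : Fin b) (m : M) :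
    hit φ (coactProd μ B.coact) (m ⊗ₜ Pi.single j 1) =
      ∑ q, hit (φ ∘ₗ (TensorProduct.mk k H H).flip (B.entry j q)) μ m ⊗ₜ Pi.single q 1 := by
  simp only [hit, LinearMap.comp_apply, coactProd_tmul, coact_single, TensorProduct.tmul_sum,
    map_sum]
  refine Finset.sum_congr rfl fun p _ => ?_
  generalize μ m = t
  induction t with
  | zero => simp
  | add t t' h h' => simp only [TensorProduct.add_tmul, map_add, h, h']
  | tmul a y => simp [TensorProduct.smul_tmul']

lemma twist_single_mid (φ : H ⊗[k] (H ⊗[k] H) →ₗ[k] k) (μ : M →ₗ[k] H ⊗[k] M) (i : Fin n)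
    (j : Fin b) (m : M) : twist φ A.coact μ B.coact (Pi.single i 1 ⊗ₜ (m ⊗ₜ Pi.single j 1)) =
      ∑ p, ∑ q, Pi.single p 1 ⊗ₜ (hit (evalOuter φ (A.entry i p) (B.entry j q)) μ m ⊗ₜ
        Pi.single q 1) := by
  simp only [twist, hit_single, hit_single_right, TensorProduct.tmul_sum, LinearMap.comp_assoc,
    evalOuter]

lemma crossRight_single (act : H →ₗ[k] M →ₗ[k] M) (j : Fin b) (m : M) :
    crossRight act B.coact (m ⊗ₜ Pi.single j 1) =
      ∑ q, Pi.single q 1 ⊗ₜ act (B.entry j q) m := by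
  simp [crossRight_tmul]

lemma crossLeft_single (act : H →ₗ[k] M →ₗ[k] M) (j : Fin b) (m : M) :
    crossLeft act B.coact (Pi.single j 1 ⊗ₜ m) =
      ∑ q, act (B.entry j q) m ⊗ₜ Pi.single q 1 := by
  simp [crossLeft_tmul]

lemma twist_tensor_single [DualQuasiBialgebra k H] (φ : H ⊗[k] (H ⊗[k] H) →ₗ[k] k)
    (μ : M →ₗ[k] H ⊗[k] M) (i : Fin n) (j : Fin b) (l : Fin c) (m : M) :
    twist φ (tensorCoact A.coact μ) B.coact C.coact
        ((Pi.single i 1 ⊗ₜ m) ⊗ₜ (Pi.single j 1 ⊗ₜ Pi.single l 1)) =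
      ∑ p, ∑ q, ∑ r, (Pi.single p 1 ⊗ₜ hit (φ ∘ₗ (TensorProduct.mk k H (H ⊗[k] H)).flip
        (B.entry j q ⊗ₜ C.entry l r) ∘ₗ mul ∘ₗ TensorProduct.mk k H H (A.entry i p)) μ m) ⊗ₜ
        (Pi.single q 1 ⊗ₜ Pi.single r 1) := by
  have h1 : tensorCoact A.coact μ (Pi.single i 1 ⊗ₜ m) = ∑ p, TensorProduct.map
      (mul ∘ₗ TensorProduct.mk k H H (A.entry i p))
      (TensorProduct.mk k (Fin n → k) M (Pi.single p 1)) (μ m) := by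
    simp only [tensorCoact, LinearMap.comp_apply, coactProd_tmul, coact_single,
      TensorProduct.sum_tmul, map_sum]
    refine Finset.sum_congr rfl fun p _ => ?_
    generalize μ m = t
    induction t with
    | zero => simp
    | add t t' h h' => simp only [TensorProduct.tmul_add, map_add, h, h']
    | tmul a y => simp
  simp only [twist, hit, LinearMap.comp_apply, coactProd_tmul, coact_single, h1,
    TensorProduct.tmul_sum, TensorProduct.sum_tmul, map_sum,
    TensorProduct.tensorTensorTensorComm_tmul]
  rw [Finset.sum_comm_cycle]
  refine Finset.sum_congr rfl fun p _ => ?_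
  rw [Finset.sum_comm]
  refine Finset.sum_congr rfl fun q _ => Finset.sum_congr rfl fun r _ => ?_
  generalize μ m = t
  induction t with
  | zero => simp
  | add t t' h h' => simp only [TensorProduct.tmul_add, TensorProduct.add_tmul, map_add, h, h']
  | tmul a y => simp [TensorProduct.smul_tmul']

end

section

variable [DualQuasiHopfAlgebra k H] {n : ℕ} (A : MatrixCoefficients k H n) {M : Type u}
  [AddCommGroup M] [Module k M]

lemma outerCoact_entry (i j : Fin n) : outerCoact k (A.entry i j) =
    ∑ p, ∑ q, (A.entry i p ⊗ₜ s (k := k) (A.entry q j)) ⊗ₜ A.entry p q := by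
  simp only [outerCoact, LinearMap.comp_apply, comul_entry, map_sum, LinearMap.lTensor_tmul,
    LinearEquiv.coe_coe, TensorProduct.comm_tmul, TensorProduct.tmul_sum,
    TensorProduct.assoc_symm_tmul, LinearMap.rTensor_tmul]

lemma outerTwist_entry (φ : H ⊗[k] (H ⊗[k] H) →ₗ[k] k) (M : YDData k H) (i j : Fin n)
    (m : M.carrier) : outerTwist φ M (A.entry i j ⊗ₜ m) =
      ∑ p, ∑ q, A.entry p q ⊗ₜ
        hit (evalOuter φ (A.entry i p) (s (k := k) (A.entry q j))) M.coact m := by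
  simp only [outerTwist, hit, LinearMap.comp_apply, coactProd_tmul, outerCoact_entry,
    TensorProduct.sum_tmul, map_sum]
  refine Finset.sum_congr rfl fun p _ => Finset.sum_congr rfl fun q _ => ?_
  generalize M.coact m = t
  induction t with
  | zero => simp
  | add t t' h h' => simp only [TensorProduct.tmul_add, map_add, h, h']
  | tmul a y => simp [TensorProduct.smul_tmul']

variable [BijectiveAntipode k H]

lemma innerAct_entry (M : YDData k H) (i j : Fin n) (m : M.carrier) :
    innerAct M (A.entry i j ⊗ₜ m) = ∑ p,
      hit (pL k ∘ₗ TensorProduct.mk k H H (s (k := k) (A.entry i p))) M.coact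
        (M.act (s (k := k) (A.entry p j)) m) := by
  simp only [innerAct, LinearMap.comp_apply, LinearMap.rTensor_tmul, comul_entry,
    TensorProduct.sum_tmul, map_sum, LinearEquiv.coe_coe, TensorProduct.assoc_tmul,
    LinearMap.lTensor_tmul, TensorProduct.lift.tmul]
  refine Finset.sum_congr rfl fun p _ => ?_
  simp only [contractAfter, hit, coactAfter, LinearMap.comp_apply, LinearMap.lTensor_tmul]
  generalize M.coact _ = t
  induction t with
  | zero => simp
  | add t t' h h' => simp only [TensorProduct.tmul_add, map_add, h, h']
  | tmul a y => simp

/-- `q^R(a, s(h)) = σ(a, s(h₁), α(h₂)h₃)`, for matrix coefficients. -/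
lemma qR_s_entry (a : H) (i j : Fin n) : qR k (a ⊗ₜ s (k := k) (A.entry i j)) =
    ∑ r, ∑ t, α (k := k) (A.entry r t) *
      σ (k := k) (a ⊗ₜ (s (k := k) (A.entry i r) ⊗ₜ A.entry t j)) := by
  have h := A.dual.contractMid_entry (α ∘ₗ antipodeInv k) j i
  simp only [dual_entry, LinearMap.comp_apply, antipodeInv_s] at h
  simp only [qR, LinearMap.comp_apply, LinearMap.lTensor_tmul, h, map_sum,
    map_smul, TensorProduct.tmul_sum,
    LinearMap.rTensor_tmul, LinearEquiv.coe_coe, TensorProduct.comm_tmul, antipodeInv_s,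
    TensorProduct.tmul_smul, smul_eq_mul]
  exact Finset.sum_comm

/-- `p^L(s(h), a) = σ(h₁β(h₂), s(h₃), a)`, for matrix coefficients. -/
lemma pL_s_entry (a : H) (i j : Fin n) : pL k (s (k := k) (A.entry i j) ⊗ₜ a) =
    ∑ r, ∑ t, β (k := k) (A.entry r t) *
      σ (k := k) (A.entry i r ⊗ₜ (s (k := k) (A.entry t j) ⊗ₜ a)) := by
  have h := A.dual.contractMid_entry (β ∘ₗ antipodeInv k) j i
  simp only [dual_entry, LinearMap.comp_apply, antipodeInv_s] at h
  simp only [pL, LinearMap.comp_apply, LinearMap.rTensor_tmul, h, map_sum,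
    map_smul, TensorProduct.sum_tmul, ← TensorProduct.smul_tmul',
    LinearEquiv.coe_coe, TensorProduct.comm_tmul, antipodeInv_s,
    TensorProduct.assoc_tmul, smul_eq_mul]
  exact Finset.sum_comm

lemma transferAct_entry (M : YDData k H) (i j : Fin n) (m : M.carrier) :
    transferAct M (A.entry i j) m = ∑ p, ∑ q, ∑ p', ∑ q', ∑ l,
      hit (pL k ∘ₗ TensorProduct.mk k H H (s (k := k) (A.entry p' l))) M.coact
        (M.act (s (k := k) (A.entry l q'))
          (hit (evalOuter σinv (A.entry p p') (s (k := k) (A.entry q' q))) M.coact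
            (hit (evalOuter (qR k ∘ₗ mul.rTensor H ∘ₗ
              (TensorProduct.assoc k H H H).symm.toLinearMap) (A.entry i p)
                (s (k := k) (A.entry q j))) M.coact m))) := by
  simp only [transferAct, TensorProduct.curry_apply, LinearMap.comp_apply, outerTwist_entry,
    innerAct_entry, map_sum]

/-- The coevaluation and the first associativity constraint in the inverse of the half-braiding
give the factor `q^R` of `▷`. -/
lemma assocInvMap_coev (μ : M →ₗ[k] H ⊗[k] M) (i : Fin n) (m : M) :
    assocInvMap (tensorCoact A.coact μ) A.dual.coact A.coact ((Pi.single i 1 ⊗ₜ m) ⊗ₜ A.coev 1) =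
      ∑ p, ∑ q, ∑ j, ((Pi.single p 1 ⊗ₜ hit (evalOuter (qR k ∘ₗ mul.rTensor H ∘ₗ
        (TensorProduct.assoc k H H H).symm.toLinearMap) (A.entry i p) (s (k := k) (A.entry q j)))
          μ m) ⊗ₜ Pi.single q 1) ⊗ₜ Pi.single j 1 := by
  have key : ∀ p q j, evalOuter (qR k ∘ₗ mul.rTensor H ∘ₗ
        (TensorProduct.assoc k H H H).symm.toLinearMap) (A.entry i p) (s (k := k) (A.entry q j)) =
      ∑ r, ∑ t, α (k := k) (A.entry r t) • (σ ∘ₗ (TensorProduct.mk k H (H ⊗[k] H)).flip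
        (s (k := k) (A.entry q r) ⊗ₜ A.entry t j) ∘ₗ mul ∘ₗ
          TensorProduct.mk k H H (A.entry i p)) := fun p q j => LinearMap.ext fun b => by
    simp [qR_s_entry]
  simp only [key, hit_sum, hit_smul, coev_one, assocInvMap, LinearMap.comp_apply,
    TensorProduct.tmul_sum, TensorProduct.tmul_smul, map_sum, map_smul, twist_tensor_single,
    TensorProduct.sum_tmul, ← TensorProduct.smul_tmul', LinearEquiv.coe_coe,
    TensorProduct.assoc_symm_tmul, dual_entry, Finset.smul_sum]
  rw [sum_comm₄]
  exact Finset.sum_congr rfl fun p _ => Finset.sum_congr rfl fun q _ => Finset.sum_comm_cycle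

/-- The last associativity constraint and the evaluation in the inverse of the half-braiding give
the factor `p^L` of `▷`. -/
lemma ev_assocInvMap (μ : M →ₗ[k] H ⊗[k] M) (i j : Fin n) (m : M) :
    TensorProduct.lid k M (A.ev.rTensor M (assocInvMap A.coact A.dual.coact μ
      (Pi.single i 1 ⊗ₜ (Pi.single j 1 ⊗ₜ m)))) =
      hit (pL k ∘ₗ TensorProduct.mk k H H (s (k := k) (A.entry i j))) μ m := by
  have key : pL k ∘ₗ TensorProduct.mk k H H (s (k := k) (A.entry i j)) =
      ∑ r, ∑ t, β (k := k) (A.entry r t) • (σ ∘ₗ TensorProduct.mk k H (H ⊗[k] H) (A.entry i r) ∘ₗ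
        TensorProduct.mk k H H (s (k := k) (A.entry t j))) := LinearMap.ext fun b => by
    simp [pL_s_entry]
  simp only [key, hit_sum, hit_smul, assocInvMap, LinearMap.comp_apply, twist_single_single,
    map_sum, LinearEquiv.coe_coe, TensorProduct.assoc_symm_tmul, LinearMap.rTensor_tmul, ev_single,
    TensorProduct.lid_tmul, dual_entry]

/-- On a matrix comodule, the inverse of the half-braiding of a right-left Yetter-Drinfeld module
that is built from the dual is given by the action `▷`. -/
lemma laxHalfBraiding_inv {M : YDData k H} (h : IsRightLeftYD M) :
    (h.laxHalfBraiding.inv A.dual.toComod A.toComod).lin = crossLeft (transferAct M) A.coact := by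
  refine TensorProduct.ext ((Pi.basisFun k _).ext fun i => LinearMap.ext fun m => ?_)
  rw [Pi.basisFun_apply]
  simp only [LinearMap.compr₂ₛₗ_apply, TensorProduct.mk_apply]
  rw [crossLeft_single]
  let N : LComod k H := h.toComod
  -- The linear maps underlying the factors of the inverse, applied one after the other.
  change TensorProduct.map (TensorProduct.lid k M.carrier).toLinearMap LinearMap.id
    (TensorProduct.map (TensorProduct.map A.ev LinearMap.id) LinearMap.id
    (TensorProduct.map (assocInvMap A.coact A.dual.coact M.coact) LinearMap.id
    (TensorProduct.map (TensorProduct.map LinearMap.id (crossRight M.act A.dual.coact))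
      LinearMap.id
    (TensorProduct.map (assocMap A.coact M.coact A.dual.coact) LinearMap.id
    (assocInvMap (tensorCoact A.coact M.coact) A.dual.coact A.coact
    (TensorProduct.map LinearMap.id A.coev ((TensorProduct.rid k _).symm
      (Pi.single i 1 ⊗ₜ m)))))))) = _
  have h1 : ∀ (p q : Fin n) (m : M.carrier), TensorProduct.lid k M.carrier
      (TensorProduct.map A.ev LinearMap.id
      (assocInvMap A.coact A.dual.coact M.coact
      (TensorProduct.map LinearMap.id (crossRight M.act A.dual.coact)
      (assocMap A.coact M.coact A.dual.coact
        ((Pi.single p 1 ⊗ₜ m) ⊗ₜ Pi.single q 1))))) = ∑ p', ∑ q', ∑ l,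
      hit (pL k ∘ₗ TensorProduct.mk k H H (s (k := k) (A.entry p' l))) M.coact
        (M.act (s (k := k) (A.entry l q'))
          (hit (evalOuter σinv (A.entry p p') (s (k := k) (A.entry q' q))) M.coact m)) := by
    intro p q m
    have h2 := A.ev_assocInvMap M.coact
    rw [LinearMap.rTensor] at h2
    simp only [assocMap, LinearMap.comp_apply, LinearEquiv.coe_coe, TensorProduct.assoc_tmul,
      twist_single_mid, map_sum, TensorProduct.map_tmul, crossRight_single, dual_entry,
      TensorProduct.tmul_sum, LinearMap.id_apply, h2]
  rw [TensorProduct.rid_symm_apply, TensorProduct.map_tmul, LinearMap.id_apply, assocInvMap_coev]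
  simp only [map_sum, TensorProduct.map_tmul, LinearMap.id_apply, LinearEquiv.coe_coe, h1,
    transferAct_entry, TensorProduct.sum_tmul]
  exact Finset.sum_comm_cycle

end

end MatrixCoefficients

/-! ### Half-braidings and actions -/

section Representations

open MonoidalCategory DualQuasiBialgebra

variable {k H : Type u} [Field k] [AddCommGroup H] [Module k H] [Coalgebra k H]

section

variable [DualQuasiHopfAlgebra k H] [BijectiveAntipode k H]

/-- `u ⊗ m ↦ u₋₁ ▷ m ⊗ u₀` is inverse to `m ⊗ u ↦ u₀ ⊗ m · u₋₁`. -/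
lemma IsRightLeftYD.crossLeft_transferAct_comp_crossRight {M : YDData k H} (h : IsRightLeftYD M)
    (U : LComod k H) :
    crossLeft (transferAct M) U.coact ∘ₗ crossRight M.act U.coact = LinearMap.id := by
  refine LinearMap.ext fun t => ?_
  obtain ⟨n, A, f, v, -, hv⟩ := U.exists_matrixCoefficients
    (TensorProduct.comm k M.carrier U.carrier t)
  have h1 := LinearMap.congr_fun
    (congrArg LComod.Hom.lin (h.laxHalfBraiding.hom_inv A.dual.toComod A.toComod))
    (TensorProduct.comm k (Fin n → k) M.carrier v)
  rw [LComod.comp_lin, A.laxHalfBraiding_inv] at h1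
  have ht : t = TensorProduct.map LinearMap.id f.lin
      (TensorProduct.comm k (Fin n → k) M.carrier v) := by
    rw [TensorProduct.map_comm]
    exact (LinearEquiv.eq_symm_apply _).2 hv.symm
  have h2 := LinearMap.congr_fun (crossRight_comp_map M.act f.colinear)
    (TensorProduct.comm k (Fin n → k) M.carrier v)
  have h3 := LinearMap.congr_fun (crossLeft_comp_map (transferAct M) f.colinear)
    (crossRight M.act A.coact (TensorProduct.comm k (Fin n → k) M.carrier v))
  rw [ht]
  exact (congrArg (crossLeft (transferAct M) U.coact) h2).trans
    (h3.trans (congrArg (TensorProduct.map LinearMap.id f.lin) h1))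

lemma IsRightLeftYD.crossRight_comp_crossLeft_transferAct {M : YDData k H} (h : IsRightLeftYD M)
    (U : LComod k H) :
    crossRight M.act U.coact ∘ₗ crossLeft (transferAct M) U.coact = LinearMap.id := by
  refine LinearMap.ext fun t => ?_
  obtain ⟨n, A, f, v, -, rfl⟩ := U.exists_matrixCoefficients t
  have h1 := LinearMap.congr_fun
    (congrArg LComod.Hom.lin (h.laxHalfBraiding.inv_hom A.dual.toComod A.toComod)) v
  rw [LComod.comp_lin, A.laxHalfBraiding_inv] at h1
  have h2 := LinearMap.congr_fun (crossLeft_comp_map (transferAct M) f.colinear) v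
  have h3 := LinearMap.congr_fun (crossRight_comp_map M.act f.colinear)
    (crossLeft (transferAct M) A.coact v)
  exact (congrArg (crossRight M.act U.coact) h2).trans
    (h3.trans (congrArg (TensorProduct.map f.lin LinearMap.id) h1))

end

variable [DualQuasiBialgebra k H]

/-- The object of the Drinfeld center given by a half-braiding. -/
abbrev CategoryTheory.Center.of {C : Type*} [Category C] [MonoidalCategory C] {X : C}
    (b : HalfBraiding X) : Center C :=
  ⟨X, b⟩

lemma CategoryTheory.HalfBraiding.β_unit {C : Type*} [Category C] [MonoidalCategory C] {X : C}
    (b : HalfBraiding X) : (b.β (𝟙_ C)).hom = (ρ_ X).hom ≫ (λ_ X).inv := by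
  have := congrArg Center.Hom.f
    (braiding_tensorUnit_right (C := Center C) (Center.of b))
  exact this.trans (congrArg ((ρ_ X).hom ≫ ·) (Center.leftUnitor_inv_f (Center.of b)))

lemma CategoryTheory.HalfBraiding.inv_naturality {C : Type*} [Category C] [MonoidalCategory C]
    {X : C} (b : HalfBraiding X) {U V : C} (f : U ⟶ V) :
    f ▷ X ≫ (b.β V).inv = (b.β U).inv ≫ X ◁ f := by
  rw [Iso.eq_inv_comp, ← Category.assoc, ← b.naturality, Category.assoc, Iso.hom_inv_id,
    Category.comp_id]

/-- The half-braiding `b` of the comodule `M` is `m ⊗ u ↦ u₀ ⊗ m · u₋₁`. -/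
def RightRep (M : YDData k H) (h : M.IsComodule) (b : HalfBraiding h.toComod) : Prop :=
  ∀ U : LComod k H, (b.β U).hom.lin = crossRight M.act U.coact

/-- The inverse of the half-braiding `b` of the comodule `M` is `u ⊗ m ↦ u₋₁ · m ⊗ u₀`. -/
def LeftRep (M : YDData k H) (h : M.IsComodule) (b : HalfBraiding h.toComod) : Prop :=
  ∀ U : LComod k H, (b.β U).inv.lin = crossLeft M.act U.coact

lemma RightRep.isRightLeftYD {M : YDData k H} {h : M.IsComodule} {b : HalfBraiding h.toComod}
    (hb : RightRep M h b) : IsRightLeftYD M where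
  __ := h
  act_act := (right_hexagon_iff M.act M.coact).2 fun X Y => by
    have h1 := congrArg LComod.Hom.lin (right_hexagon_rearrange.2 (b.monoidal X Y))
    simp only [LComod.comp_lin, LComod.whiskerLeft_lin, LComod.whiskerRight_lin, hb X, hb Y,
      hb (X ⊗ Y)] at h1
    exact h1
  act_one := (right_unit_iff M.act).2 ((hb (𝟙_ _)).symm.trans (congrArg LComod.Hom.lin b.β_unit))
  compat := (right_compat_iff M.act M.coact).2 fun X => by
    have h1 := (b.β X).hom.colinear
    rw [hb X] at h1
    exact h1

lemma LeftRep.isLeftLeftYD {M : YDData k H} {h : M.IsComodule} {b : HalfBraiding h.toComod}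
    (hb : LeftRep M h b) : IsLeftLeftYD M where
  __ := h
  act_act := (left_hexagon_iff M.act M.coact).2 fun X Y => by
    have h1 : (α_ X Y h.toComod).inv ≫ (b.β (X ⊗ Y)).inv ≫ (α_ h.toComod X Y).inv =
        X ◁ (b.β Y).inv ≫ (α_ X h.toComod Y).inv ≫ (b.β X).inv ▷ Y := by
      rw [← IsIso.inv_eq_inv]
      simp [b.monoidal]
    have h2 := congrArg LComod.Hom.lin h1
    simp only [LComod.comp_lin, LComod.whiskerLeft_lin, LComod.whiskerRight_lin, hb X, hb Y,
      hb (X ⊗ Y)] at h2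
    exact h2
  one_act := (left_unit_iff M.act).2 ((hb (𝟙_ _)).symm.trans (congrArg LComod.Hom.lin
    (show (b.β (𝟙_ _)).inv = (λ_ _).hom ≫ (ρ_ _).inv by
      rw [← IsIso.inv_eq_inv]
      simp [b.β_unit])))
  compat := (left_compat_iff M.act M.coact).2 fun X => by
    have h1 := (b.β X).inv.colinear
    rw [hb X] at h1
    exact h1

lemma RightRep.unit (h : (unitData k H).IsComodule) :
    RightRep (unitData k H) h (Center.tensorUnit (C := LComod k H)).2 := fun U => by
  refine TensorProduct.ext' fun c x => ?_
  have h1 : ∀ t : H ⊗[k] U.carrier, TensorProduct.comm k k U.carrier (TensorProduct.map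
      ((LinearMap.mul k k ∘ₗ counit).flip c) LinearMap.id t) =
      (TensorProduct.lid k U.carrier (counit.rTensor U.carrier t)) ⊗ₜ c := fun t => by
    induction t with
    | zero => simp
    | add t t' h h' => simp only [map_add, h, h', TensorProduct.add_tmul]
    | tmul a y => simp [TensorProduct.smul_tmul]
  rw [crossRight_tmul, h1, U.isCoaction.counit_apply]
  change (c • x) ⊗ₜ (1 : k) = _
  rw [TensorProduct.smul_tmul, smul_eq_mul, _root_.mul_one]

lemma LeftRep.unit (h : (unitData k H).IsComodule) :
    LeftRep (unitData k H) h (Center.tensorUnit (C := LComod k H)).2 := fun U => by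
  refine TensorProduct.ext' fun x c => ?_
  have h1 : ∀ t : H ⊗[k] U.carrier, TensorProduct.map
      ((LinearMap.mul k k ∘ₗ counit).flip c) LinearMap.id t =
      c ⊗ₜ (TensorProduct.lid k U.carrier (counit.rTensor U.carrier t)) := fun t => by
    induction t with
    | zero => simp
    | add t t' h h' => simp only [map_add, h, h', TensorProduct.tmul_add]
    | tmul a y => simp [TensorProduct.smul_tmul', mul_comm]
  rw [crossLeft_tmul, h1, U.isCoaction.counit_apply]
  change (1 : k) ⊗ₜ (c • x) = _
  rw [← TensorProduct.smul_tmul, smul_eq_mul, _root_.mul_one]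

/-- The action on `M ⊗ N` is that of the tensor product of the half-braidings of `M` and `N`; by
`natural_ext_right` it suffices to compare the two on the regular comodule. -/
lemma RightRep.tensor {M N : YDData k H} {hM : M.IsComodule} {b : HalfBraiding hM.toComod}
    (hb : RightRep M hM b) {hN : N.IsComodule} {c : HalfBraiding hN.toComod}
    (hc : RightRep N hN c) (h : ((rightLeft k H).tensor M N).IsComodule) :
    RightRep ((rightLeft k H).tensor M N) h
      (Center.tensorObj (Center.of b) (Center.of c)).2 := by
  intro U
  refine natural_ext_right (k := k) (H := H)
    (F := fun U => ((Center.tensorObj (Center.of b) (Center.of c)).2.β U).hom.lin)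
    (G := fun U => crossRight (rightTensorAct M N) U.coact) ?_ ?_ ?_ U
  · intro X Y f
    exact congrArg LComod.Hom.lin ((Center.tensorObj (Center.of b) (Center.of c)).2.naturality f)
  · exact fun f => crossRight_comp_map _ f.colinear
  · refine TensorProduct.ext' fun m g => ?_
    refine Eq.trans ?_ (counitLeft_crossRight _ _ _).symm
    change counitLeft k H (M.carrier ⊗[k] N.carrier) (assocMap comul M.coact N.coact
      (TensorProduct.map (b.β (LComod.regular k H)).hom.lin LinearMap.id
      (assocInvMap M.coact comul N.coact
      (TensorProduct.map LinearMap.id (c.β (LComod.regular k H)).hom.lin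
      (assocMap M.coact N.coact comul (m ⊗ₜ g)))))) = _
    rw [counitLeft_assocMap, hb, hc]
    rfl

/-- The mirror image of `RightRep.tensor`, for the inverses of the half-braidings. -/
lemma LeftRep.tensor {M N : YDData k H} {hM : M.IsComodule} {b : HalfBraiding hM.toComod}
    (hb : LeftRep M hM b) {hN : N.IsComodule} {c : HalfBraiding hN.toComod}
    (hc : LeftRep N hN c) (h : ((leftLeft k H).tensor M N).IsComodule) :
    LeftRep ((leftLeft k H).tensor M N) h
      (Center.tensorObj (Center.of b) (Center.of c)).2 := by
  intro U
  refine natural_ext (k := k) (H := H)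
    (F := fun U => ((Center.tensorObj (Center.of b) (Center.of c)).2.β U).inv.lin)
    (G := fun U => crossLeft (leftTensorAct M N) U.coact) ?_ ?_ ?_ U
  · intro X Y f
    exact congrArg LComod.Hom.lin
      ((Center.tensorObj (Center.of b) (Center.of c)).2.inv_naturality f)
  · exact fun f => crossLeft_comp_map _ f.colinear
  · refine TensorProduct.ext' fun g m => ?_
    refine Eq.trans ?_ (counitRight_crossLeft _ _ _).symm
    have hinv : ((Center.tensorObj (Center.of b) (Center.of c)).2.β (LComod.regular k H)).inv.lin =
      assocInvMap M.coact N.coact comul ∘ₗ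
      TensorProduct.map LinearMap.id (c.β (LComod.regular k H)).inv.lin ∘ₗ
      assocMap M.coact comul N.coact ∘ₗ
      TensorProduct.map (b.β (LComod.regular k H)).inv.lin LinearMap.id ∘ₗ
      assocInvMap comul M.coact N.coact := rfl
    refine (congrArg (fun φ => counitRight k H _ (φ (g ⊗ₜ m))) hinv).trans ?_
    refine (counitRight_assocInvMap _ _ _).trans ?_
    rw [hb, hc]
    rfl

/-- A colinear map commutes with the actions exactly if it is a morphism in the Drinfeld center. -/
lemma RightRep.act_iff {M N : YDData k H} {hM : M.IsComodule} {b : HalfBraiding hM.toComod}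
    (hb : RightRep M hM b) {hN : N.IsComodule} {c : HalfBraiding hN.toComod}
    (hc : RightRep N hN c) (f : hM.toComod ⟶ hN.toComod) :
    (∀ h m, f.lin (M.act h m) = N.act h (f.lin m)) ↔
      ∀ U, f ▷ U ≫ (c.β U).hom = (b.β U).hom ≫ U ◁ f := by
  constructor
  · intro h U
    ext1
    simp only [LComod.comp_lin, LComod.whiskerLeft_lin, LComod.whiskerRight_lin, hb U, hc U]
    exact (map_comp_crossRight h U.coact).symm
  · intro h g m
    have h1 := LinearMap.congr_fun (congrArg LComod.Hom.lin (h (LComod.regular k H))) (m ⊗ₜ g)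
    simp only [LComod.comp_lin, LComod.whiskerLeft_lin, LComod.whiskerRight_lin, hb _, hc _,
      LinearMap.comp_apply] at h1
    have h2 := congrArg (counitLeft k H N.carrier) h1
    rw [← counitLeft_crossRight N.act, ← counitLeft_crossRight M.act]
    refine Eq.trans ?_ h2.symm
    generalize crossRight M.act (comul (R := k)) (m ⊗ₜ g) = t
    induction t with
    | zero => simp
    | add t t' h h' => simp only [map_add, h, h']
    | tmul a y => exact map_smul f.lin (counit a) y

lemma LeftRep.act_iff {M N : YDData k H} {hM : M.IsComodule} {b : HalfBraiding hM.toComod}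
    (hb : LeftRep M hM b) {hN : N.IsComodule} {c : HalfBraiding hN.toComod}
    (hc : LeftRep N hN c) (f : hM.toComod ⟶ hN.toComod) :
    (∀ h m, f.lin (M.act h m) = N.act h (f.lin m)) ↔
      ∀ U, f ▷ U ≫ (c.β U).hom = (b.β U).hom ≫ U ◁ f := by
  have hinv : (∀ U, f ▷ U ≫ (c.β U).hom = (b.β U).hom ≫ U ◁ f) ↔
      ∀ U, (b.β U).inv ≫ f ▷ U = U ◁ f ≫ (c.β U).inv :=
    forall_congr' fun U => by
      rw [Iso.eq_comp_inv, Category.assoc, Iso.inv_comp_eq]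
  rw [hinv]
  constructor
  · intro h U
    ext1
    simp only [LComod.comp_lin, LComod.whiskerLeft_lin, LComod.whiskerRight_lin, hb U, hc U]
    exact map_comp_crossLeft h U.coact
  · intro h g m
    have h1 := LinearMap.congr_fun (congrArg LComod.Hom.lin (h (LComod.regular k H))) (g ⊗ₜ m)
    simp only [LComod.comp_lin, LComod.whiskerLeft_lin, LComod.whiskerRight_lin, hb _, hc _,
      LinearMap.comp_apply] at h1
    have h2 := congrArg (counitRight k H N.carrier) h1
    rw [← counitRight_crossLeft N.act, ← counitRight_crossLeft M.act]
    refine Eq.trans ?_ h2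
    generalize crossLeft M.act (comul (R := k)) (g ⊗ₜ m) = t
    induction t with
    | zero => simp
    | add t t' h h' => simp only [map_add, h, h']
    | tmul a y => exact map_smul f.lin (counit y) a

end Representations

/-! ### Braided monoidal structures from the Drinfeld center -/

section CenterModels

open MonoidalCategory DualQuasiBialgebra

variable {k H : Type u} [Field k] [AddCommGroup H] [Module k H] [Coalgebra k H]
  [DualQuasiBialgebra k H]

/-- A relation `Rep M b` between modules of a given kind and half-braidings `b` of the underlying
comodules, which identifies the modules, the morphisms, the tensor products and the braiding with
those of the Drinfeld center of the category of comodules, with some braiding of the latter. -/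
structure CenterModel (K : YDKind k H) where
  Rep : ∀ (M : YDData k H) (h : M.IsComodule), HalfBraiding h.toComod → Prop
  braided : BraidedCategory (Center (LComod k H))
  isComodule : ∀ {M : YDData k H}, K.prop M → M.IsComodule
  exists_rep : ∀ {M : YDData k H} (h : K.prop M), ∃ b, Rep M (isComodule h) b
  prop_of_rep : ∀ {M : YDData k H} {h : M.IsComodule} {b : HalfBraiding h.toComod},
    Rep M h b → K.prop M
  unit : ∀ h : (unitData k H).IsComodule,
    Rep (unitData k H) h (Center.tensorUnit (C := LComod k H)).2
  tensor : ∀ {M N : YDData k H} {hM : M.IsComodule} {b : HalfBraiding hM.toComod}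
    (_ : Rep M hM b) {hN : N.IsComodule} {c : HalfBraiding hN.toComod} (_ : Rep N hN c)
    (h : (K.tensor M N).IsComodule), Rep (K.tensor M N) h
      (Center.tensorObj (Center.of b) (Center.of c)).2
  act_iff : ∀ {M N : YDData k H} {hM : M.IsComodule} {b : HalfBraiding hM.toComod}
    (_ : Rep M hM b) {hN : N.IsComodule} {c : HalfBraiding hN.toComod}
    (_ : Rep N hN c) (f : hM.toComod ⟶ hN.toComod),
    (∀ h m, f.lin (M.act h m) = N.act h (f.lin m)) ↔
      ∀ U, f ▷ U ≫ (c.β U).hom = (b.β U).hom ≫ U ◁ f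
  braid : ∀ {M N : YDData k H} {hM : M.IsComodule} {b : HalfBraiding hM.toComod}
    (_ : Rep M hM b) {hN : N.IsComodule} {c : HalfBraiding hN.toComod} (_ : Rep N hN c),
    (braided.braiding (Center.of b) (Center.of c)).hom.f.lin =
      K.braid M N

namespace CenterModel

lemma isComodule_tensor (K : YDKind k H) {M N : YDData k H} (hM : M.IsComodule)
    (hN : N.IsComodule) : (K.tensor M N).IsComodule :=
  have h := hM.toComod.isCoaction.tensor hN.toComod.isCoaction
  ⟨h.coassoc, h.counit⟩

lemma isComodule_unitData : (unitData k H).IsComodule :=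
  ⟨isCoaction_unitCoact.coassoc, isCoaction_unitCoact.counit⟩

variable {K : YDKind k H}

/-- A half-braiding representing `M`. -/
noncomputable def halfBraiding (C : CenterModel K) (M : K.Mod) :
    HalfBraiding (C.isComodule M.property).toComod :=
  (C.exists_rep M.property).choose

lemma rep (C : CenterModel K) (M : K.Mod) :
    C.Rep M.obj (C.isComodule M.property) (C.halfBraiding M) :=
  (C.exists_rep M.property).choose_spec

/-- The object of the Drinfeld center that represents `M`. -/
noncomputable def obj (C : CenterModel K) (M : K.Mod) : Center (LComod k H) :=
  Center.of (C.halfBraiding M)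

/-- The morphism in the Drinfeld center that represents `f`. -/
noncomputable def hom (C : CenterModel K) {M N : K.Mod} (f : M ⟶ N) : C.obj M ⟶ C.obj N :=
  ⟨⟨f.hom.lin, f.hom.isHom.coact⟩, (C.act_iff (C.rep M) (C.rep N) _).1 f.hom.isHom.act⟩

lemma isHom (C : CenterModel K) {M N : YDData k H} {hM : M.IsComodule} {b : HalfBraiding hM.toComod}
    (hb : C.Rep M hM b) {hN : N.IsComodule} {c : HalfBraiding hN.toComod} (hc : C.Rep N hN c)
    (f : Center.of b ⟶ Center.of c) :
    YDData.IsHom M N f.f.lin :=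
  ⟨f.f.colinear, (C.act_iff hb hc f.f).2 f.comm⟩

lemma rep_tensor (C : CenterModel K) (M N : K.Mod) : C.Rep (K.tensor M.obj N.obj)
    (isComodule_tensor K (C.isComodule M.property) (C.isComodule N.property))
    (Center.tensorObj (C.obj M) (C.obj N)).2 :=
  C.tensor (C.rep M) (C.rep N) _

lemma isClosed (C : CenterModel K) : K.IsClosed where
  tensor M N := C.prop_of_rep (C.rep_tensor M N)
  unit := C.prop_of_rep (C.unit isComodule_unitData)
  map M M' N N' f g := C.isHom (C.rep_tensor M N) (C.rep_tensor M' N')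
    (Center.tensorHom (C.hom f) (C.hom g))
  assoc M N P := C.isHom
    (C.tensor (C.rep_tensor M N) (C.rep P)
      (isComodule_tensor K (isComodule_tensor K (C.isComodule M.property)
        (C.isComodule N.property)) (C.isComodule P.property)))
    (C.tensor (C.rep M) (C.rep_tensor N P)
      (isComodule_tensor K (C.isComodule M.property) (isComodule_tensor K
        (C.isComodule N.property) (C.isComodule P.property))))
    (Center.associator (C.obj M) (C.obj N) (C.obj P)).hom
  assoc_bijective M N P := by
    let e := α_ (C.obj M).1 (C.obj N).1 (C.obj P).1
    exact Function.bijective_iff_has_inverse.2 ⟨e.inv.lin,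
      fun x => LinearMap.congr_fun (LComod.hom_inv_lin e) x,
      fun x => LinearMap.congr_fun (LComod.inv_hom_lin e) x⟩
  leftUnit M := C.isHom
    (C.tensor (C.unit isComodule_unitData) (C.rep M)
      (isComodule_tensor K isComodule_unitData (C.isComodule M.property)))
    (C.rep M) (Center.leftUnitor (C.obj M)).hom
  rightUnit M := C.isHom
    (C.tensor (C.rep M) (C.unit isComodule_unitData)
      (isComodule_tensor K (C.isComodule M.property) isComodule_unitData))
    (C.rep M) (Center.rightUnitor (C.obj M)).hom

omit [Coalgebra k H] [DualQuasiBialgebra k H] in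
lemma hom_ext {M N : K.Mod} {f g : M ⟶ N} (h : f.hom.lin = g.hom.lin) : f = g :=
  ObjectProperty.hom_ext _ (YDData.Hom.ext h)

lemma isMonoidal (C : CenterModel K) : K.IsMonoidal where
  __ := C.isClosed
  laws := ⟨{
    __ := C.isClosed.monoidalStruct
    tensorHom_def f g := hom_ext (congrArg LComod.Hom.lin (tensorHom_def (C.hom f).f (C.hom g).f))
    id_tensorHom_id M N := hom_ext (congrArg LComod.Hom.lin
      (id_tensorHom_id (C.obj M).1 (C.obj N).1))
    tensorHom_comp_tensorHom f g f' g' := hom_ext (congrArg LComod.Hom.lin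
      (tensorHom_comp_tensorHom (C.hom f).f (C.hom g).f (C.hom f').f (C.hom g').f))
    whiskerLeft_id M N := hom_ext (congrArg LComod.Hom.lin
      (whiskerLeft_id (C.obj M).1 (C.obj N).1))
    id_whiskerRight M N := hom_ext (congrArg LComod.Hom.lin
      (id_whiskerRight (C.obj M).1 (C.obj N).1))
    associator_naturality f g h := hom_ext (congrArg LComod.Hom.lin
      (associator_naturality (C.hom f).f (C.hom g).f (C.hom h).f))
    leftUnitor_naturality f := hom_ext (congrArg LComod.Hom.lin
      (leftUnitor_naturality (C.hom f).f))
    rightUnitor_naturality f := hom_ext (congrArg LComod.Hom.lin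
      (rightUnitor_naturality (C.hom f).f))
    pentagon M N P Q := hom_ext (congrArg LComod.Hom.lin
      (pentagon (C.obj M).1 (C.obj N).1 (C.obj P).1 (C.obj Q).1))
    triangle M N := hom_ext (congrArg LComod.Hom.lin (triangle (C.obj M).1 (C.obj N).1)) }, rfl⟩

/-- The braiding of the modules of kind `K`. -/
noncomputable def braiding (C : CenterModel K) (M N : K.Mod) :
    (⟨K.tensor M.obj N.obj, C.isClosed.tensor M N⟩ : K.Mod) ≅
      ⟨K.tensor N.obj M.obj, C.isClosed.tensor N M⟩ :=
  ObjectProperty.isoMk _ (YDData.isoOfBijective (M := K.tensor M.obj N.obj)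
    (N := K.tensor N.obj M.obj) ⟨K.braid M.obj N.obj, by
      rw [← C.braid (C.rep M) (C.rep N)]
      exact C.isHom (C.rep_tensor M N) (C.rep_tensor N M)
        (C.braided.braiding (C.obj M) (C.obj N)).hom⟩ (by
      let e := C.braided.braiding (C.obj M) (C.obj N)
      have h : K.braid M.obj N.obj = e.hom.f.lin := (C.braid (C.rep M) (C.rep N)).symm
      have h1 := congrArg (fun f => f.f.lin) e.hom_inv_id
      have h2 := congrArg (fun f => f.f.lin) e.inv_hom_id
      dsimp only
      rw [h]
      exact Function.bijective_iff_has_inverse.2 ⟨e.inv.f.lin,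
        fun x => LinearMap.congr_fun h1 x, fun x => LinearMap.congr_fun h2 x⟩))

lemma braid_lin (C : CenterModel K) (M N : K.Mod) : K.braid M.obj N.obj =
    (C.braided.braiding (C.obj M) (C.obj N)).hom.f.lin :=
  (C.braid (C.rep M) (C.rep N)).symm

lemma associator_inv_lin (C : CenterModel K) (M N P : K.Mod) :
    (C.isClosed.monoidalStruct.associator M N P).inv.hom.lin =
      assocInvMap M.obj.coact N.obj.coact P.obj.coact := by
  refine LinearMap.ext fun x => (C.isClosed.assoc_bijective M N P).1 ?_
  have h1 := LinearMap.congr_fun (congrArg (fun f => f.hom.lin)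
    (C.isClosed.monoidalStruct.associator M N P).inv_hom_id) x
  have h2 := LinearMap.congr_fun (LComod.inv_hom_lin (α_ (C.obj M).1 (C.obj N).1 (C.obj P).1)) x
  exact h1.trans h2.symm

lemma isBraidedMonoidal (C : CenterModel K) : K.IsBraidedMonoidal where
  __ := C.isMonoidal
  braided := by
    let _ := C.isMonoidal.monoidalCategory
    let _ := C.braided
    refine ⟨{
      braiding := C.braiding
      braiding_naturality_right := fun M N P f => hom_ext ?_
      braiding_naturality_left := fun {M N} f P => hom_ext ?_
      hexagon_forward := fun M N P => hom_ext ?_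
      hexagon_reverse := fun M N P => hom_ext ?_ }, fun M N => rfl⟩
    · change K.braid M.obj P.obj ∘ₗ TensorProduct.map LinearMap.id f.hom.lin =
        TensorProduct.map f.hom.lin LinearMap.id ∘ₗ K.braid M.obj N.obj
      rw [C.braid_lin, C.braid_lin]
      exact congrArg (fun f => f.f.lin)
        (BraidedCategory.braiding_naturality_right (C.obj M) (C.hom f))
    · change K.braid N.obj P.obj ∘ₗ TensorProduct.map f.hom.lin LinearMap.id =
        TensorProduct.map LinearMap.id f.hom.lin ∘ₗ K.braid M.obj P.obj
      rw [C.braid_lin, C.braid_lin]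
      exact congrArg (fun f => f.f.lin)
        (BraidedCategory.braiding_naturality_left (C.hom f) (C.obj P))
    · change (assocMap N.obj.coact P.obj.coact M.obj.coact ∘ₗ
          K.braid M.obj (K.tensor N.obj P.obj)) ∘ₗ
          assocMap M.obj.coact N.obj.coact P.obj.coact =
        (TensorProduct.map LinearMap.id (K.braid M.obj P.obj) ∘ₗ
          assocMap N.obj.coact M.obj.coact P.obj.coact) ∘ₗ
          TensorProduct.map (K.braid M.obj N.obj) LinearMap.id
      rw [C.braid_lin, C.braid_lin, ← C.braid (C.rep M) (C.rep_tensor N P)]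
      exact congrArg (fun f => f.f.lin)
        (BraidedCategory.hexagon_forward (C.obj M) (C.obj N) (C.obj P))
    · have h := congrArg (fun f => f.f.lin)
        (BraidedCategory.hexagon_reverse (C.obj M) (C.obj N) (C.obj P))
      change ((C.isClosed.monoidalStruct.associator P M N).inv.hom.lin ∘ₗ
          K.braid (K.tensor M.obj N.obj) P.obj) ∘ₗ
          (C.isClosed.monoidalStruct.associator M N P).inv.hom.lin =
        (TensorProduct.map (K.braid M.obj P.obj) LinearMap.id ∘ₗ
          (C.isClosed.monoidalStruct.associator M P N).inv.hom.lin) ∘ₗ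
          TensorProduct.map LinearMap.id (K.braid N.obj P.obj)
      rw [C.braid_lin, C.braid_lin, ← C.braid (C.rep_tensor M N) (C.rep P),
        C.associator_inv_lin, C.associator_inv_lin, C.associator_inv_lin]
      simp only [Center.comp_f, Center.associator_inv_f] at h
      exact h

end CenterModel

end CenterModels

/-! ### The two models of the Drinfeld center and the transfer functor -/

section

open MonoidalCategory

variable {C : Type*} [Category C] [MonoidalCategory C] {M : C}

/-- The half-braiding formed by the inverses of a family of isomorphisms `U ⊗ M ⟶ M ⊗ U`. -/
def LeftLaxHalfBraiding.toHalfBraiding (b : LeftLaxHalfBraiding M) (i : ∀ U : C, U ⊗ M ≅ M ⊗ U)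
    (hi : ∀ U, (i U).hom = b.β U) : HalfBraiding M where
  β U := (i U).symm
  monoidal U V := by
    have h := b.monoidal U V
    rw [← hi, ← hi, ← hi] at h
    rw [← cancel_epi (i (U ⊗ V)).hom, Iso.symm_hom, Iso.hom_inv_id, h]
    simp
  naturality {U V} f := by
    have h := b.naturality f
    rw [← hi, ← hi] at h
    rw [← cancel_epi (i U).hom, ← cancel_mono (i V).hom]
    simp [h]

end

section Models

open MonoidalCategory DualQuasiBialgebra

variable {k H : Type u} [Field k] [AddCommGroup H] [Module k H] [Coalgebra k H]
  [DualQuasiHopfAlgebra k H] [BijectiveAntipode k H]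

variable (k H) in
/-- Right-left Yetter-Drinfeld modules form the Drinfeld center of the category of comodules. -/
noncomputable def rightModel : CenterModel (rightLeft k H) where
  Rep := RightRep
  braided := inferInstance
  isComodule h := h.toIsComodule
  exists_rep {M} h := ⟨{
    β U := LComod.isoMk (h.laxHalfBraiding.β U) (crossLeft (transferAct M) U.coact)
      (h.crossLeft_transferAct_comp_crossRight U) (h.crossRight_comp_crossLeft_transferAct U)
    monoidal := h.laxHalfBraiding.monoidal
    naturality := h.laxHalfBraiding.naturality }, fun _ => rfl⟩
  prop_of_rep h := h.isRightLeftYD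
  unit := RightRep.unit
  tensor := RightRep.tensor
  act_iff := RightRep.act_iff
  braid hb _ _ _ := hb _

lemma IsLeftLeftYD.exists_leftRep {M : YDData k H} (h : IsLeftLeftYD M) :
    ∃ b, LeftRep M h.toIsComodule b := by
  let e (U : LComod k H) := LinearEquiv.ofBijective _ (h.laxHalfBraiding.bijective U)
  let i (U : LComod k H) : U ⊗ h.toComod ≅ h.toComod ⊗ U :=
    LComod.isoMk (h.laxHalfBraiding.β U) (e U).symm.toLinearMap
      (LinearMap.ext fun x => (e U).symm_apply_apply x)
      (LinearMap.ext fun x => (e U).apply_symm_apply x)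
  exact ⟨h.laxHalfBraiding.toHalfBraiding i fun _ => rfl, fun _ => rfl⟩

variable (k H) in
/-- Left-left Yetter-Drinfeld modules form the Drinfeld center of the category of comodules, with
the reversed braiding. -/
noncomputable def leftModel : CenterModel (leftLeft k H) where
  Rep := LeftRep
  braided := reverseBraiding _
  isComodule h := h.toIsComodule
  exists_rep h := h.exists_leftRep
  prop_of_rep h := h.isLeftLeftYD
  unit := LeftRep.unit
  tensor := LeftRep.tensor
  act_iff := LeftRep.act_iff
  braid {M N hM b hb hN c} hc := by
    refine Eq.trans ?_ (hc hM.toComod)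
    exact congrArg LComod.Hom.lin (show (β_ (Center.of c) (Center.of b)).inv.f =
      (c.β hM.toComod).inv from IsIso.Iso.inv_hom _)

/-- `M` and `T M` are given by the same half-braiding. -/
lemma RightRep.transferObj {M : YDData k H} {h : M.IsComodule} {b : HalfBraiding h.toComod}
    (hb : RightRep M h b) : LeftRep (transferObj M) ⟨h.coassoc, h.counit⟩ b := fun U => by
  have h1 := hb.isRightLeftYD.crossRight_comp_crossLeft_transferAct U
  rw [← hb U] at h1
  have h2 := LComod.hom_inv_lin (b.β U)
  calc (b.β U).inv.lin = (b.β U).inv.lin ∘ₗ ((b.β U).hom.lin ∘ₗ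
        crossLeft (transferAct M) U.coact) := by rw [h1, LinearMap.comp_id]
    _ = ((b.β U).inv.lin ∘ₗ (b.β U).hom.lin) ∘ₗ crossLeft (transferAct M) U.coact := rfl
    _ = crossLeft (transferAct M) U.coact := by rw [h2, LinearMap.id_comp]

variable (k H) in
lemma isTransfer : IsTransfer k H where
  obj M := ((rightModel k H).rep M).transferObj.isLeftLeftYD
  map M N f := ⟨f.hom.isHom.coact, (LeftRep.act_iff ((rightModel k H).rep M).transferObj
    ((rightModel k H).rep N).transferObj ((rightModel k H).hom f).f).2
      ((rightModel k H).hom f).comm⟩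

/-- The right action `n ⊗ h ↦ n · h` obtained from a half-braiding. -/
noncomputable def rightActOf {N : YDData k H} {h : N.IsComodule} (b : HalfBraiding h.toComod) :
    H →ₗ[k] N.carrier →ₗ[k] N.carrier :=
  LinearMap.flip (TensorProduct.curry
    (counitLeft k H N.carrier ∘ₗ (b.β (LComod.regular k H)).hom.lin))

/-- The comodule `N` with the right action obtained from a half-braiding. -/
noncomputable abbrev rightObjOf {N : YDData k H} {h : N.IsComodule}
    (b : HalfBraiding h.toComod) : YDData k H where
  carrier := N.carrier
  coact := N.coact
  act := rightActOf b

omit [BijectiveAntipode k H] in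
/-- Every half-braiding is given by a right action, by naturality. -/
lemma rightRep_rightObjOf {N : YDData k H} {h : N.IsComodule} (b : HalfBraiding h.toComod) :
    RightRep (rightObjOf b) ⟨h.coassoc, h.counit⟩ b := fun U => by
  refine natural_ext_right (k := k) (H := H) (F := fun U => (b.β U).hom.lin)
    (G := fun U => crossRight (rightActOf b) U.coact) ?_ ?_ ?_ U
  · exact fun f => congrArg LComod.Hom.lin (b.naturality f)
  · exact fun f => crossRight_comp_map _ f.colinear
  · exact TensorProduct.ext' fun n g => (counitLeft_crossRight (rightActOf b) g n).symm

omit [BijectiveAntipode k H] in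
lemma RightRep.act_eq {M : YDData k H} {h : M.IsComodule} {b : HalfBraiding h.toComod}
    (hb : RightRep M h b) : rightActOf b = M.act := by
  have h1 : (b.β (LComod.regular k H)).hom.lin = crossRight M.act comul := hb (LComod.regular k H)
  refine LinearMap.ext fun g => LinearMap.ext fun m => ?_
  rw [← counitLeft_crossRight M.act, ← h1]
  rfl

omit [BijectiveAntipode k H] in
/-- The left action is determined by the inverse of the half-braiding on the regular comodule. -/
lemma LeftRep.act_eq {M : YDData k H} {h : M.IsComodule} {b : HalfBraiding h.toComod}
    (hb : LeftRep M h b) {act : H →ₗ[k] M.carrier →ₗ[k] M.carrier}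
    (hact : (b.β (LComod.regular k H)).inv.lin = crossLeft act comul) : act = M.act := by
  have h1 : (b.β (LComod.regular k H)).inv.lin = crossLeft M.act comul := hb (LComod.regular k H)
  refine LinearMap.ext fun g => LinearMap.ext fun m => ?_
  rw [← counitRight_crossLeft M.act, ← counitRight_crossLeft act, ← hact, ← h1]

omit [BijectiveAntipode k H] in
/-- A half-braiding is determined by the left action it gives. -/
lemma LeftRep.unique {M : YDData k H} {h : M.IsComodule} {b c : HalfBraiding h.toComod}
    (hb : LeftRep M h b) (hc : LeftRep M h c) : b = c := by
  obtain ⟨β, _, _⟩ := b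
  obtain ⟨β', _, _⟩ := c
  have : β = β' := funext fun U => Iso.ext_inv (LComod.hom_ext ((hb U).trans (hc U).symm))
  subst this
  rfl

/-- The functor that replaces the actions by the given ones and keeps the comodules and maps. -/
noncomputable abbrev changeAct {K K' : YDKind k H}
    (act : ∀ M : K.Mod, H →ₗ[k] M.obj.carrier →ₗ[k] M.obj.carrier)
    (hp : ∀ M : K.Mod, K'.prop ⟨M.obj.carrier, M.obj.coact, act M⟩)
    (hmap : ∀ {M N : K.Mod} (f : M ⟶ N), YDData.IsHom ⟨M.obj.carrier, M.obj.coact, act M⟩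
      ⟨N.obj.carrier, N.obj.coact, act N⟩ f.hom.lin) : K.Mod ⥤ K'.Mod where
  obj M := ⟨⟨M.obj.carrier, M.obj.coact, act M⟩, hp M⟩
  map f := ObjectProperty.homMk ⟨f.hom.lin, hmap f⟩

omit [Coalgebra k H] [DualQuasiHopfAlgebra k H] [BijectiveAntipode k H] in
lemma changeAct_eq_id {K : YDKind k H}
    {act : ∀ M : K.Mod, H →ₗ[k] M.obj.carrier →ₗ[k] M.obj.carrier}
    {hp : ∀ M : K.Mod, K.prop ⟨M.obj.carrier, M.obj.coact, act M⟩}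
    {hmap : ∀ {M N : K.Mod} (f : M ⟶ N), YDData.IsHom ⟨M.obj.carrier, M.obj.coact, act M⟩
      ⟨N.obj.carrier, N.obj.coact, act N⟩ f.hom.lin}
    (h : ∀ M, act M = M.obj.act) : changeAct act hp hmap = 𝟭 K.Mod := by
  obtain rfl : act = fun M => M.obj.act := funext h
  rfl

/-- The right action on a left-left Yetter-Drinfeld module that is given by the same
half-braiding. -/
noncomputable def transferInvAct (N : (leftLeft k H).Mod) :
    H →ₗ[k] N.obj.carrier →ₗ[k] N.obj.carrier :=
  rightActOf ((leftModel k H).halfBraiding N)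

lemma rightRep_transferInvAct (N : (leftLeft k H).Mod) :
    RightRep ⟨N.obj.carrier, N.obj.coact, transferInvAct N⟩
      ⟨((leftModel k H).isComodule N.property).coassoc,
        ((leftModel k H).isComodule N.property).counit⟩ ((leftModel k H).halfBraiding N) :=
  rightRep_rightObjOf ((leftModel k H).halfBraiding N)

variable (k H) in
/-- The inverse of the functor `T`: both sides are given by half-braidings. -/
noncomputable def transferInv : (leftLeft k H).Mod ⥤ (rightLeft k H).Mod :=
  changeAct transferInvAct (fun N => (rightRep_transferInvAct N).isRightLeftYD)
    (fun {M N} f => ⟨f.hom.isHom.coact, (RightRep.act_iff (rightRep_transferInvAct M)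
      (rightRep_transferInvAct N) ((leftModel k H).hom f).f).2 ((leftModel k H).hom f).comm⟩)

lemma transferInvAct_functor_obj (M : (rightLeft k H).Mod) :
    transferInvAct ((isTransfer k H).functor.obj M) = M.obj.act := by
  rw [transferInvAct, ((leftModel k H).rep ((isTransfer k H).functor.obj M)).unique
    ((rightModel k H).rep M).transferObj]
  exact ((rightModel k H).rep M).act_eq

end Models

/-! ### The isomorphism of braided monoidal categories -/

section Transfer

open MonoidalCategory DualQuasiBialgebra

variable {k H : Type u} [Field k] [AddCommGroup H] [Module k H] [Coalgebra k H]
  [DualQuasiHopfAlgebra k H] [BijectiveAntipode k H]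

lemma functor_comp_transferInv :
    (isTransfer k H).functor ⋙ transferInv k H = 𝟭 (rightLeft k H).Mod := by
  let F := (isTransfer k H).functor ⋙ transferInv k H
  have h : F = changeAct (fun M => transferInvAct ((isTransfer k H).functor.obj M))
      (fun M => (F.obj M).property) (fun f => (F.map f).hom.isHom) := rfl
  exact h.trans (changeAct_eq_id transferInvAct_functor_obj)

lemma transferInv_comp_functor :
    transferInv k H ⋙ (isTransfer k H).functor = 𝟭 (leftLeft k H).Mod := by
  let F := transferInv k H ⋙ (isTransfer k H).functor
  have h : F = changeAct (fun N => transferAct ((transferInv k H).obj N).obj)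
      (fun M => (F.obj M).property) (fun f => (F.map f).hom.isHom) := rfl
  refine h.trans (changeAct_eq_id fun N => ?_)
  exact ((leftModel k H).rep N).act_eq
    ((rightRep_rightObjOf ((leftModel k H).halfBraiding N)).transferObj (LComod.regular k H))

/-- `T M ⊗ T N = T (M ⊗ N)`: both are given by the tensor product of the half-braidings of `M` and
`N`. -/
lemma leftTensorAct_transferObj (M N : (rightLeft k H).Mod) :
    leftTensorAct (transferObj M.obj) (transferObj N.obj) =
      transferAct ((rightLeft k H).tensor M.obj N.obj) := by
  have hM : RightRep M.obj _ _ := (rightModel k H).rep M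
  have hN : RightRep N.obj _ _ := (rightModel k H).rep N
  have h := CenterModel.isComodule_tensor (rightLeft k H) ((rightModel k H).isComodule M.property)
    ((rightModel k H).isComodule N.property)
  have h1 := (hM.tensor hN h).transferObj
  have h2 := hM.transferObj.tensor hN.transferObj ⟨h.coassoc, h.counit⟩
  exact LeftRep.act_eq h1 (h2 (LComod.regular k H))

lemma unit_act_transferObj : (unitData k H).act = transferAct (unitData k H) := by
  have h1 := (RightRep.unit (k := k) (H := H) CenterModel.isComodule_unitData).transferObj
  exact LeftRep.act_eq h1 (LeftRep.unit CenterModel.isComodule_unitData (LComod.regular k H))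

end Transfer

section ChangeAct

open MonoidalCategory

variable {k H : Type u} [Field k] [AddCommGroup H] [Module k H] [Coalgebra k H]
  [DualQuasiBialgebra k H] {K K' : YDKind k H}
  (act : ∀ M : K.Mod, H →ₗ[k] M.obj.carrier →ₗ[k] M.obj.carrier)
  (hp : ∀ M : K.Mod, K'.prop ⟨M.obj.carrier, M.obj.coact, act M⟩)
  (hmap : ∀ {M N : K.Mod} (f : M ⟶ N), YDData.IsHom ⟨M.obj.carrier, M.obj.coact, act M⟩
    ⟨N.obj.carrier, N.obj.coact, act N⟩ f.hom.lin)

/-- A functor that only changes the actions is strictly monoidal if the new actions on tensor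
products and on the unit object are the prescribed ones. -/
noncomputable def changeActCoreMonoidal (hK : K.IsMonoidal) (hK' : K'.IsMonoidal)
    (htensor : ∀ M N : K.Mod, K'.tensorAct ⟨M.obj.carrier, M.obj.coact, act M⟩
      ⟨N.obj.carrier, N.obj.coact, act N⟩ = act ⟨K.tensor M.obj N.obj, hK.tensor M N⟩)
    (hunit : (unitData k H).act = act ⟨unitData k H, hK.unit⟩) :
    letI := hK.monoidalCategory
    letI := hK'.monoidalCategory
    (changeAct act hp hmap).CoreMonoidal :=
  letI := hK.monoidalCategory
  letI := hK'.monoidalCategory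
  { εIso := ObjectProperty.isoMk _ (YDData.isoOfBijective (M := unitData k H)
      (N := ⟨k, (unitData k H).coact, act ⟨unitData k H, hK.unit⟩⟩) ⟨LinearMap.id, by
        refine ⟨by rw [LinearMap.lTensor_id]; rfl, fun h m => ?_⟩
        exact LinearMap.congr_fun (LinearMap.congr_fun hunit h) m⟩ Function.bijective_id)
    μIso := fun M N => ObjectProperty.isoMk _ (YDData.isoOfBijective
      (M := K'.tensor ⟨M.obj.carrier, M.obj.coact, act M⟩ ⟨N.obj.carrier, N.obj.coact, act N⟩)
      (N := ⟨M.obj.carrier ⊗[k] N.obj.carrier, tensorCoact M.obj.coact N.obj.coact,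
        act ⟨K.tensor M.obj N.obj, hK.tensor M N⟩⟩) ⟨LinearMap.id, by
        refine ⟨by rw [LinearMap.lTensor_id]; rfl, fun h m => ?_⟩
        exact LinearMap.congr_fun (LinearMap.congr_fun (htensor M N) h) m⟩ Function.bijective_id)
    μIso_hom_natural_left := fun f P => CenterModel.hom_ext
      ((LinearMap.id_comp _).trans (LinearMap.comp_id _).symm)
    μIso_hom_natural_right := fun P f => CenterModel.hom_ext
      ((LinearMap.id_comp _).trans (LinearMap.comp_id _).symm)
    associativity := fun M N P => CenterModel.hom_ext (by
      change (assocMap M.obj.coact N.obj.coact P.obj.coact ∘ₗ LinearMap.id) ∘ₗ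
          TensorProduct.map LinearMap.id LinearMap.id =
        (LinearMap.id ∘ₗ TensorProduct.map LinearMap.id LinearMap.id) ∘ₗ
          assocMap M.obj.coact N.obj.coact P.obj.coact
      rw [TensorProduct.map_id, TensorProduct.map_id]
      rfl)
    left_unitality := fun M => CenterModel.hom_ext (by
      change (TensorProduct.lid k M.obj.carrier).toLinearMap =
        ((TensorProduct.lid k M.obj.carrier).toLinearMap ∘ₗ LinearMap.id) ∘ₗ
          TensorProduct.map LinearMap.id LinearMap.id
      rw [TensorProduct.map_id]
      rfl)
    right_unitality := fun M => CenterModel.hom_ext (by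
      change (TensorProduct.rid k M.obj.carrier).toLinearMap =
        ((TensorProduct.rid k M.obj.carrier).toLinearMap ∘ₗ LinearMap.id) ∘ₗ
          TensorProduct.map LinearMap.id LinearMap.id
      rw [TensorProduct.map_id]
      rfl) }

/-- The functor is braided for the reversed braiding of its source if it turns the braiding into
the inverse of the braiding of its target. -/
lemma changeAct_braided (hK : K.IsBraidedMonoidal) (hK' : K'.IsBraidedMonoidal)
    (htensor : ∀ M N : K.Mod, K'.tensorAct ⟨M.obj.carrier, M.obj.coact, act M⟩
      ⟨N.obj.carrier, N.obj.coact, act N⟩ = act ⟨K.tensor M.obj N.obj, hK.tensor M N⟩)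
    (hunit : (unitData k H).act = act ⟨unitData k H, hK.unit⟩)
    (hbraid : ∀ M N : K.Mod, K'.braid ⟨M.obj.carrier, M.obj.coact, act M⟩
      ⟨N.obj.carrier, N.obj.coact, act N⟩ ∘ₗ K.braid N.obj M.obj = LinearMap.id) :
    letI : MonoidalCategory K.Mod := hK.monoidalCategory
    letI : MonoidalCategory K'.Mod := hK'.monoidalCategory
    letI : BraidedCategory K'.Mod := hK'.braidedCategory
    letI : BraidedCategory K.Mod :=
      letI : BraidedCategory K.Mod := hK.braidedCategory
      reverseBraiding K.Mod
    ∃ b : (changeAct act hp hmap).Braided,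
      (∀ M N : K.Mod, (b.μ M N).hom.lin =
        (LinearMap.id : M.obj.carrier ⊗[k] N.obj.carrier →ₗ[k] M.obj.carrier ⊗[k] N.obj.carrier)) ∧
      b.ε.hom.lin = (LinearMap.id : k →ₗ[k] k) := by
  let mK : MonoidalCategory K.Mod := hK.monoidalCategory
  let mK' : MonoidalCategory K'.Mod := hK'.monoidalCategory
  let bK' : BraidedCategory K'.Mod := hK'.braidedCategory
  let bK : BraidedCategory K.Mod := hK.braidedCategory
  let _ : BraidedCategory K.Mod := reverseBraiding K.Mod
  let m := changeActCoreMonoidal act hp hmap hK.toIsMonoidal hK'.toIsMonoidal htensor hunit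
  refine ⟨{ m.toMonoidal with braided := fun M N => CenterModel.hom_ext ?_ },
    fun _ _ => rfl, rfl⟩
  have h1 : (bK.braiding N M).hom.hom.lin = K.braid N.obj M.obj :=
    hK.braided.choose_spec N M
  have h2 : (bK'.braiding ((changeAct act hp hmap).obj M)
      ((changeAct act hp hmap).obj N)).hom.hom.lin = K'.braid ⟨M.obj.carrier, M.obj.coact, act M⟩
        ⟨N.obj.carrier, N.obj.coact, act N⟩ := hK'.braided.choose_spec _ _
  have h3 : (bK.braiding N M).hom.hom.lin ∘ₗ (bK.braiding N M).inv.hom.lin = LinearMap.id :=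
    congrArg (fun f => f.hom.lin) (bK.braiding N M).inv_hom_id
  change (bK.braiding N M).inv.hom.lin ∘ₗ LinearMap.id = LinearMap.id ∘ₗ
    (bK'.braiding ((changeAct act hp hmap).obj M) ((changeAct act hp hmap).obj N)).hom.hom.lin
  rw [h2, LinearMap.comp_id, LinearMap.id_comp]
  rw [h1] at h3
  have h4 := congrArg (fun g => g ∘ₗ (bK.braiding N M).inv.hom.lin) (hbraid M N)
  dsimp only at h4
  rw [LinearMap.comp_assoc, h3] at h4
  exact h4.symm

end ChangeAct

theorem proposition2p12 (k H : Type u) [Field k] [AddCommGroup H] [Module k H] [Coalgebra k H]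
    [DualQuasiHopfAlgebra k H] [BijectiveAntipode k H] :
    ∃ (hR : (rightLeft k H).IsBraidedMonoidal) (hL : (leftLeft k H).IsBraidedMonoidal)
      (hT : IsTransfer k H),
      letI : MonoidalCategory (rightLeft k H).Mod := hR.monoidalCategory
      letI : MonoidalCategory (leftLeft k H).Mod := hL.monoidalCategory
      letI : BraidedCategory (leftLeft k H).Mod := hL.braidedCategory
      letI : BraidedCategory (rightLeft k H).Mod :=
        letI : BraidedCategory (rightLeft k H).Mod := hR.braidedCategory
        reverseBraiding (rightLeft k H).Mod
      (∃ S : (leftLeft k H).Mod ⥤ (rightLeft k H).Mod,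
        hT.functor ⋙ S = 𝟭 (rightLeft k H).Mod ∧ S ⋙ hT.functor = 𝟭 (leftLeft k H).Mod) ∧
      ∃ b : hT.functor.Braided,
        (∀ M N : (rightLeft k H).Mod, (b.μ M N).hom.lin =
          (LinearMap.id : M.obj.carrier ⊗[k] N.obj.carrier →ₗ[k] M.obj.carrier ⊗[k] N.obj.carrier)) ∧
        b.ε.hom.lin = (LinearMap.id : k →ₗ[k] k) := by
  refine ⟨(rightModel k H).isBraidedMonoidal, (leftModel k H).isBraidedMonoidal, isTransfer k H,
    ⟨transferInv k H, functor_comp_transferInv, transferInv_comp_functor⟩, ?_⟩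
  refine changeAct_braided (K := rightLeft k H) (K' := leftLeft k H)
    (fun M => transferAct M.obj) (isTransfer k H).obj (fun f => (isTransfer k H).map _ _ f)
    (rightModel k H).isBraidedMonoidal (leftModel k H).isBraidedMonoidal
    leftTensorAct_transferObj unit_act_transferObj fun M N => ?_
  exact N.property.crossLeft_transferAct_comp_crossRight
    ⟨_, _, M.property.toIsComodule.toComod.isCoaction⟩
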